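/- **Proposition (Coxeter–Conway friezes).** Let $n\ge 1$ and let $T$ be a triangulation of the $(n+3)$-gon, i.e. a maximal set of pairwise non-crossing diagonals $D_1,\dots,D_n$; the vertices of the polygon are numbered clockwise by $\mathbb Z/(n+3)\mathbb Z$. Let $Q=Q_T$ be the quiver with vertices $1,\dots,n$ and an arrow $i\to j$ if and only if $D_i$ and $D_j$ are edges of a triangle of $T$ and the angle from $D_i$ to $D_j$ in this triangle is counterclockwise. Assume that $Q$ is an orientation of the Dynkin diagram $A_n$. *The Auslander–Reiten quiver.* Let $P_i$, $I_i$ be the indecomposable projective and injective representations of $Q$ over $\mathbb C$ attached to the vertex $i$. The vertices of the Auslander–Reiten quiver $\Gamma_{\mathcal C}$ of the cluster category are the isomorphism classes of indecomposable finite-dimensional complex representations of $Q$ together with the $n$ shifted projectives $SP_1,\dots,SP_n$. Its arrows are: $M\to N$ between representations if there is an irreducible morphism $M\to N$ (this is the Auslander–Reiten quiver $\Gamma_Q$ of $Q$); $SP_i\to SP_k$ and $I_k\to SP_i$ for $k\to i$ in $Q$; $SP_i\to P_j$ for $i\to j$ in $Q$. Its translation $\tau$ is given by the almost split sequences $0\to\tau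 N\to B\to N\to 0$ for non-projective $N$, and by $\tau P_i=SP_i$, $\tau SP_i=I_i$. *The numbers.* For a representation $M$ of $Q$ with dimension vector $\underline m$ put $$X_M=\sum_{\underline e}\chi(\mathrm{Gr}_{\underline e}(M))\prod_i u_i^{-\langle \underline e,\alpha_i\rangle-\langle\alpha_i,\underline m-\underline e\rangle},$$ where $\mathrm{Gr}_{\underline e}(M)$ is the complex Grassmannian of subrepresentations of dimension vector $\underline e$, $\chi$ is the Euler–Poincaré characteristic, $\langle\,,\rangle$ is the Euler form of $Q$ and $\alpha_i$ is the $i$-th simple root; put $X_{SP_i}=u_i$. Let $\mathsf x_M=X_M|_{u_1=\dots=u_n=1}$. *The frieze.* Let $d_k$ be the number of diagonals of $T$ containing the vertex $k$ and $m_k=d_k+1$. The Coxeter–Conway frieze of $T$ is the array of positive numbers $F(r,k)$, $0\le r\le n+1$, $k\in\mathbb Z$ (with $F(r,k)$ drawn at height $r$ and horizontal position $k+r/2$) such that $F(0,k)=1$, $F(1,k)=m_{k \bmod (n+3)}$, $F(n+1,k)=1$, and $F(r,k)F(r,k+1)=1+F(r+1,k)F(r-1,k+1)$ for $1\le r\le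 n$. Then replacing each vertex $M$ of the Auslander–Reiten quiver by $\mathsf x_M$ gives the Coxeter–Conway frieze of $T$. Precisely: the frieze $F$ exists, and there is an assignment $(r,k)\mapsto M_{r,k}$ of a vertex of $\Gamma_{\mathcal C}$ to every point $(r,k)$ with $1\le r\le n$, $k\in\mathbb Z$, such that 1. every vertex of $\Gamma_{\mathcal C}$ occurs, and $M_{r,k}=M_{s,l}$ if and only if $(r,k)$ and $(s,l)$ differ by a power of the glide reflection $(r,k)\mapsto(n+1-r,\,k+r+1)$; 2. the arrows out of $M_{r,k}$ are exactly those to $M_{r+1,k}$ (if $r<n$) and $M_{r-1,k+1}$ (if $r>1$), and the arrows into $M_{r,k}$ are exactly those from $M_{r-1,k}$ (if $r>1$) and $M_{r+1,k-1}$ (if $r<n$); 3. $\tau M_{r,k}=M_{r,k-1}$; 4. $\mathsf x_{M_{r,k}}=F(r,k)$ for all $1\le r\le n$ and $k\in\mathbb Z$. -/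

import Mathlib

open CategoryTheory CategoryTheory.Limits

noncomputable section

/-! ## Triangulations of a polygon and their quivers

The vertices of the `N`-gon are numbered clockwise by `ZMod N`; a side or a diagonal is the
unordered pair of its endpoints. -/

/-- `{a, b}` is a side of the `N`-gon. -/
def IsSide {N : ℕ} (D : Sym2 (ZMod N)) : Prop :=
  ∃ a : ZMod N, D = s(a, a + 1)

/-- `{a, b}` is a diagonal of the `N`-gon: two distinct vertices that are not neighbours. -/
def IsDiagonal {N : ℕ} (D : Sym2 (ZMod N)) : Prop :=
  ¬ D.IsDiag ∧ ¬ IsSide D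

/-- Two diagonals cross (in the interior of the polygon): their endpoints `a, b` and `c, d` alternate,
that is, starting at `a` and going around the polygon one meets `c`, `b`, `d` in this order. -/
def Crosses {N : ℕ} (D E : Sym2 (ZMod N)) : Prop :=
  ∃ a b c d : ZMod N, D = s(a, b) ∧ E = s(c, d) ∧
    0 < (c - a).val ∧ (c - a).val < (b - a).val ∧ (b - a).val < (d - a).val

/-- A triangulation of the `(n+3)`-gon: a maximal set of pairwise non-crossing diagonals. -/
structure PolygonTriangulation (n : ℕ) where
  diagonals : Finset (Sym2 (ZMod (n + 3)))
  isDiagonal : ∀ D ∈ diagonals, IsDiagonal D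
  noncrossing : ∀ D ∈ diagonals, ∀ E ∈ diagonals, ¬ Crosses D E
  maximal : ∀ D, IsDiagonal D → (∀ E ∈ diagonals, ¬ Crosses D E) → D ∈ diagonals

namespace PolygonTriangulation

variable {n : ℕ} (T : PolygonTriangulation n)

/-- The number `d_k` of diagonals of `T` that contain the vertex `k`. -/
def valency (k : ZMod (n + 3)) : ℕ :=
  (T.diagonals.filter (fun D => k ∈ D)).card

/-- The set of vertices of the quiver `Q_T`: the diagonals of `T`. -/
abbrev Vertex : Type := {D : Sym2 (ZMod (n + 3)) // D ∈ T.diagonals}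

/-- There is an arrow `D → E` in `Q_T`: the diagonals `D = {v, a}` and `E = {v, b}` are edges of a
triangle `v, a, b` of `T`, and the rotation about the common endpoint `v` inside this triangle that
takes `D` to `E` is counterclockwise. As the vertices are numbered clockwise, the latter says
that `b` comes before `a` on the clockwise way around the polygon from `v`. -/
def Arrow (D E : T.Vertex) : Prop :=
  ∃ v a b : ZMod (n + 3), D.1 = s(v, a) ∧ E.1 = s(v, b) ∧
    (IsSide s(a, b) ∨ s(a, b) ∈ T.diagonals) ∧ (b - v).val < (a - v).val

/-- The quiver `Q_T` of a triangulation. -/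
instance quiver : Quiver.{0} T.Vertex where
  Hom D E := PLift (T.Arrow D E)

/-- `Q_T` is an orientation of the Dynkin diagram `A_n`. -/
def IsTypeA : Prop :=
  Nonempty (SimpleGraph.fromRel T.Arrow ≃g SimpleGraph.pathGraph n)

/-- `F r k` is the entry of the row `R_r`, `0 ≤ r ≤ n + 1`, at the horizontal position `k + r / 2`, so
that the rows are shifted by half a step against each other, and a diamond with left, right, upper
and lower entries `a, d, b, c` consists of `F r k, F r (k+1), F (r+1) k, F (r-1) (k+1)`.

`F` is the Coxeter-Conway frieze of `T`: the row `R_0` is filled with `1`, the row `R_1` with the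
`m_k = d_k + 1`, the diamonds satisfy `a d = 1 + b c`, and one reaches a row of `1`s again. All the
entries are positive, so the rows `R_0` and `R_1` and the diamond rule determine all the others. -/
structure IsCoxeterConwayFrieze (F : ℕ → ℤ → ℚ) : Prop where
  bottom : ∀ k, F 0 k = 1
  first : ∀ k : ℤ, F 1 k = T.valency (k : ZMod (n + 3)) + 1
  diamond : ∀ r, 1 ≤ r → r ≤ n → ∀ k,
    F r k * F r (k + 1) = 1 + F (r + 1) k * F (r - 1) (k + 1)
  top : ∀ k, F (n + 1) k = 1
  pos : ∀ r, r ≤ n + 1 → ∀ k, 0 < F r k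

end PolygonTriangulation

/-! ## Euler characteristic and quiver Grassmannians -/

/-- The Euler-Poincaré characteristic of a space, from its rational singular homology. -/
def eulerPoincare (X : Type) [TopologicalSpace X] : ℤ :=
  ∑ᶠ i : ℕ, (-1) ^ i * (Module.finrank ℚ
    (((AlgebraicTopology.singularHomologyFunctor (ModuleCat.{0} ℚ) i).obj
      (ModuleCat.of ℚ ℚ)).obj (TopCat.of X)) : ℤ)

/-- The Grassmannian of `d`-dimensional subspaces of a complex vector space. -/
def ComplexGrassmannian (d : ℕ) (W : Type) [AddCommGroup W] [Module ℂ W] : Type :=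
  {N : Submodule ℂ W // Module.finrank ℂ N = d}

/-- The linearly independent `d`-tuples of vectors. -/
def Frame (d : ℕ) (W : Type) [AddCommGroup W] [Module ℂ W] : Type :=
  {v : Fin d → W // LinearIndependent ℂ v}

/-- The frames carry the topology of the finite-dimensional complex vector space `W ^ d`. -/
instance (d : ℕ) (W : Type) [AddCommGroup W] [Module ℂ W] : TopologicalSpace (Frame d W) :=
  TopologicalSpace.induced Subtype.val
    (@Pi.topologicalSpace (Fin d) (fun _ => W) (fun _ => moduleTopology ℂ W))

/-- The subspace spanned by a frame. -/
def Frame.span {d : ℕ} {W : Type} [AddCommGroup W] [Module ℂ W] (v : Frame d W) :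
    ComplexGrassmannian d W :=
  ⟨Submodule.span ℂ (Set.range v.1), by
    rw [finrank_span_eq_card v.2, Fintype.card_fin]⟩

/-- The usual (quotient) topology of the complex Grassmannian. -/
instance (d : ℕ) (W : Type) [AddCommGroup W] [Module ℂ W] :
    TopologicalSpace (ComplexGrassmannian d W) :=
  TopologicalSpace.coinduced Frame.span inferInstance

section Representations

variable (V : Type) [Quiver.{0} V]

/-- The category of finite-dimensional complex representations of a quiver. -/
abbrev QuiverRep : Type 1 := Paths V ⥤ FGModuleCat.{0} ℂ

variable {V}

/-- The vector space of a representation at a vertex. -/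
abbrev QuiverRep.space (M : QuiverRep V) (i : V) : FGModuleCat.{0} ℂ :=
  M.obj ((Paths.of V).obj i)

/-- The linear map of a representation along an arrow. -/
abbrev QuiverRep.arrowMap (M : QuiverRep V) {i j : V} (a : i ⟶ j) : M.space i →ₗ[ℂ] M.space j :=
  (M.map ((Paths.of V).map a)).hom.hom

/-- The component of a morphism of representations at a vertex. -/
abbrev QuiverRep.component {M N : QuiverRep V} (f : M ⟶ N) (i : V) : M.space i →ₗ[ℂ] N.space i :=
  (f.app ((Paths.of V).obj i)).hom.hom

/-- The dimension vector. -/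
def QuiverRep.dimVec (M : QuiverRep V) (i : V) : ℕ :=
  Module.finrank ℂ (M.space i)

/-- The Grassmannian `Gr_e(M)` of subrepresentations of `M` of dimension vector `e`. -/
def QuiverGrassmannian (M : QuiverRep V) (e : V → ℕ) : Type :=
  {N : ∀ i, ComplexGrassmannian (e i) (M.space i) //
    ∀ (i j : V) (a : i ⟶ j), (N i).1 ≤ (N j).1.comap (M.arrowMap a)}

instance (M : QuiverRep V) (e : V → ℕ) : TopologicalSpace (QuiverGrassmannian M e) :=
  TopologicalSpace.induced Subtype.val inferInstance

/-! ## The elements `X_M` -/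

section Character

variable [Fintype V] [DecidableEq V]

/-- The Euler form of the quiver on the Grothendieck group `ℤ^V` of its representations, for which
`⟨α_i, α_i⟩ = 1` if there are no loops, and `⟨α_i, α_j⟩ = -#{i → j}` for `i ≠ j`. -/
def quiverEulerForm (a b : V → ℤ) : ℤ :=
  ∑ i, a i * b i - ∑ i, ∑ j, (Nat.card (i ⟶ j) : ℤ) * (a i * b j)

/-- The value of a Laurent polynomial in `u_i`, `i ∈ V`, at a point with nonzero coordinates. -/
def laurentEval (P : AddMonoidAlgebra ℚ (V → ℤ)) (u : V → ℚ) : ℚ :=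
  P.coeff.sum fun a c => c * ∏ i, u i ^ a i

/-- The Laurent polynomial
`X_M = ∑_e χ(Gr_e(M)) ∏_i u_i ^ (- ⟨e, α_i⟩ - ⟨α_i, dim M - e⟩)`. -/
def clusterCharacter (M : QuiverRep V) : AddMonoidAlgebra ℚ (V → ℤ) :=
  ∑ e ∈ Finset.Iic M.dimVec,
    AddMonoidAlgebra.single
      (fun i => - quiverEulerForm (fun j => (e j : ℤ)) (Pi.single i 1)
        - quiverEulerForm (Pi.single i 1) (fun j => (M.dimVec j : ℤ) - e j))
      (eulerPoincare (QuiverGrassmannian M e) : ℚ)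

end Character

/-! ## Auslander-Reiten theory of representations -/

/-- Irreducible morphisms of representations. -/
def IsIrreducibleMorphism {M N : QuiverRep V} (f : M ⟶ N) : Prop :=
  ¬ IsSplitMono f ∧ ¬ IsSplitEpi f ∧
    ∀ (L : QuiverRep V) (g : M ⟶ L) (h : L ⟶ N), g ≫ h = f → IsSplitMono g ∨ IsSplitEpi h

/-- Almost split exact sequences. -/
def IsAlmostSplit (S : ShortComplex (QuiverRep V)) : Prop :=
  S.ShortExact ∧ Indecomposable S.X₁ ∧ Indecomposable S.X₃ ∧ ¬ IsSplitEpi S.g ∧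
    ∀ (N : QuiverRep V) (h : N ⟶ S.X₃), ¬ IsSplitEpi h → ∃ h' : N ⟶ S.X₂, h' ≫ S.g = h

/-- `M` is isomorphic to the indecomposable projective `P_i = kQe_i`: it is free on one generator at
the vertex `i`, that is, `Hom(P_i, N) = N_i`. -/
def IsProjectiveAt (i : V) (M : QuiverRep V) : Prop :=
  ∃ v : M.space i, ∀ (N : QuiverRep V) (w : N.space i),
    ∃! f : M ⟶ N, QuiverRep.component f i v = w

/-- `M` is isomorphic to the indecomposable injective `I_i`: it is cofree on one linear form at the
vertex `i`, that is, `Hom(N, I_i) = (N_i)^*`. -/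
def IsInjectiveAt (i : V) (M : QuiverRep V) : Prop :=
  ∃ φ : M.space i →ₗ[ℂ] ℂ, ∀ (N : QuiverRep V) (ψ : N.space i →ₗ[ℂ] ℂ),
    ∃! f : N ⟶ M, φ ∘ₗ QuiverRep.component f i = ψ

/-! ## The Auslander-Reiten quiver of the cluster category -/

variable (V) in
/-- The indecomposable objects of the cluster category: the indecomposable representations
of the quiver, and the shifts `SP_i` of the indecomposable projectives. -/
inductive ClusterObject : Type 1 where
  | rep (M : QuiverRep V) (hM : Indecomposable M) : ClusterObject
  | shiftedProjective (i : V) : ClusterObject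

namespace ClusterObject

/-- Isomorphism of indecomposable objects. The vertices of the Auslander-Reiten quiver are the
isomorphism classes. -/
def Iso : ClusterObject V → ClusterObject V → Prop
  | rep M _, rep N _ => Nonempty (M ≅ N)
  | shiftedProjective i, shiftedProjective j => i = j
  | _, _ => False

/-- The arrows of the Auslander-Reiten quiver `Γ_C` of the cluster category. Between representations
they are given by the irreducible morphisms; moreover `SP_i → SP_k` for `k → i` in the quiver,
`SP_i → P_j` for `i → j`, and `I_k → SP_i` for `k → i`. -/
def HasArrow : ClusterObject V → ClusterObject V → Prop
  | rep M _, rep N _ => ∃ f : M ⟶ N, IsIrreducibleMorphism f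
  | shiftedProjective i, shiftedProjective k => Nonempty (k ⟶ i)
  | shiftedProjective i, rep M _ => ∃ j, Nonempty (i ⟶ j) ∧ IsProjectiveAt j M
  | rep M _, shiftedProjective i => ∃ k, Nonempty (k ⟶ i) ∧ IsInjectiveAt k M

/-- `IsTau X Y` means that `X` is the Auslander-Reiten translate `τ Y` in the cluster category. On
nonprojective representations it is given by the almost split sequences `0 → τ N → B → N → 0`;
moreover `τ P_i = SP_i` and `τ SP_i = I_i`. -/
def IsTau : ClusterObject V → ClusterObject V → Prop
  | rep M _, rep N _ => ∃ (B : QuiverRep V) (f : M ⟶ B) (g : B ⟶ N) (w : f ≫ g = 0),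
      IsAlmostSplit (ShortComplex.mk f g w)
  | shiftedProjective i, rep N _ => IsProjectiveAt i N
  | rep M _, shiftedProjective i => IsInjectiveAt i M
  | shiftedProjective _, shiftedProjective _ => False

section Values

variable [Fintype V] [DecidableEq V]

/-- The Laurent polynomial `X_M` of an indecomposable object of the cluster category, where
`X_{SP_i} = u_i`. -/
def X : ClusterObject V → AddMonoidAlgebra ℚ (V → ℤ)
  | rep M _ => clusterCharacter M
  | shiftedProjective i => AddMonoidAlgebra.single (Pi.single i 1) 1

/-- The number `x_M`, the value of `X_M` at `u_1 = … = u_n = 1`. -/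
def number (M : ClusterObject V) : ℚ :=
  laurentEval M.X (fun _ => 1)

end Values

end ClusterObject

/-- The points `(r, k)`, `1 ≤ r ≤ n`, of the strip in which the rows `R_1, …, R_n` of a frieze are
written. -/
def stripPoint (n r : ℕ) : Prop := 1 ≤ r ∧ r ≤ n

/-- The neighbours of `(r, k)` in the strip on its right: the upper one `(r + 1, k)` and the lower one
`(r - 1, k + 1)`. -/
def StripArrow (r : ℕ) (k : ℤ) (s : ℕ) (l : ℤ) : Prop :=
  (s = r + 1 ∧ l = k) ∨ (s + 1 = r ∧ l = k + 1)

/-- Two points of the strip with `n` rows differ by a power of the glide reflection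
`(r, k) ↦ (n + 1 - r, k + r + 1)`, whose square is the translation by `n + 3`. -/
def GlideEquiv (n r : ℕ) (k : ℤ) (s : ℕ) (l : ℤ) : Prop :=
  (s = r ∧ ((n : ℤ) + 3) ∣ l - k) ∨ (s + r = n + 1 ∧ ((n : ℤ) + 3) ∣ l - (k + r + 1))

/-- `p` displays the Auslander-Reiten quiver `Γ_C` in the strip with `n` rows in the usual way: arrows
go to the right, `τ` is the translation to the left by one step, every vertex occurs, and two
points of the strip carry the same vertex if and only if they differ by a power of the glide
reflection, so that `Γ_C` is the quotient of the strip by it. -/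
structure IsStripDisplay (n : ℕ) (p : ℕ → ℤ → ClusterObject V) : Prop where
  surjective : ∀ M : ClusterObject V, ∃ r k, stripPoint n r ∧ (p r k).Iso M
  iso_iff : ∀ r k s l, stripPoint n r → stripPoint n s →
    ((p r k).Iso (p s l) ↔ GlideEquiv n r k s l)
  arrow_right : ∀ r k, stripPoint n r → ∀ M : ClusterObject V,
    ((p r k).HasArrow M ↔ ∃ s l, stripPoint n s ∧ StripArrow r k s l ∧ (p s l).Iso M)
  arrow_left : ∀ r k, stripPoint n r → ∀ M : ClusterObject V,
    (M.HasArrow (p r k) ↔ ∃ s l, stripPoint n s ∧ StripArrow s l r k ∧ (p s l).Iso M)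
  tau : ∀ r k, stripPoint n r → ∀ M : ClusterObject V,
    (M.IsTau (p r k) ↔ (p r (k - 1)).Iso M)

end Representations

end

/-! A diagonal of the polygon has, up to translation by $n+3$, two lifts to the universal cover of
its boundary: the integer arcs $[a,b]$ and $[b,a+n+3]$. Since a path has no 3-cycles, no triangle of
$T$ has three diagonals as edges. So the diagonals, in the order of $A_n$, lift to arcs $[x_i,y_i]$,
each extending the previous one by one unit, starting from length $2$
(`IsTypeA.exists_zigzagCoords`).

Representations. An arc $[a,b]$ defines a thin representation, supported on the diagonals of $T$
that it crosses. Splitting off summands with the help of two flags shows that every indecomposable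
is thin (`exists_thin_summand`), for exactly one arc. A nonzero morphism from $[a,b]$ to $[a',b']$
requires $a\le a'$ and $b\le b'$, and is then a multiple of a canonical one (`le_of_hom_ne_zero`,
`exists_eq_smul_can`). Hence the almost split sequence ending at a nonprojective $[a,b]$ is
$[a-1,b-1]\to[a-1,b]\oplus[a,b-1]\to[a,b]$. The objects $SP_i$, $P_i$, $I_i$ are $D_i$ itself, $D_i$
rotated by $+1$, and $D_i$ rotated by $-1$. So the vertices of $\Gamma_{\mathcal C}$ are all
diagonals, $\tau$ is a rotation, and arrows move one end of a diagonal by one step (`hasArrow_iff`,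
`isTau_iff`). The strip point $(r,k)$ is the arc $[k-1,k+r]$, and the glide reflection exchanges the
two lifts of a diagonal.

Numbers. The Grassmannians of a thin representation are empty or points, so $\mathsf x_M$ counts the
subsets of its support that are closed under the arrows. On the frieze side there are vectors
$z_j\in\mathbb Z^2$ with $z_{j+n+3}=-z_j$, $\det(z_j,z_{j+1})=1$, and $z_q=z_p+z_r$ whenever
$p<q<r<p+n+3$ lift the corners of a triangle of $T$. The diamond rule for
$F(r,k)=\det(z_{k-1},z_{k+r})$ is a Plücker relation. Along the crossed diagonals, the closed sets
avoiding and containing the last one are counted by $\det(z_a,z_{y_m})$ and $\det(z_{x_m},z_a)$;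
hence $\mathsf x_M=\det(z_a,z_b)$ (`card_closedSets_eq`), which is therefore positive. The first row
is right because $[k-1,k+1]$ crosses exactly the diagonals at $k$; these form a linearly oriented
path, and one with $m$ points has $m+1$ closed sets (`det_eq_arcCount`). -/

noncomputable section

/-! ### Morphisms of quiver representations, vertex by vertex -/

section RepresentationBasics

variable {V : Type} [Quiver.{0} V]

namespace QuiverRep

theorem hom_ext {M N : QuiverRep V} {f g : M ⟶ N}
    (h : ∀ i, component f i = component g i) : f = g := by
  ext i : 2
  exact FGModuleCat.hom_ext (h i)

theorem component_comp {M N L : QuiverRep V} (f : M ⟶ N) (g : N ⟶ L) (i : V) :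
    component (f ≫ g) i = component g i ∘ₗ component f i := rfl

theorem component_add {M N : QuiverRep V} (f g : M ⟶ N) (i : V) :
    component (f + g) i = component f i + component g i := rfl

theorem component_smul {M N : QuiverRep V} (c : ℂ) (f : M ⟶ N) (i : V) :
    component (c • f) i = c • component f i := rfl

theorem component_comp_apply {M N L : QuiverRep V} (f : M ⟶ N) (g : N ⟶ L) (i : V)
    (z : M.space i) : component (f ≫ g) i z = component g i (component f i z) := rfl

theorem component_naturality {M N : QuiverRep V} (f : M ⟶ N) {i j : V} (a : i ⟶ j) :
    component f j ∘ₗ M.arrowMap a = N.arrowMap a ∘ₗ component f i :=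
  congrArg (fun t => t.hom.hom) (f.naturality ((Paths.of V).map a))

theorem component_naturality_apply {M N : QuiverRep V} (f : M ⟶ N) {i j : V} (a : i ⟶ j)
    (z : M.space i) : component f j (M.arrowMap a z) = N.arrowMap a (component f i z) :=
  LinearMap.congr_fun (component_naturality f a) z

/-- The representation with given spaces and arrow maps. -/
def mk (W : V → FGModuleCat.{0} ℂ) (φ : ∀ {i j : V}, (i ⟶ j) → (W i →ₗ[ℂ] W j)) : QuiverRep V :=
  Paths.lift { obj := W, map := fun a => FGModuleCat.ofHom (φ a) }

theorem arrowMap_mk (W : V → FGModuleCat.{0} ℂ)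
    (φ : ∀ {i j : V}, (i ⟶ j) → (W i →ₗ[ℂ] W j)) {i j : V} (a : i ⟶ j) :
    (mk W φ).arrowMap a = φ a := by
  unfold mk arrowMap
  erw [Paths.lift_toPath]
  rfl

theorem naturality_of_arrows {M N : QuiverRep V} (F : ∀ i : Paths V, M.obj i ⟶ N.obj i)
    (h : ∀ {i j : V} (a : i ⟶ j), M.map ((Paths.of V).map a) ≫ F j = F i ≫ N.map ((Paths.of V).map a))
    {i j : Paths V} (p : i ⟶ j) : M.map p ≫ F j = F i ≫ N.map p := by
  induction p using Paths.induction_fixed_source with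
  | id => rw [M.map_id, N.map_id, Category.id_comp, Category.comp_id]
  | comp p q ih =>
    rw [M.map_comp, N.map_comp, Category.assoc, ← reassoc_of% ih]
    exact congrArg (fun t => M.map p ≫ t) (h q)

/-- The morphism with given components. -/
def homMk {M N : QuiverRep V} (f : ∀ i, M.space i →ₗ[ℂ] N.space i)
    (h : ∀ {i j : V} (a : i ⟶ j), f j ∘ₗ M.arrowMap a = N.arrowMap a ∘ₗ f i) : M ⟶ N where
  app i := ⟨ModuleCat.ofHom (f i)⟩
  naturality _ _ p := naturality_of_arrows (fun i => ⟨ModuleCat.ofHom (f i)⟩)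
    (fun a => FGModuleCat.hom_ext (h a)) p

theorem component_homMk {M N : QuiverRep V} (f : ∀ i, M.space i →ₗ[ℂ] N.space i)
    (h : ∀ {i j : V} (a : i ⟶ j), f j ∘ₗ M.arrowMap a = N.arrowMap a ∘ₗ f i) (i : V) :
    component (homMk f h) i = f i := rfl

theorem isIso_of_bijective {M N : QuiverRep V} (f : M ⟶ N)
    (h : ∀ i, Function.Bijective (component f i)) : IsIso f := by
  have : ∀ i, IsIso (f.app i) := by
    intro i
    let e := LinearEquiv.ofBijective _ (h i)
    refine ⟨⟨⟨ModuleCat.ofHom e.symm.toLinearMap⟩, ?_, ?_⟩⟩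
    · apply FGModuleCat.hom_ext
      ext z
      exact e.symm_apply_apply z
    · apply FGModuleCat.hom_ext
      ext z
      exact e.apply_symm_apply z
  exact NatIso.isIso_of_isIso_app f

theorem isZero_iff {M : QuiverRep V} : IsZero M ↔ ∀ i, ∀ z : M.space i, z = 0 := by
  rw [IsZero.iff_id_eq_zero]
  constructor
  · intro h i z
    exact LinearMap.congr_fun (congrArg (fun f => component f i) h) z
  · intro h
    apply hom_ext
    intro i
    ext z
    exact (h i _).trans (h i _).symm

theorem mono_of_injective {M N : QuiverRep V} (f : M ⟶ N)
    (h : ∀ i, Function.Injective (component f i)) : Mono f := by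
  constructor
  intro L g g' hg
  apply hom_ext
  intro i
  ext z
  apply h i
  exact LinearMap.congr_fun (congrArg (fun f => component f i) hg) z

theorem epi_of_surjective {M N : QuiverRep V} (f : M ⟶ N)
    (h : ∀ i, Function.Surjective (component f i)) : Epi f := by
  constructor
  intro L g g' hg
  apply hom_ext
  intro i
  ext z
  obtain ⟨z, rfl⟩ := h i z
  exact LinearMap.congr_fun (congrArg (fun f => component f i) hg) z

theorem injective_of_splitMono {M N : QuiverRep V} (f : M ⟶ N) (g : N ⟶ M) (h : f ≫ g = 𝟙 M)
    (i : V) : Function.LeftInverse (component g i) (component f i) := fun z =>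
  LinearMap.congr_fun (congrArg (fun f => component f i) h) z

theorem surjective_of_epi {M N : QuiverRep V} (f : M ⟶ N) [Epi f] (i : V) :
    Function.Surjective (component f i) := by
  have h1 : Epi (f.app ((Paths.of V).obj i)) := inferInstance
  have h2 : Epi ((forget₂ (FGModuleCat ℂ) (ModuleCat ℂ)).map (f.app ((Paths.of V).obj i))) :=
    inferInstance
  exact (ModuleCat.epi_iff_surjective _).1 h2

end QuiverRep

end RepresentationBasics

/-! ### Thin representations attached to arcs, and the morphisms between them -/

section ThinRepresentations

/-- Coordinates for a quiver of type `A_n`: the `i`-th vertex on the line carries an arc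
`[x i, y i]` of integers of length `i + 2`, each arc extends the previous one by one unit to the
left or to the right, and arrows between neighbours go from the larger to the smaller endpoints. -/
structure ZigzagCoords (V : Type) [Quiver.{0} V] (n : ℕ) where
  idx : V ≃ Fin n
  x : ℕ → ℤ
  y : ℕ → ℤ
  gap : ∀ i : ℕ, y i = x i + i + 2
  step : ∀ i : ℕ, x (i + 1) = x i ∨ x (i + 1) = x i - 1
  hom_iff : ∀ v w : V, Nonempty (v ⟶ w) ↔
    ((idx v : ℕ) + 1 = idx w ∨ (idx w : ℕ) + 1 = idx v) ∧ x (idx w) ≤ x (idx v) ∧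
      y (idx w) ≤ y (idx v)
  hom_subsingleton : ∀ v w : V, Subsingleton (v ⟶ w)

/-- The line `ℂ` if `p` holds, and `0` otherwise. -/
def propLine (p : Prop) : Submodule ℂ ℂ where
  carrier := {z | ¬ p → z = 0}
  zero_mem' := fun _ => rfl
  add_mem' := fun ha hb hp => by rw [ha hp, hb hp, add_zero]
  smul_mem' := fun c z hz hp => by rw [hz hp, smul_zero]

open Classical in
/-- The identity of `ℂ` where source and target allow it, and `0` otherwise. -/
def propLineMap (p q : Prop) : propLine p →ₗ[ℂ] propLine q where
  toFun z := ⟨if q then z else 0, fun hq => by simp [hq]⟩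
  map_add' a b := by
    ext
    by_cases hq : q <;> simp [hq]
  map_smul' c a := by
    ext
    by_cases hq : q <;> simp [hq]

namespace ZigzagCoords

variable {V : Type} [Quiver.{0} V] {n : ℕ} (C : ZigzagCoords V n)

/-- The left end of the arc at a vertex. -/
def l (v : V) : ℤ := C.x (C.idx v)

/-- The right end of the arc at a vertex. -/
def r (v : V) : ℤ := C.y (C.idx v)

theorem x_anti {i j : ℕ} (h : i ≤ j) : C.x j ≤ C.x i := by
  induction j, h using Nat.le_induction with
  | base => exact le_rfl
  | succ j _ ih => have := C.step j; omega

theorem y_mono {i j : ℕ} (h : i ≤ j) : C.y i ≤ C.y j := by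
  induction j, h using Nat.le_induction with
  | base => exact le_rfl
  | succ j _ ih =>
    have := C.step j
    have := C.gap j
    have := C.gap (j + 1)
    push_cast at *
    omega

theorem idx_lt (v : V) : (C.idx v : ℕ) < n := (C.idx v).2

theorem exists_idx {i : ℕ} (h : i < n) : ∃ v, (C.idx v : ℕ) = i :=
  ⟨C.idx.symm ⟨i, h⟩, by simp⟩

theorem idx_inj {v w : V} (h : (C.idx v : ℕ) = C.idx w) : v = w :=
  C.idx.injective (Fin.ext h)

theorem r_eq (v : V) : C.r v = C.l v + (C.idx v : ℕ) + 2 := C.gap _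

theorem l_anti {v w : V} (h : (C.idx v : ℕ) ≤ C.idx w) : C.l w ≤ C.l v := C.x_anti h

theorem r_mono {v w : V} (h : (C.idx v : ℕ) ≤ C.idx w) : C.r v ≤ C.r w := C.y_mono h

/-- The edge between two neighbours. -/
theorem edge {v w : V} (h : (C.idx v : ℕ) + 1 = C.idx w) :
    (C.l w = C.l v ∧ C.r w = C.r v + 1 ∧ Nonempty (w ⟶ v)) ∨
    (C.l w = C.l v - 1 ∧ C.r w = C.r v ∧ Nonempty (v ⟶ w)) := by
  have h1 := C.step (C.idx v)
  have h2 := C.gap (C.idx v)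
  have h3 := C.gap (C.idx w)
  rw [C.hom_iff, C.hom_iff]
  rw [h] at h1
  unfold l r
  push_cast [← h] at h3
  rw [h] at h3
  omega

theorem arrow_le {v w : V} (a : v ⟶ w) : C.l w ≤ C.l v ∧ C.r w ≤ C.r v :=
  ((C.hom_iff v w).1 ⟨a⟩).2

theorem arrow_adj {v w : V} (a : v ⟶ w) :
    (C.idx v : ℕ) + 1 = C.idx w ∨ (C.idx w : ℕ) + 1 = C.idx v :=
  ((C.hom_iff v w).1 ⟨a⟩).1

/-- The arc at `v` is crossed by the arc from `a` to `b`. -/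
def supp (a b : ℤ) (v : V) : Prop :=
  C.l v < a ∧ a < C.r v ∧ C.r v < b ∧ b < C.l v + n + 3

/-- The arcs are nested: the two conditions on `a` pass to larger indices, the two conditions on `b`
to smaller ones. -/
theorem supp_of_between {a b : ℤ} {u v w : V} (hu : C.supp a b u) (hw : C.supp a b w)
    (h1 : (C.idx u : ℕ) ≤ C.idx v) (h2 : (C.idx v : ℕ) ≤ C.idx w) : C.supp a b v := by
  have := C.l_anti h1
  have := C.l_anti h2
  have := C.r_mono h1
  have := C.r_mono h2
  unfold supp at *
  omega

/-- The thin representation supported on the arcs that are crossed by the arc from `a` to `b`. -/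
def thin (a b : ℤ) : QuiverRep V :=
  QuiverRep.mk (fun v => FGModuleCat.of ℂ (propLine (C.supp a b v)))
    (fun {v w} _ => propLineMap (C.supp a b v) (C.supp a b w))

/-- The coordinate on the space of a thin representation at a vertex. -/
def coord (a b : ℤ) (v : V) : (C.thin a b).space v →ₗ[ℂ] ℂ := (propLine (C.supp a b v)).subtype

/-- The generator of the space of a thin representation at a vertex. -/
def gen (a b : ℤ) (v : V) : (C.thin a b).space v :=
  propLineMap True (C.supp a b v) ⟨1, fun h => absurd trivial h⟩

variable {a b : ℤ} {v w : V}

theorem coord_injective : Function.Injective (C.coord a b v) := Subtype.val_injective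

theorem coord_gen (h : C.supp a b v) : C.coord a b v (C.gen a b v) = 1 := if_pos h

theorem gen_eq_zero (h : ¬ C.supp a b v) : C.gen a b v = 0 :=
  C.coord_injective ((if_neg h).trans (map_zero _).symm)

theorem coord_eq_zero (h : ¬ C.supp a b v) (z : (C.thin a b).space v) : C.coord a b v z = 0 :=
  z.2 h

theorem coord_smul_gen (z : (C.thin a b).space v) : C.coord a b v z • C.gen a b v = z := by
  apply C.coord_injective
  rw [map_smul]
  by_cases h : C.supp a b v
  · rw [C.coord_gen h, smul_eq_mul, mul_one]
  · rw [C.coord_eq_zero h, zero_smul]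

theorem gen_ne_zero (h : C.supp a b v) : C.gen a b v ≠ 0 := fun h0 => by
  have := C.coord_gen h
  rw [h0, map_zero] at this
  exact zero_ne_one this

open Classical in
theorem arrowMap_gen (f : v ⟶ w) (h : C.supp a b v) :
    (C.thin a b).arrowMap f (C.gen a b v) = C.gen a b w := by
  unfold thin
  rw [QuiverRep.arrowMap_mk]
  apply C.coord_injective
  change (if C.supp a b w then (if C.supp a b v then (1 : ℂ) else 0) else 0) =
    if C.supp a b w then (1 : ℂ) else 0
  rw [if_pos h]

theorem thin_linearMap_ext {W : Type*} [AddCommGroup W] [Module ℂ W]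
    {f g : (C.thin a b).space v →ₗ[ℂ] W} (h : C.supp a b v → f (C.gen a b v) = g (C.gen a b v)) :
    f = g := by
  ext z
  rw [← C.coord_smul_gen z, map_smul, map_smul]
  by_cases hv : C.supp a b v
  · rw [h hv]
  · rw [C.coord_eq_zero hv, zero_smul, zero_smul]

/-- Morphisms out of a thin representation are given by the images of the generators. -/
def thinDesc (M : QuiverRep V) (g : ∀ v, M.space v)
    (h0 : ∀ v w (f : v ⟶ w), C.supp a b v → C.supp a b w → M.arrowMap f (g v) = g w)
    (h1 : ∀ v w (f : v ⟶ w), C.supp a b v → ¬ C.supp a b w → M.arrowMap f (g v) = 0) :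
    C.thin a b ⟶ M :=
  QuiverRep.homMk (fun v => (LinearMap.toSpanSingleton ℂ _ (g v)) ∘ₗ C.coord a b v) (by
    intro v w f
    apply C.thin_linearMap_ext
    intro hv
    simp only [LinearMap.comp_apply, LinearMap.toSpanSingleton_apply]
    rw [C.arrowMap_gen f hv, C.coord_gen hv, one_smul]
    by_cases hw : C.supp a b w
    · rw [C.coord_gen hw, one_smul, h0 v w f hv hw]
    · rw [C.coord_eq_zero hw, zero_smul, h1 v w f hv hw])

theorem thinDesc_gen (M : QuiverRep V) (g : ∀ v, M.space v) (h0) (h1) (hv : C.supp a b v) :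
    QuiverRep.component (C.thinDesc (a := a) (b := b) M g h0 h1) v (C.gen a b v) = g v := by
  change LinearMap.toSpanSingleton ℂ _ (g v) (C.coord a b v (C.gen a b v)) = g v
  rw [C.coord_gen hv, LinearMap.toSpanSingleton_apply, one_smul]

theorem thin_hom_ext {M : QuiverRep V} {f g : C.thin a b ⟶ M}
    (h : ∀ v, C.supp a b v → QuiverRep.component f v (C.gen a b v) =
      QuiverRep.component g v (C.gen a b v)) : f = g :=
  QuiverRep.hom_ext fun v => C.thin_linearMap_ext (h v)

/-- The canonical morphisms between thin representations. -/
def can (a b a' b' : ℤ) (ha : a ≤ a') (hb : b ≤ b') : C.thin a b ⟶ C.thin a' b' :=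
  C.thinDesc _ (fun v => C.gen a' b' v)
    (by
      intro v w f hv hw
      have := C.arrow_le f
      by_cases hv' : C.supp a' b' v
      · exact C.arrowMap_gen f hv'
      -- Moving the ends to the right loses `v` only if `a'` reaches `C.r v` or `b'` reaches `C.l v
      -- + n + 3`. An arrow does not raise these bounds, so `w` is lost as well.
      · rw [C.gen_eq_zero hv', map_zero, C.gen_eq_zero]
        unfold supp at *
        omega)
    (by
      intro v w f hv hw
      have := C.arrow_le f
      by_cases hv' : C.supp a' b' v
      · rw [C.arrowMap_gen f hv', C.gen_eq_zero]
        unfold supp at *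
        omega
      · rw [C.gen_eq_zero hv', map_zero])

theorem can_gen {a' b' : ℤ} {ha : a ≤ a'} {hb : b ≤ b'} (hv : C.supp a b v) :
    QuiverRep.component (C.can a b a' b' ha hb) v (C.gen a b v) = C.gen a' b' v :=
  C.thinDesc_gen _ _ _ _ hv

theorem can_refl : C.can a b a b le_rfl le_rfl = 𝟙 _ :=
  C.thin_hom_ext fun _ hv => C.can_gen hv

/-- A vertex crossed by the first and the last arc is crossed by the middle one, so the composite
does not vanish too early. -/
theorem can_comp {a' b' a'' b'' : ℤ} {ha : a ≤ a'} {hb : b ≤ b'} {ha' : a' ≤ a''} {hb' : b' ≤ b''} :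
    C.can a b a' b' ha hb ≫ C.can a' b' a'' b'' ha' hb' =
      C.can a b a'' b'' (ha.trans ha') (hb.trans hb') := by
  apply C.thin_hom_ext
  intro v hv
  rw [QuiverRep.component_comp_apply, C.can_gen hv, C.can_gen hv]
  by_cases hv' : C.supp a' b' v
  · exact C.can_gen hv'
  · rw [C.gen_eq_zero hv', map_zero, C.gen_eq_zero]
    unfold supp at *
    omega

/-- The scalar by which a morphism of thin representations acts at a vertex. -/
def scalar {a' b' : ℤ} (f : C.thin a b ⟶ C.thin a' b') (v : V) : ℂ :=
  C.coord a' b' v (QuiverRep.component f v (C.gen a b v))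

theorem component_gen {a' b' : ℤ} (f : C.thin a b ⟶ C.thin a' b') (v : V) :
    QuiverRep.component f v (C.gen a b v) = C.scalar f v • C.gen a' b' v :=
  (C.coord_smul_gen _).symm

theorem scalar_eq_of_arrow {a' b' : ℤ} (f : C.thin a b ⟶ C.thin a' b') {v w : V} (g : v ⟶ w)
    (hv : C.supp a b v) (hv' : C.supp a' b' v) (hw' : C.supp a' b' w) :
    C.scalar f v = C.scalar f w := by
  have h := congrArg (C.coord a' b' w) (QuiverRep.component_naturality_apply f g (C.gen a b v))
  rw [C.arrowMap_gen g hv, C.component_gen f v, map_smul, map_smul, C.arrowMap_gen g hv',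
    C.coord_gen hw', smul_eq_mul, mul_one] at h
  exact h.symm

theorem scalar_eq_zero_of_target {a' b' : ℤ} (f : C.thin a b ⟶ C.thin a' b') {v w : V} (g : v ⟶ w)
    (hv : C.supp a b v) (hv' : ¬ C.supp a' b' v) : C.scalar f w = 0 := by
  have h := congrArg (C.coord a' b' w) (QuiverRep.component_naturality_apply f g (C.gen a b v))
  rwa [C.arrowMap_gen g hv, C.component_gen f v, C.gen_eq_zero hv', smul_zero, map_zero,
    map_zero] at h

theorem scalar_eq_zero_of_source {a' b' : ℤ} (f : C.thin a b ⟶ C.thin a' b') {v w : V} (g : v ⟶ w)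
    (hv : C.supp a b v) (hw : ¬ C.supp a b w) (hv' : C.supp a' b' v) (hw' : C.supp a' b' w) :
    C.scalar f v = 0 := by
  rw [C.scalar_eq_of_arrow f g hv hv' hw']
  unfold scalar
  rw [C.gen_eq_zero hw, map_zero, map_zero]

theorem hom_eq_zero_of_scalar {a' b' : ℤ} {f : C.thin a b ⟶ C.thin a' b'}
    (h : ∀ v, C.supp a b v → C.supp a' b' v → C.scalar f v = 0) : f = 0 := by
  apply C.thin_hom_ext
  intro v hv
  rw [C.component_gen]
  by_cases hv' : C.supp a' b' v
  · rw [h v hv hv', zero_smul]; rfl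
  · rw [C.gen_eq_zero hv', smul_zero]; rfl

/-- At index `0` the only admissible left end is `C.l v + 1`, so source and target cannot both be
supported there. Further on, the scalar is inherited from the preceding vertex if both are supported
at it. Otherwise `a' < a` decides which of the two supports ends, and the arrow between the vertices
has the direction for which naturality forces the scalar to vanish. -/
theorem hom_eq_zero_of_lt_left {a' b' : ℤ} (h : a' < a) (f : C.thin a b ⟶ C.thin a' b') :
    f = 0 := by
  apply C.hom_eq_zero_of_scalar
  suffices H : ∀ i : ℕ, ∀ v, (C.idx v : ℕ) = i → C.supp a b v → C.supp a' b' v →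
      C.scalar f v = 0 from fun v => H _ v rfl
  intro i
  induction i with
  | zero =>
    intro v hi hv hv'
    have := C.r_eq v
    unfold supp at *
    omega
  | succ i ih =>
    intro v hi hv hv'
    obtain ⟨u, hu⟩ := C.exists_idx (i := i) (by have := C.idx_lt v; omega)
    have hedge := C.edge (v := u) (w := v) (by omega)
    by_cases hc : C.supp a b u ∧ C.supp a' b' u
    · have h0 := ih u hu hc.1 hc.2
      rcases hedge with ⟨-, -, ⟨g⟩⟩ | ⟨-, -, ⟨g⟩⟩
      · rw [C.scalar_eq_of_arrow f g hv hv' hc.2, h0]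
      · rw [← C.scalar_eq_of_arrow f g hc.1 hc.2 hv', h0]
    · rcases hedge with ⟨h1, h2, ⟨g⟩⟩ | ⟨h1, h2, ⟨g⟩⟩
      · refine C.scalar_eq_zero_of_source f g hv ?_ hv' ?_ <;> unfold supp at * <;> omega
      · refine C.scalar_eq_zero_of_target f g ?_ ?_ <;> unfold supp at * <;> omega

/-- The mirror image, by induction from the last vertex, where the only admissible right end is `C.r
v + 1`. -/
theorem hom_eq_zero_of_lt_right {a' b' : ℤ} (h : b' < b) (f : C.thin a b ⟶ C.thin a' b') :
    f = 0 := by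
  apply C.hom_eq_zero_of_scalar
  suffices H : ∀ i : ℕ, ∀ v, (C.idx v : ℕ) + 1 + i = n → C.supp a b v → C.supp a' b' v →
      C.scalar f v = 0 from fun v => H (n - (C.idx v + 1)) v (by have := C.idx_lt v; omega)
  intro i
  induction i with
  | zero =>
    intro v hi hv hv'
    have := C.r_eq v
    unfold supp at *
    omega
  | succ i ih =>
    intro v hi hv hv'
    obtain ⟨u, hu⟩ := C.exists_idx (i := C.idx v + 1) (by omega)
    have hedge := C.edge (v := v) (w := u) (by omega)
    by_cases hc : C.supp a b u ∧ C.supp a' b' u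
    · have h0 := ih u (by omega) hc.1 hc.2
      rcases hedge with ⟨-, -, ⟨g⟩⟩ | ⟨-, -, ⟨g⟩⟩
      · rw [← C.scalar_eq_of_arrow f g hc.1 hc.2 hv', h0]
      · rw [C.scalar_eq_of_arrow f g hv hv' hc.2, h0]
    · rcases hedge with ⟨h1, h2, ⟨g⟩⟩ | ⟨h1, h2, ⟨g⟩⟩
      · refine C.scalar_eq_zero_of_target f g ?_ ?_ <;> unfold supp at * <;> omega
      · refine C.scalar_eq_zero_of_source f g hv ?_ hv' ?_ <;> unfold supp at * <;> omega

theorem le_of_hom_ne_zero {a' b' : ℤ} {f : C.thin a b ⟶ C.thin a' b'} (h : f ≠ 0) :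
    a ≤ a' ∧ b ≤ b' := by
  by_contra! hc
  rcases lt_or_ge a' a with h1 | h1
  · exact h (C.hom_eq_zero_of_lt_left h1 f)
  · exact h (C.hom_eq_zero_of_lt_right (hc h1) f)

/-- A function that does not change along the edges inside a convex set is constant on it. -/
theorem eq_of_steps {P : V → Prop} {c : V → ℂ}
    (hP : ∀ u v w, P u → P w → (C.idx u : ℕ) ≤ C.idx v → (C.idx v : ℕ) ≤ C.idx w → P v)
    (hc : ∀ u v, P u → P v → (C.idx u : ℕ) + 1 = C.idx v → c u = c v) {v w : V} (hv : P v)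
    (hw : P w) : c v = c w := by
  wlog h : (C.idx v : ℕ) ≤ C.idx w generalizing v w
  · exact (this hw hv (by omega)).symm
  obtain ⟨d, hd⟩ := Nat.exists_eq_add_of_le h
  clear h
  induction d generalizing w with
  | zero => rw [C.idx_inj (v := v) (w := w) (by omega)]
  | succ d ih =>
    obtain ⟨u, hu⟩ := C.exists_idx (i := C.idx v + d) (by have := C.idx_lt w; omega)
    have hPu := hP v u w hv hw (by omega) (by omega)
    rw [ih hPu hu, hc u w hPu hw (by omega)]

/-- Both supports are convex, hence so is their intersection, and naturality keeps the scalar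
constant along its edges. -/
theorem exists_eq_smul_can {a' b' : ℤ} (ha : a ≤ a') (hb : b ≤ b')
    (f : C.thin a b ⟶ C.thin a' b') : ∃ c : ℂ, f = c • C.can a b a' b' ha hb := by
  by_cases he : ∃ v, C.supp a b v ∧ C.supp a' b' v
  · obtain ⟨v, hv⟩ := he
    refine ⟨C.scalar f v, C.thin_hom_ext fun w hw => ?_⟩
    rw [QuiverRep.component_smul, LinearMap.smul_apply, C.can_gen hw, C.component_gen]
    by_cases hw' : C.supp a' b' w
    · congr 1
      refine C.eq_of_steps (P := fun v => C.supp a b v ∧ C.supp a' b' v) (c := C.scalar f) ?_ ?_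
        ⟨hw, hw'⟩ hv
      · exact fun u v w hu hw h1 h2 =>
          ⟨C.supp_of_between hu.1 hw.1 h1 h2, C.supp_of_between hu.2 hw.2 h1 h2⟩
      · intro u v hu hv huv
        rcases C.edge huv with ⟨-, -, ⟨g⟩⟩ | ⟨-, -, ⟨g⟩⟩
        · exact (C.scalar_eq_of_arrow f g hv.1 hv.2 hu.2).symm
        · exact C.scalar_eq_of_arrow f g hu.1 hu.2 hv.2
    · rw [C.gen_eq_zero hw', smul_zero, smul_zero]
  · refine ⟨0, ?_⟩
    rw [zero_smul]
    exact C.hom_eq_zero_of_scalar fun v hv hv' => absurd ⟨v, hv, hv'⟩ he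

theorem isZero_thin_iff : IsZero (C.thin a b) ↔ ∀ v, ¬ C.supp a b v := by
  rw [QuiverRep.isZero_iff]
  constructor
  · exact fun h v hv => C.gen_ne_zero hv (h v _)
  · exact fun h v z => C.coord_injective ((C.coord_eq_zero (h v) z).trans (map_zero _).symm)

end ZigzagCoords

end ThinRepresentations

/-! ### Every nonzero representation has a thin direct summand -/

section Classification

/-- A finite flag of subspaces, from `0` to the whole space. -/
structure IsFlag {A : Type*} [AddCommGroup A] [Module ℂ A] (F : Set (Submodule ℂ A)) : Prop where
  finite : F.Finite
  chain : IsChain (· ≤ ·) F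
  bot_mem : ⊥ ∈ F
  top_mem : ⊤ ∈ F

/-- The splitting of a space into the line of `x` and the kernel of `φ` is compatible with a flag. -/
def FlagCompatible {A : Type*} [AddCommGroup A] [Module ℂ A] (F : Set (Submodule ℂ A)) (x : A)
    (φ : A →ₗ[ℂ] ℂ) : Prop :=
  φ x = 1 ∧ ∀ W ∈ F, x ∈ W ∨ W ≤ LinearMap.ker φ

section LinearAlgebra

variable {A B : Type*} [AddCommGroup A] [Module ℂ A] [AddCommGroup B] [Module ℂ B]
  {F : Set (Submodule ℂ A)}

theorem IsFlag.push (hF : IsFlag F) (f : A →ₗ[ℂ] B) :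
    IsFlag (insert ⊤ (Submodule.map f '' F)) where
  finite := (hF.finite.image _).insert _
  chain := (hF.chain.image_of_map_rel _ _ _ fun _ _ h => Submodule.map_mono h).insert
    fun _ _ _ => Or.inr le_top
  bot_mem := Or.inr ⟨⊥, hF.bot_mem, Submodule.map_bot f⟩
  top_mem := Or.inl rfl

theorem IsFlag.pull (hF : IsFlag F) (f : B →ₗ[ℂ] A) :
    IsFlag (insert ⊥ (Submodule.comap f '' F)) where
  finite := (hF.finite.image _).insert _
  chain := (hF.chain.image_of_map_rel _ _ _ fun _ _ h => Submodule.comap_mono h).insert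
    fun _ _ _ => Or.inl bot_le
  bot_mem := Or.inl rfl
  top_mem := Or.inr ⟨⊤, hF.top_mem, Submodule.comap_top f⟩

/-- Lift `x` into the smallest member of the flag that `φ ∘ₗ f` does not kill: every member not
killed contains that one, hence contains the lift. -/
theorem FlagCompatible.of_push (hF : IsFlag F) {f : A →ₗ[ℂ] B} {x : B} {φ : B →ₗ[ℂ] ℂ}
    (h : FlagCompatible (insert ⊤ (Submodule.map f '' F)) x φ) (h0 : φ ∘ₗ f ≠ 0) :
    ∃ x', f x' = x ∧ FlagCompatible F x' (φ ∘ₗ f) := by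
  obtain ⟨W₀, hW₀⟩ := (hF.finite.subset (Set.sep_subset F
    fun W => ¬ W ≤ LinearMap.ker (φ ∘ₗ f))).exists_minimal ⟨⊤, hF.top_mem, fun hle =>
      h0 (LinearMap.ker_eq_top.1 (top_le_iff.1 hle))⟩
  have hx : x ∈ Submodule.map f W₀ := by
    refine (h.2 _ (Or.inr ⟨W₀, hW₀.1.1, rfl⟩)).resolve_right fun hle => hW₀.1.2 fun z hz => ?_
    exact hle ⟨z, hz, rfl⟩
  obtain ⟨x', hx', rfl⟩ := hx
  refine ⟨x', rfl, h.1, fun W hW => or_iff_not_imp_right.2 fun hle => ?_⟩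
  rcases hF.chain.total hW hW₀.1.1 with h1 | h1
  · exact hW₀.2 ⟨hW, hle⟩ h1 hx'
  · exact h1 hx'

theorem IsFlag.exists_maximal_notMem (hF : IsFlag F) {x : A} (hx : x ≠ 0) :
    ∃ W₀, x ∉ W₀ ∧ ∀ W ∈ F, x ∈ W ∨ W ≤ W₀ := by
  obtain ⟨W₀, hW₀⟩ := (hF.finite.subset (Set.sep_subset F fun W => x ∉ W)).exists_maximal
    ⟨⊥, hF.bot_mem, hx⟩
  refine ⟨W₀, hW₀.1.2, fun W hW => or_iff_not_imp_left.2 fun hxW => ?_⟩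
  rcases hF.chain.total hW hW₀.1.1 with h1 | h1
  · exact h1
  · exact hW₀.2 ⟨hW, hxW⟩ h1

/-- Dually, let `W₀` be the largest member of the flag without `f x`. Then `φ` kills the preimage of
`W₀`, so it factors through the quotient by `W₀` and extends to a form vanishing on `W₀`. -/
theorem FlagCompatible.of_pull (hF : IsFlag F) {f : B →ₗ[ℂ] A} {x : B} {φ : B →ₗ[ℂ] ℂ}
    (h : FlagCompatible (insert ⊥ (Submodule.comap f '' F)) x φ) (h0 : f x ≠ 0) :
    ∃ φ' : A →ₗ[ℂ] ℂ, φ' ∘ₗ f = φ ∧ FlagCompatible F (f x) φ' := by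
  by_cases hF' : ∃ W ∈ F, ¬ f x ∈ W
  · obtain ⟨W₀, hW₀⟩ := (hF.finite.subset (Set.sep_subset F fun W => f x ∉ W)).exists_maximal hF'
    have hker : LinearMap.ker (W₀.mkQ ∘ₗ f) ≤ LinearMap.ker φ := by
      rw [LinearMap.ker_comp, Submodule.ker_mkQ]
      exact (h.2 _ (Or.inr ⟨W₀, hW₀.1.1, rfl⟩)).resolve_left hW₀.1.2
    have hmem : φ ∈ LinearMap.range (W₀.mkQ ∘ₗ f).dualMap := by
      rw [LinearMap.range_dualMap_eq_dualAnnihilator_ker, Submodule.mem_dualAnnihilator]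
      exact fun w hw => hker hw
    obtain ⟨ψ, rfl⟩ := hmem
    refine ⟨ψ ∘ₗ W₀.mkQ, rfl, h.1, fun W hW => or_iff_not_imp_left.2 fun hxW => ?_⟩
    have hle : W ≤ W₀ := by
      rcases hF.chain.total hW hW₀.1.1 with h1 | h1
      · exact h1
      · exact hW₀.2 ⟨hW, hxW⟩ h1
    intro z hz
    have hz0 : W₀.mkQ z = 0 := (Submodule.Quotient.mk_eq_zero W₀).2 (hle hz)
    rw [LinearMap.mem_ker, LinearMap.comp_apply, hz0, map_zero]
  · exact absurd ⟨⊥, hF.bot_mem, h0⟩ hF'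

/-- The linear algebra behind the classification, as in the Bruhat decomposition. Any nonzero `x` in
the smallest nonzero member of `F` suits `F`, whatever `φ` is; then `φ` is chosen to vanish on the
largest member of `E` without `x`. -/
theorem exists_flagCompatible {E : Set (Submodule ℂ A)} (hF : IsFlag F) (hE : IsFlag E)
    [Nontrivial A] : ∃ x φ, FlagCompatible F x φ ∧ FlagCompatible E x φ := by
  obtain ⟨W₁, hW₁⟩ := (hF.finite.subset (Set.sep_subset F fun W => W ≠ ⊥)).exists_minimal
    ⟨⊤, hF.top_mem, top_ne_bot⟩
  obtain ⟨x, hx, hx0⟩ := (Submodule.ne_bot_iff _).1 hW₁.1.2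
  obtain ⟨W₀, hxW₀, hW₀⟩ := hE.exists_maximal_notMem hx0
  obtain ⟨φ, hφ, hle⟩ := Submodule.exists_le_ker_of_notMem hxW₀
  have hc : ∀ z, ((φ x)⁻¹ • φ) z = (φ x)⁻¹ * φ z := fun z => rfl
  have h1 : ((φ x)⁻¹ • φ) x = 1 := by rw [hc, inv_mul_cancel₀ hφ]
  refine ⟨x, (φ x)⁻¹ • φ, ⟨h1, fun W hW => ?_⟩, ⟨h1, fun W hW => ?_⟩⟩
  · rcases eq_or_ne W ⊥ with rfl | hne
    · exact Or.inr bot_le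
    · refine Or.inl ?_
      rcases hF.chain.total hW hW₁.1.1 with h1 | h1
      · exact hW₁.2 ⟨hW, hne⟩ h1 hx
      · exact h1 hx
  · refine (hW₀ W hW).imp_right fun h z hz => ?_
    have := hle (h hz)
    rw [LinearMap.mem_ker] at this ⊢
    rw [hc, this, mul_zero]

end LinearAlgebra

variable {V : Type} [Quiver.{0} V]

/-- Along an arrow, the vectors `X` and the linear forms `Φ` at its ends define a morphism of
representations, and the arrow takes nonzero vectors of the family to each other. -/
def ArrowCompatible (L : QuiverRep V) (X : ∀ w, L.space w) (Φ : ∀ w, L.space w →ₗ[ℂ] ℂ) {v w : V}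
    (f : v ⟶ w) : Prop :=
  (∀ z, Φ w (L.arrowMap f z) • X w = Φ v z • L.arrowMap f (X v)) ∧
    (X v ≠ 0 → X w ≠ 0 → L.arrowMap f (X v) = X w)

/-- Splittings of the space at the `m`-th vertex of a half-line extend to the half-line, if they are
compatible with a certain flag. -/
theorem exists_flag_extension (L : QuiverRep V) (pos : V → ℕ) (inj : Function.Injective pos)
    (down : ∀ (v : V) (m : ℕ), pos v = m + 1 → ∃ u, pos u = m)
    (edge : ∀ u v : V, pos u + 1 = pos v → Nonempty (u ⟶ v) ∨ Nonempty (v ⟶ u))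
    (adj : ∀ u v : V, (u ⟶ v) → pos u + 1 = pos v ∨ pos v + 1 = pos u)
    (asymm : ∀ u v : V, (u ⟶ v) → (v ⟶ u) → False) (uniq : ∀ u v : V, Subsingleton (u ⟶ v)) (m : ℕ) :
    ∀ v, pos v = m → ∃ F : Set (Submodule ℂ (L.space v)), IsFlag F ∧
      ∀ x φ, FlagCompatible F x φ → ∃ (X : ∀ w, L.space w) (Φ : ∀ w, L.space w →ₗ[ℂ] ℂ),
        X v = x ∧ Φ v = φ ∧ (∀ w, pos w ≤ m → Φ w (X w) = 1 ∨ (X w = 0 ∧ Φ w = 0)) ∧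
        (∀ w w' (f : w ⟶ w'), pos w ≤ m → pos w' ≤ m → ArrowCompatible L X Φ f) ∧
        (∀ w w', pos w ≤ pos w' → pos w' ≤ m → X w ≠ 0 → X w' ≠ 0) := by
  classical
  induction m with
  | zero =>
    intro v hv
    refine ⟨{⊥, ⊤}, ⟨Set.toFinite _, ?_, by simp, by simp⟩, fun x φ h => ?_⟩
    · exact (IsChain.singleton).insert fun _ _ _ => Or.inl bot_le
    · refine ⟨Function.update (fun _ => 0) v x, Function.update (fun _ => 0) v φ, by simp, by simp,
        ?_, ?_, ?_⟩
      · intro w hw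
        obtain rfl : w = v := inj (by omega)
        simpa using Or.inl h.1
      · intro w w' f hw hw'
        have := adj w w' f
        omega
      · intro w w' hw hw'
        obtain rfl : w = w' := inj (by omega)
        exact id
  | succ m ih =>
    intro v hv
    obtain ⟨u, hu⟩ := down v m hv
    obtain ⟨F, hF, hext⟩ := ih u hu
    have huv : u ≠ v := by rintro rfl; omega
    -- Adding the vertex `v` to a solution on the positions up to `m` leaves only the edge between
    -- `u` and `v` to be checked.
    have key : ∀ (X : ∀ w, L.space w) (Φ : ∀ w, L.space w →ₗ[ℂ] ℂ) x φ, φ x = 1 →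
        (∀ w, pos w ≤ m → Φ w (X w) = 1 ∨ (X w = 0 ∧ Φ w = 0)) →
        (∀ w w' (f : w ⟶ w'), pos w ≤ m → pos w' ≤ m → ArrowCompatible L X Φ f) →
        (∀ w w', pos w ≤ pos w' → pos w' ≤ m → X w ≠ 0 → X w' ≠ 0) →
        (∀ f : u ⟶ v, ArrowCompatible L (Function.update X v x) (Function.update Φ v φ) f) →
        (∀ f : v ⟶ u, ArrowCompatible L (Function.update X v x) (Function.update Φ v φ) f) →
        ∃ (X : ∀ w, L.space w) (Φ : ∀ w, L.space w →ₗ[ℂ] ℂ),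
        X v = x ∧ Φ v = φ ∧ (∀ w, pos w ≤ m + 1 → Φ w (X w) = 1 ∨ (X w = 0 ∧ Φ w = 0)) ∧
        (∀ w w' (f : w ⟶ w'), pos w ≤ m + 1 → pos w' ≤ m + 1 → ArrowCompatible L X Φ f) ∧
        (∀ w w', pos w ≤ pos w' → pos w' ≤ m + 1 → X w ≠ 0 → X w' ≠ 0) := by
      intro X Φ x φ hx h1 h2 h3 h4 h5
      have hne : ∀ w, pos w ≤ m → w ≠ v := by rintro w hw rfl; omega
      refine ⟨Function.update X v x, Function.update Φ v φ, by simp, by simp, ?_, ?_, ?_⟩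
      · intro w hw
        by_cases hwv : w = v
        · subst hwv
          simpa using Or.inl hx
        · have : pos w ≠ m + 1 := fun h => hwv (inj (h.trans hv.symm))
          simpa [hwv] using h1 w (by omega)
      · intro w w' f hw hw'
        by_cases hwv : w = v
        · subst hwv
          obtain rfl : w' = u := inj (by have := adj w w' f; omega)
          exact h5 f
        · by_cases hwv' : w' = v
          · subst hwv'
            obtain rfl : w = u := inj (by have := adj w w' f; omega)
            exact h4 f
          · have : pos w ≠ m + 1 := fun h => hwv (inj (h.trans hv.symm))
            have : pos w' ≠ m + 1 := fun h => hwv' (inj (h.trans hv.symm))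
            have := h2 w w' f (by omega) (by omega)
            simpa [ArrowCompatible, hwv, hwv'] using this
      · intro w w' hw hw'
        by_cases hwv' : w' = v
        · subst hwv'
          have hx0 : x ≠ 0 := by rintro rfl; simp at hx
          simpa using fun _ => hx0
        · have : pos w' ≠ m + 1 := fun h => hwv' (inj (h.trans hv.symm))
          simpa [hwv', hne w (by omega)] using h3 w w' hw (by omega)
    -- If the edge kills the splitting, the summand ends at `v` and is extended by zero.
    have zero : ∀ (x) (φ : L.space v →ₗ[ℂ] ℂ), φ x = 1 →
        (∀ f : u ⟶ v, φ ∘ₗ L.arrowMap f = 0) →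
        (∀ f : v ⟶ u, L.arrowMap f x = 0) → _ := fun x φ hx h1 h2 =>
      key (fun _ => 0) (fun _ => 0) x φ hx (fun _ _ => Or.inr ⟨rfl, rfl⟩)
        (fun _ _ _ _ _ => ⟨by simp, by simp⟩) (fun _ _ _ _ => by simp)
        (fun f => by
          have := fun z => LinearMap.congr_fun (h1 f) z
          simp only [LinearMap.comp_apply, LinearMap.zero_apply] at this
          simp [ArrowCompatible, huv, this])
        (fun f => by simp [ArrowCompatible, huv, h2 f])
    rcases edge u v (by omega) with ⟨⟨f⟩⟩ | ⟨⟨f⟩⟩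
    · refine ⟨_, hF.push (L.arrowMap f), fun x φ h => ?_⟩
      by_cases h0 : φ ∘ₗ L.arrowMap f = 0
      · exact zero x φ h.1 (fun f' => by rw [Subsingleton.elim f' f, h0])
          (fun f' => (asymm _ _ f f').elim)
      · obtain ⟨x', hx', hc⟩ := h.of_push hF h0
        obtain ⟨X, Φ, hX, hΦ, h1, h2, h3⟩ := hext _ _ hc
        refine key X Φ x φ h.1 h1 h2 h3 (fun f' => ?_) (fun f' => (asymm _ _ f f').elim)
        rw [Subsingleton.elim f' f]
        simp [ArrowCompatible, huv, hX, hΦ, hx']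
    · refine ⟨_, hF.pull (L.arrowMap f), fun x φ h => ?_⟩
      by_cases h0 : L.arrowMap f x = 0
      · exact zero x φ h.1 (fun f' => (asymm _ _ f f').elim)
          (fun f' => by rw [Subsingleton.elim f' f, h0])
      · obtain ⟨φ', hφ', hc⟩ := h.of_pull hF h0
        obtain ⟨X, Φ, hX, hΦ, h1, h2, h3⟩ := hext _ _ hc
        refine key X Φ x φ h.1 h1 h2 h3 (fun f' => (asymm _ _ f f').elim) (fun f' => ?_)
        rw [Subsingleton.elim f' f]
        have := fun z => LinearMap.congr_fun hφ' z
        simp only [LinearMap.comp_apply] at this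
        simp [ArrowCompatible, huv, hX, hΦ, this]

namespace ZigzagCoords

variable {n : ℕ} (C : ZigzagCoords V n)

theorem hom_asymm (C : ZigzagCoords V n) {u v : V} (f : u ⟶ v) (g : v ⟶ u) : False := by
  have := C.arrow_le f
  have := C.arrow_le g
  have := C.arrow_adj f
  have := C.r_eq u
  have := C.r_eq v
  omega

/-- Every nonempty convex set of vertices is the set of arcs crossed by some arc. -/
theorem exists_supp_iff {P : V → Prop} (hne : ∃ v, P v)
    (hP : ∀ u v w, P u → P w → (C.idx u : ℕ) ≤ C.idx v → (C.idx v : ℕ) ≤ C.idx w → P v) :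
    ∃ a b, ∀ v, C.supp a b v ↔ P v := by
  have : Finite V := Finite.of_equiv _ C.idx.symm
  obtain ⟨u, hu, humin⟩ := Set.exists_min_image {v | P v} (fun v => (C.idx v : ℕ))
    (Set.toFinite _) hne
  obtain ⟨w, hw, hwmax⟩ := Set.exists_max_image {v | P v} (fun v => (C.idx v : ℕ))
    (Set.toFinite _) hne
  -- The left end is the third vertex of the triangle just before the arc of `u`: the endpoint that
  -- was moved to reach `u`, or the tip `C.l u + 1` at the start of the line.
  have hA : ∃ a, ∀ v, (C.l v < a ∧ a < C.r v) ↔ (C.idx u : ℕ) ≤ C.idx v := by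
    rcases Nat.eq_zero_or_pos (C.idx u : ℕ) with h0 | h0
    · refine ⟨C.l u + 1, fun v => ?_⟩
      have h1 := C.l_anti (v := u) (w := v) (by omega)
      have h2 := C.r_mono (v := u) (w := v) (by omega)
      have h3 := C.r_eq u
      omega
    · obtain ⟨t, ht⟩ := C.exists_idx (i := C.idx u - 1) (by have := C.idx_lt u; omega)
      have hr := C.r_eq u
      have hedge := C.edge (v := t) (w := u) (by omega)
      rcases hedge with ⟨h1, h2, -⟩ | ⟨h1, h2, -⟩
      · refine ⟨C.r t, fun v => ⟨fun h => ?_, fun h => ?_⟩⟩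
        · by_contra hlt
          have := C.r_mono (v := v) (w := t) (by omega)
          omega
        · have := C.l_anti h
          have := C.r_mono h
          omega
      · refine ⟨C.l t, fun v => ⟨fun h => ?_, fun h => ?_⟩⟩
        · by_contra hlt
          have := C.l_anti (v := v) (w := t) (by omega)
          omega
        · have := C.l_anti h
          have := C.r_mono h
          omega
  -- The right end is the third vertex of the triangle just after the arc of `w`, lifted to the
  -- right of that arc.
  have hB : ∃ b, ∀ v, (C.r v < b ∧ b < C.l v + n + 3) ↔ (C.idx v : ℕ) ≤ C.idx w := by
    have hwn := C.idx_lt w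
    have hr := C.r_eq w
    rcases Nat.lt_or_ge (C.idx w + 1 : ℕ) n with h0 | h0
    · obtain ⟨t, ht⟩ := C.exists_idx h0
      have hedge := C.edge (v := w) (w := t) (by omega)
      rcases hedge with ⟨h1, h2, -⟩ | ⟨h1, h2, -⟩
      · refine ⟨C.r t, fun v => ⟨fun h => ?_, fun h => ?_⟩⟩
        · by_contra hlt
          have := C.r_mono (v := t) (w := v) (by omega)
          omega
        · have := C.l_anti h
          have := C.r_mono h
          omega
      · refine ⟨C.l t + n + 3, fun v => ⟨fun h => ?_, fun h => ?_⟩⟩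
        · by_contra hlt
          have := C.l_anti (v := t) (w := v) (by omega)
          omega
        · have := C.l_anti h
          have := C.r_mono h
          omega
    · refine ⟨C.r w + 1, fun v => ?_⟩
      have hv := C.idx_lt v
      have h1 := C.l_anti (v := v) (w := w) (by omega)
      have h2 := C.r_mono (v := v) (w := w) (by omega)
      omega
  obtain ⟨a, ha⟩ := hA
  obtain ⟨b, hb⟩ := hB
  refine ⟨a, b, fun v => ?_⟩
  have : C.supp a b v ↔ (C.l v < a ∧ a < C.r v) ∧ (C.r v < b ∧ b < C.l v + n + 3) := by
    unfold supp
    tauto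
  rw [this, ha, hb]
  exact ⟨fun h => hP u v w hu hw h.1 h.2, fun h => ⟨humin v h, hwmax v h⟩⟩

/-- Every nonzero representation has a thin direct summand. -/
theorem exists_thin_summand (L : QuiverRep V) (hL : ¬ IsZero L) :
    ∃ a b, (∃ v, C.supp a b v) ∧ ∃ (s : C.thin a b ⟶ L) (p : L ⟶ C.thin a b), s ≫ p = 𝟙 _ := by
  classical
  rw [QuiverRep.isZero_iff] at hL
  push Not at hL
  obtain ⟨i, z, hz⟩ := hL
  have : Nontrivial (L.space i) := ⟨z, 0, hz⟩
  obtain ⟨F, hF, hFext⟩ := exists_flag_extension L (fun v => C.idx v)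
    (fun u v h => C.idx_inj h) (fun v m h => C.exists_idx (by have := C.idx_lt v; omega))
    (fun u v h => (C.edge h).elim (fun h => Or.inr h.2.2) (fun h => Or.inl h.2.2))
    (fun u v => C.arrow_adj) (fun u v => C.hom_asymm) C.hom_subsingleton _ i rfl
  -- The other half of the line, numbered from the far end; it puts a second flag on the space at
  -- `i`.
  obtain ⟨E, hE, hEext⟩ := exists_flag_extension L (fun v => n - 1 - C.idx v)
    (fun u v h => C.idx_inj (by have := C.idx_lt u; have := C.idx_lt v; simp only at h; omega))
    (fun v m h => by
      have := C.idx_lt v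
      obtain ⟨u, hu⟩ := C.exists_idx (i := C.idx v + 1) (by omega)
      exact ⟨u, by omega⟩)
    (fun u v h => (C.edge (v := v) (w := u)
      (by have := C.idx_lt u; have := C.idx_lt v; omega)).elim
        (fun h => Or.inl h.2.2) (fun h => Or.inr h.2.2))
    (fun u v f => by
      have := C.arrow_adj f
      have := C.idx_lt u
      have := C.idx_lt v
      omega) (fun u v => C.hom_asymm) C.hom_subsingleton _ i rfl
  -- A splitting at `i` that suits both flags extends in both directions, and the two extensions are
  -- glued at `i`.
  obtain ⟨x, φ, hFc, hEc⟩ := exists_flagCompatible hF hE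
  obtain ⟨X, Φ, hX, hΦ, h1, h2, h3⟩ := hFext x φ hFc
  obtain ⟨X', Φ', hX', hΦ', h1', h2', h3'⟩ := hEext x φ hEc
  obtain ⟨Y, hY⟩ : ∃ Y : ∀ w, L.space w, Y = fun w =>
    if (C.idx w : ℕ) ≤ C.idx i then X w else X' w := ⟨_, rfl⟩
  obtain ⟨Ψ, hΨ⟩ : ∃ Ψ : ∀ w, L.space w →ₗ[ℂ] ℂ, Ψ = fun w =>
    if (C.idx w : ℕ) ≤ C.idx i then Φ w else Φ' w := ⟨_, rfl⟩
  have lo : ∀ w, (C.idx w : ℕ) ≤ C.idx i → Y w = X w ∧ Ψ w = Φ w := fun w h =>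
    ⟨by rw [hY]; exact if_pos h, by rw [hΨ]; exact if_pos h⟩
  have hi : ∀ w, (C.idx i : ℕ) ≤ C.idx w → Y w = X' w ∧ Ψ w = Φ' w := fun w h => by
    rcases h.lt_or_eq with h | h
    · exact ⟨by rw [hY]; exact if_neg (not_le.2 h), by rw [hΨ]; exact if_neg (not_le.2 h)⟩
    · obtain rfl := C.idx_inj h
      rw [(lo i le_rfl).1, (lo i le_rfl).2, hX, hX', hΦ, hΦ']
      exact ⟨rfl, rfl⟩
  have one : ∀ w, Ψ w (Y w) = 1 ∨ (Y w = 0 ∧ Ψ w = 0) := fun w => by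
    have := C.idx_lt w
    rcases le_total (C.idx w : ℕ) (C.idx i) with h | h
    · rw [(lo w h).1, (lo w h).2]
      exact h1 w h
    · rw [(hi w h).1, (hi w h).2]
      exact h1' w (by omega)
  have arr : ∀ w w' (f : w ⟶ w'), ArrowCompatible L Y Ψ f := fun w w' f => by
    have := C.arrow_adj f
    have := C.idx_lt w
    have := C.idx_lt w'
    have hcase : ((C.idx w : ℕ) ≤ C.idx i ∧ (C.idx w' : ℕ) ≤ C.idx i) ∨
        ((C.idx i : ℕ) ≤ C.idx w ∧ (C.idx i : ℕ) ≤ C.idx w') := by omega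
    rcases hcase with ⟨h, h'⟩ | ⟨h, h'⟩
    · have := h2 w w' f h h'
      unfold ArrowCompatible at *
      rwa [(lo w h).1, (lo w h).2, (lo w' h').1, (lo w' h').2]
    · have := h2' w w' f (by omega) (by omega)
      unfold ArrowCompatible at *
      rwa [(hi w h).1, (hi w h).2, (hi w' h').1, (hi w' h').2]
  have conn : ∀ u v w, Y u ≠ 0 → Y w ≠ 0 → (C.idx u : ℕ) ≤ C.idx v → (C.idx v : ℕ) ≤ C.idx w →
      Y v ≠ 0 := fun u v w hu hw huv hvw => by
    have := C.idx_lt w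
    rcases le_total (C.idx v : ℕ) (C.idx i) with h | h
    · rw [(lo v h).1]
      rw [(lo u (huv.trans h)).1] at hu
      exact h3 u v huv h hu
    · rw [(hi v h).1]
      rw [(hi w (h.trans hvw)).1] at hw
      exact h3' w v (by omega) (by omega) hw
  have hYi : Y i ≠ 0 := fun h => by
    have := hFc.1
    rw [← hX, ← (lo i le_rfl).1, h, map_zero] at this
    exact zero_ne_one this
  obtain ⟨a, b, hab⟩ := C.exists_supp_iff (P := fun v => Y v ≠ 0) ⟨i, hYi⟩ conn
  have hone : ∀ w, C.supp a b w → Ψ w (Y w) = 1 := fun w hw =>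
    (one w).resolve_right fun h => (hab w).1 hw h.1
  have hzero : ∀ w, ¬ C.supp a b w → Y w = 0 := fun w hw => by
    by_contra h
    exact hw ((hab w).2 h)
  refine ⟨a, b, ⟨i, (hab i).2 hYi⟩, C.thinDesc L Y ?_ ?_, QuiverRep.homMk (fun w =>
    (LinearMap.toSpanSingleton ℂ _ (C.gen a b w)) ∘ₗ Ψ w) ?_, ?_⟩
  · exact fun v w f hv hw => (arr v w f).2 ((hab v).1 hv) ((hab w).1 hw)
  · intro v w f hv hw
    have := (arr v w f).1 (Y v)
    rw [hone v hv, one_smul, hzero w hw, smul_zero] at this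
    exact this.symm
  · intro v w f
    ext z
    simp only [LinearMap.comp_apply, LinearMap.toSpanSingleton_apply, map_smul]
    have h := (arr v w f).1 z
    by_cases hw : C.supp a b w
    · by_cases hv : C.supp a b v
      · rw [(arr v w f).2 ((hab v).1 hv) ((hab w).1 hw)] at h
        rw [C.arrowMap_gen f hv, smul_left_injective ℂ ((hab w).1 hw) h]
      · rw [hzero v hv, map_zero, smul_zero, smul_eq_zero] at h
        rw [h.resolve_right ((hab w).1 hw), zero_smul, C.gen_eq_zero hv, map_zero, smul_zero]
    · rw [C.gen_eq_zero hw, smul_zero]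
      by_cases hv : C.supp a b v
      · rw [C.arrowMap_gen f hv, C.gen_eq_zero hw, smul_zero]
      · rw [C.gen_eq_zero hv, map_zero, smul_zero]
  · apply C.thin_hom_ext
    intro v hv
    rw [QuiverRep.component_comp_apply, C.thinDesc_gen _ _ _ _ hv, QuiverRep.component_homMk,
      LinearMap.comp_apply, hone v hv, LinearMap.toSpanSingleton_apply, one_smul]
    rfl

end ZigzagCoords

end Classification

/-! ### Indecomposables, almost split maps and irreducible morphisms -/

section AuslanderReitenQuiver

variable {V : Type} [Quiver.{0} V]

/-- The projection onto a summand `Y` is a scalar `c`; it is the identity on `Y` and zero on `Z`, so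
`Y` vanishes if `c = 0` and `Z` vanishes otherwise. -/
theorem indecomposable_of_scalar_endomorphisms {X : QuiverRep V} (hX : ¬ IsZero X)
    (h : ∀ f : X ⟶ X, ∃ c : ℂ, f = c • 𝟙 X) : Indecomposable X := by
  refine ⟨hX, fun Y Z e => ?_⟩
  obtain ⟨c, hc⟩ := h (e.hom ≫ biprod.fst ≫ biprod.inl ≫ e.inv)
  have hfst : biprod.fst ≫ biprod.inl = c • 𝟙 (Y ⊞ Z) := by
    have := congrArg (fun t => e.inv ≫ t ≫ e.hom) hc
    simpa using this
  by_cases h0 : c = 0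
  · left
    rw [h0, zero_smul] at hfst
    rw [IsZero.iff_id_eq_zero]
    simpa using congrArg (fun t => biprod.inl ≫ t ≫ biprod.fst) hfst
  · right
    rw [IsZero.iff_id_eq_zero]
    have := congrArg (fun t => biprod.inr ≫ t ≫ biprod.snd) hfst
    simp only [biprod.inr_fst_assoc, zero_comp, Category.assoc, Linear.smul_comp,
      Linear.comp_smul, Category.id_comp, biprod.inr_snd] at this
    exact (smul_eq_zero.1 this.symm).resolve_left h0

theorem QuiverRep.exists_biprod_iso {M L : QuiverRep V} (s : M ⟶ L) (p : L ⟶ M)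
    (h : s ≫ p = 𝟙 M) : ∃ (K : QuiverRep V) (ι : K ⟶ L), ι ≫ p = 0 ∧ Mono ι ∧
      Nonempty (L ≅ M ⊞ K) := by
  have hs : IsSplitMono s := ⟨⟨⟨p, h⟩⟩⟩
  refine ⟨kernel p, kernel.ι p, kernel.condition p, inferInstance, ⟨?_⟩⟩
  refine ⟨biprod.lift p (kernel.lift p (𝟙 L - p ≫ s) ?_), biprod.desc s (kernel.ι p), ?_, ?_⟩
  · simp [h]
  · simp
  · apply biprod.hom_ext'
    · apply biprod.hom_ext
      · simp [h]
      · rw [← cancel_mono (kernel.ι p)]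
        simp [reassoc_of% h]
    · apply biprod.hom_ext
      · simp
      · rw [← cancel_mono (kernel.ι p)]
        simp

theorem QuiverRep.injective_of_mono {M N : QuiverRep V} (f : M ⟶ N) [Mono f] (i : V) :
    Function.Injective (component f i) := by
  have h1 : Mono (f.app ((Paths.of V).obj i)) := inferInstance
  have h2 : Mono ((forget₂ (FGModuleCat ℂ) (ModuleCat ℂ)).map (f.app ((Paths.of V).obj i))) :=
    inferInstance
  exact (ModuleCat.mono_iff_injective _).1 h2

theorem QuiverRep.iso_of_indecomposable {M L : QuiverRep V} (hL : Indecomposable L)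
    (hM : ¬ IsZero M) (s : M ⟶ L) (p : L ⟶ M) (h : s ≫ p = 𝟙 M) : Nonempty (L ≅ M) := by
  obtain ⟨K, ι, hι, hmono, ⟨e⟩⟩ := exists_biprod_iso s p h
  rcases hL.2 _ _ e with h0 | h0
  · exact absurd h0 hM
  · have := (Biprod.isIso_inl_iff_isZero M K).2 h0
    exact ⟨e ≪≫ (asIso (biprod.inl : M ⟶ M ⊞ K)).symm⟩

theorem IsIrreducibleMorphism.of_iso {M N M' N' : QuiverRep V} {f : M ⟶ N}
    (hf : IsIrreducibleMorphism f) (e : M' ≅ M) (e' : N ≅ N') :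
    IsIrreducibleMorphism (e.hom ≫ f ≫ e'.hom) := by
  refine ⟨fun h => hf.1 ?_, fun h => hf.2.1 ?_, fun L g k hgk => ?_⟩
  · obtain ⟨⟨⟨r, hr⟩⟩⟩ := h
    refine ⟨⟨⟨e'.hom ≫ r ≫ e.hom, ?_⟩⟩⟩
    have := congrArg (fun t => e.inv ≫ t ≫ e.hom) hr
    simpa using this
  · obtain ⟨⟨⟨r, hr⟩⟩⟩ := h
    refine ⟨⟨⟨e'.hom ≫ r ≫ e.hom, ?_⟩⟩⟩
    have := congrArg (fun t => e'.hom ≫ t ≫ e'.inv) hr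
    simpa using this
  · rcases hf.2.2 L (e.inv ≫ g) (k ≫ e'.inv) (by
      rw [Category.assoc, ← Category.assoc g, hgk]
      simp) with ⟨⟨⟨r, hr⟩⟩⟩ | ⟨⟨⟨r, hr⟩⟩⟩
    · refine Or.inl ⟨⟨⟨r ≫ e.inv, ?_⟩⟩⟩
      have := congrArg (fun t => e.hom ≫ t ≫ e.inv) hr
      simpa using this
    · refine Or.inr ⟨⟨⟨e'.inv ≫ r, ?_⟩⟩⟩
      have := congrArg (fun t => e'.inv ≫ t ≫ e'.hom) hr
      simpa using this

namespace ZigzagCoords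

variable {n : ℕ} (C : ZigzagCoords V n)

/-- Splitting off a thin summand lowers the total dimension. This takes the place of the
Krull–Schmidt theorem: a property that passes to direct sums need only be checked on thin
representations. -/
theorem thin_induction {P : QuiverRep V → Prop} (iso : ∀ M N : QuiverRep V, (M ≅ N) → P M → P N)
    (zero : ∀ M, IsZero M → P M) (thin : ∀ a b, (∃ v, C.supp a b v) → P (C.thin a b))
    (biprod : ∀ M N : QuiverRep V, P M → P N → P (M ⊞ N)) (L : QuiverRep V) : P L := by
  let : Fintype V := Fintype.ofEquiv _ C.idx.symm
  obtain ⟨d, hd⟩ : ∃ d, ∑ v, L.dimVec v ≤ d := ⟨_, le_rfl⟩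
  induction d generalizing L with
  | zero =>
    apply zero
    rw [QuiverRep.isZero_iff]
    intro v z
    have h : L.dimVec v = 0 := Finset.sum_eq_zero_iff.1 (Nat.le_zero.1 hd) v (Finset.mem_univ v)
    have := Module.finrank_zero_iff.1 h
    exact Subsingleton.elim _ _
  | succ d ih =>
    by_cases hL : IsZero L
    · exact zero L hL
    · obtain ⟨a, b, ⟨i, hi⟩, s, p, hsp⟩ := C.exists_thin_summand L hL
      obtain ⟨K, ι, hι, hmono, ⟨e⟩⟩ := QuiverRep.exists_biprod_iso s p hsp
      refine iso _ _ e.symm (biprod _ _ (thin a b ⟨i, hi⟩) (ih K ?_))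
      have hle : ∀ v, K.dimVec v ≤ L.dimVec v := fun v =>
        LinearMap.finrank_le_finrank_of_injective (QuiverRep.injective_of_mono ι v)
      -- If `ι` were onto at `i`, the generator of the thin summand would come from `K`, which `p`
      -- kills.
      have hlt : K.dimVec i < L.dimVec i := by
        refine lt_of_le_of_ne (hle i) fun heq => ?_
        have hsurj := (LinearMap.injective_iff_surjective_of_finrank_eq_finrank heq).1
          (QuiverRep.injective_of_mono ι i)
        obtain ⟨z, hz⟩ := hsurj (QuiverRep.component s i (C.gen a b i))
        have h1 := QuiverRep.injective_of_splitMono s p hsp i (C.gen a b i)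
        rw [← hz, ← QuiverRep.component_comp_apply, hι] at h1
        exact C.gen_ne_zero hi h1.symm
      have := Finset.sum_lt_sum (fun v _ => hle v) ⟨i, Finset.mem_univ i, hlt⟩
      omega

variable {a b a' b' : ℤ}

theorem not_isZero_thin (h : ∃ v, C.supp a b v) : ¬ IsZero (C.thin a b) := fun h0 =>
  h.elim fun v hv => C.isZero_thin_iff.1 h0 v hv

theorem thin_endomorphism (f : C.thin a b ⟶ C.thin a b) : ∃ c : ℂ, f = c • 𝟙 _ := by
  obtain ⟨c, hc⟩ := C.exists_eq_smul_can le_rfl le_rfl f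
  exact ⟨c, by rw [hc, C.can_refl]⟩

theorem indecomposable_thin (h : ∃ v, C.supp a b v) : Indecomposable (C.thin a b) :=
  indecomposable_of_scalar_endomorphisms (C.not_isZero_thin h) C.thin_endomorphism

theorem exists_iso_thin {M : QuiverRep V} (hM : Indecomposable M) :
    ∃ a b, (∃ v, C.supp a b v) ∧ Nonempty (M ≅ C.thin a b) := by
  obtain ⟨a, b, h, s, p, hsp⟩ := C.exists_thin_summand M hM.1
  exact ⟨a, b, h, QuiverRep.iso_of_indecomposable hM (C.not_isZero_thin h) s p hsp⟩

theorem eq_of_comp_ne_zero {f : C.thin a b ⟶ C.thin a' b'} {g : C.thin a' b' ⟶ C.thin a b}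
    (h : f ≫ g ≠ 0) : a = a' ∧ b = b' := by
  have h1 : f ≠ 0 := by rintro rfl; simp at h
  have h2 : g ≠ 0 := by rintro rfl; simp at h
  have := C.le_of_hom_ne_zero h1
  have := C.le_of_hom_ne_zero h2
  omega

theorem id_ne_zero (h : ∃ v, C.supp a b v) : 𝟙 (C.thin a b) ≠ 0 := fun h0 =>
  C.not_isZero_thin h ((IsZero.iff_id_eq_zero _).2 h0)

theorem eq_of_iso (h : ∃ v, C.supp a b v) (e : C.thin a b ≅ C.thin a' b') : a = a' ∧ b = b' :=
  C.eq_of_comp_ne_zero (f := e.hom) (g := e.inv) (by rw [e.hom_inv_id]; exact C.id_ne_zero h)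

theorem can_ne_zero {ha : a ≤ a'} {hb : b ≤ b'} {v : V} (hv : C.supp a b v)
    (hv' : C.supp a' b' v) : C.can a b a' b' ha hb ≠ 0 := fun h => by
  have := C.can_gen (ha := ha) (hb := hb) hv
  rw [h] at this
  exact C.gen_ne_zero hv' this.symm

/-- The minimal right almost split morphism that ends at a thin representation. -/
def sink (a b : ℤ) : C.thin (a - 1) b ⊞ C.thin a (b - 1) ⟶ C.thin a b :=
  biprod.desc (C.can _ _ _ _ (by omega) (by omega)) (C.can _ _ _ _ (by omega) (by omega))

/-- Each summand of the source has a smaller left or right end, so both components of a section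
would vanish. -/
theorem not_isSplitEpi_sink (h : ∃ v, C.supp a b v) : ¬ IsSplitEpi (C.sink a b) := by
  rintro ⟨⟨⟨s, hs⟩⟩⟩
  have h1 : s ≫ biprod.fst = 0 := C.hom_eq_zero_of_lt_left (by omega) _
  have h2 : s ≫ biprod.snd = 0 := C.hom_eq_zero_of_lt_right (by omega) _
  have h0 : s = 0 := biprod.hom_ext _ _ (by rw [h1, zero_comp]) (by rw [h2, zero_comp])
  rw [h0, zero_comp] at hs
  exact C.id_ne_zero h hs.symm

/-- The claim is additive in `L`, so let `L` be thin at $[a_0,b_0]$ and the map a nonzero multiple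
of the canonical one. It factors through $[a-1,b]$ if $a_0<a$, through $[a,b-1]$ if $b_0<b$, and is
an isomorphism otherwise. -/
theorem sink_almostSplit (L : QuiverRep V) (h : L ⟶ C.thin a b) (hh : ¬ IsSplitEpi h) :
    ∃ h' : L ⟶ C.thin (a - 1) b ⊞ C.thin a (b - 1), h' ≫ C.sink a b = h := by
  revert h
  refine C.thin_induction (P := fun L => ∀ h : L ⟶ C.thin a b, ¬ IsSplitEpi h →
    ∃ h' : L ⟶ C.thin (a - 1) b ⊞ C.thin a (b - 1), h' ≫ C.sink a b = h) ?_ ?_ ?_ ?_ L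
  · intro M N e hM h hh
    obtain ⟨h', hh'⟩ := hM (e.hom ≫ h) fun ⟨⟨⟨s, hs⟩⟩⟩ =>
      hh ⟨⟨⟨s ≫ e.hom, by rw [Category.assoc, hs]⟩⟩⟩
    exact ⟨e.inv ≫ h', by rw [Category.assoc, hh', e.inv_hom_id_assoc]⟩
  · exact fun M hM h _ => ⟨0, hM.eq_of_src _ _⟩
  · intro a₀ b₀ _ h hh
    by_cases h0 : h = 0
    · exact ⟨0, by rw [h0, zero_comp]⟩
    · have hle := C.le_of_hom_ne_zero h0
      obtain ⟨c, rfl⟩ := C.exists_eq_smul_can hle.1 hle.2 h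
      rcases hle.1.lt_or_eq with hlt | heq
      · exact ⟨(c • C.can a₀ b₀ (a - 1) b (by omega) hle.2) ≫ biprod.inl, by
          rw [sink, Category.assoc, biprod.inl_desc, Linear.smul_comp, C.can_comp]⟩
      · rcases hle.2.lt_or_eq with hlt | heq'
        · exact ⟨(c • C.can a₀ b₀ a (b - 1) hle.1 (by omega)) ≫ biprod.inr, by
            rw [sink, Category.assoc, biprod.inr_desc, Linear.smul_comp, C.can_comp]⟩
        · subst heq heq'
          have hc : c ≠ 0 := by rintro rfl; simp at h0
          refine absurd ⟨⟨⟨c⁻¹ • 𝟙 _, ?_⟩⟩⟩ hh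
          rw [C.can_refl, Linear.smul_comp, Linear.comp_smul, Category.comp_id, smul_smul,
            inv_mul_cancel₀ hc, one_smul]
  · intro M N hM hN h hh
    obtain ⟨p, hp⟩ := hM (biprod.inl ≫ h) fun ⟨⟨⟨s, hs⟩⟩⟩ =>
      hh ⟨⟨⟨s ≫ biprod.inl, by rw [Category.assoc, hs]⟩⟩⟩
    obtain ⟨q, hq⟩ := hN (biprod.inr ≫ h) fun ⟨⟨⟨s, hs⟩⟩⟩ =>
      hh ⟨⟨⟨s ≫ biprod.inr, by rw [Category.assoc, hs]⟩⟩⟩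
    refine ⟨biprod.desc p q, ?_⟩
    apply biprod.hom_ext'
    · rw [biprod.inl_desc_assoc, hp]
    · rw [biprod.inr_desc_assoc, hq]

/-- The conditions on the left ends pass to larger indices and the right end is shared, so the
larger of the two vertices serves. This makes canonical maps between neighbouring arcs nonzero. -/
theorem exists_supp_common_left (h : ∃ v, C.supp a b v) (h' : ∃ v, C.supp a' b v) :
    ∃ v, C.supp a b v ∧ C.supp a' b v := by
  obtain ⟨v, hv⟩ := h
  obtain ⟨w, hw⟩ := h'
  unfold supp at *
  rcases le_total (C.idx v : ℕ) (C.idx w) with h | h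
  · have := C.l_anti h
    have := C.r_mono h
    exact ⟨w, by omega, by omega⟩
  · have := C.l_anti h
    have := C.r_mono h
    exact ⟨v, by omega, by omega⟩

theorem exists_supp_common_right (h : ∃ v, C.supp a b v) (h' : ∃ v, C.supp a b' v) :
    ∃ v, C.supp a b v ∧ C.supp a b' v := by
  obtain ⟨v, hv⟩ := h
  obtain ⟨w, hw⟩ := h'
  unfold supp at *
  rcases le_total (C.idx v : ℕ) (C.idx w) with h | h
  · have := C.l_anti h
    have := C.r_mono h
    exact ⟨v, by omega, by omega⟩
  · have := C.l_anti h
    have := C.r_mono h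
    exact ⟨w, by omega, by omega⟩

/-- If the second factor is not a split epimorphism, it factors through the sink map. The component
of `g ≫ k'` at $[a,b-1]$ vanishes for lack of morphisms, so its component at $[a-1,b]$ is a nonzero
scalar, and `g` splits. -/
theorem isIrreducible_can_left (h : ∃ v, C.supp (a - 1) b v) (h' : ∃ v, C.supp a b v) :
    IsIrreducibleMorphism (C.can (a - 1) b a b (by omega) le_rfl) := by
  refine ⟨?_, ?_, fun L g k hgk => or_iff_not_imp_right.2 fun hk => ?_⟩
  · rintro ⟨⟨⟨r, hr⟩⟩⟩
    rw [C.hom_eq_zero_of_lt_left (by omega) r, comp_zero] at hr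
    exact C.id_ne_zero h hr.symm
  · rintro ⟨⟨⟨r, hr⟩⟩⟩
    rw [C.hom_eq_zero_of_lt_left (by omega) r, zero_comp] at hr
    exact C.id_ne_zero h' hr.symm
  · obtain ⟨k', hk'⟩ := C.sink_almostSplit L k hk
    obtain ⟨c, hc⟩ := C.thin_endomorphism (g ≫ k' ≫ biprod.fst)
    have hz : g ≫ k' ≫ biprod.snd = 0 := C.hom_eq_zero_of_lt_right (by omega) _
    have hd : g ≫ k' = c • biprod.inl := by
      apply biprod.hom_ext
      · rw [Category.assoc, hc, Linear.smul_comp, biprod.inl_fst]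
      · rw [Category.assoc, hz, Linear.smul_comp, biprod.inl_snd, smul_zero]
    have hc0 : c ≠ 0 := by
      rintro rfl
      obtain ⟨v, hv, hv'⟩ := C.exists_supp_common_left h h'
      refine C.can_ne_zero (ha := by omega) (hb := le_rfl) hv hv' ?_
      rw [← hgk, ← hk', ← Category.assoc, hd, zero_smul, zero_comp]
    refine ⟨⟨⟨c⁻¹ • (k' ≫ biprod.fst), ?_⟩⟩⟩
    rw [Linear.comp_smul, hc, smul_smul, inv_mul_cancel₀ hc0, one_smul]

theorem isIrreducible_can_right (h : ∃ v, C.supp a (b - 1) v) (h' : ∃ v, C.supp a b v) :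
    IsIrreducibleMorphism (C.can a (b - 1) a b le_rfl (by omega)) := by
  refine ⟨?_, ?_, fun L g k hgk => or_iff_not_imp_right.2 fun hk => ?_⟩
  · rintro ⟨⟨⟨r, hr⟩⟩⟩
    rw [C.hom_eq_zero_of_lt_right (by omega) r, comp_zero] at hr
    exact C.id_ne_zero h hr.symm
  · rintro ⟨⟨⟨r, hr⟩⟩⟩
    rw [C.hom_eq_zero_of_lt_right (by omega) r, zero_comp] at hr
    exact C.id_ne_zero h' hr.symm
  · obtain ⟨k', hk'⟩ := C.sink_almostSplit L k hk
    obtain ⟨c, hc⟩ := C.thin_endomorphism (g ≫ k' ≫ biprod.snd)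
    have hz : g ≫ k' ≫ biprod.fst = 0 := C.hom_eq_zero_of_lt_left (by omega) _
    have hd : g ≫ k' = c • biprod.inr := by
      apply biprod.hom_ext
      · rw [Category.assoc, hz, Linear.smul_comp, biprod.inr_fst, smul_zero]
      · rw [Category.assoc, hc, Linear.smul_comp, biprod.inr_snd]
    have hc0 : c ≠ 0 := by
      rintro rfl
      obtain ⟨v, hv, hv'⟩ := C.exists_supp_common_right h h'
      refine C.can_ne_zero (ha := le_rfl) (hb := by omega) hv hv' ?_
      rw [← hgk, ← hk', ← Category.assoc, hd, zero_smul, zero_comp]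
    refine ⟨⟨⟨c⁻¹ • (k' ≫ biprod.snd), ?_⟩⟩⟩
    rw [Linear.comp_smul, hc, smul_smul, inv_mul_cancel₀ hc0, one_smul]

/-- An irreducible map factors through the sink map, hence its source splits off from
$[a'-1,b']\oplus[a',b'-1]$. The identity is then a sum of two composites through these summands; one
is nonzero, and this forces the arcs to be equal. -/
theorem exists_irreducible_iff {M N : QuiverRep V} (h : ∃ v, C.supp a b v)
    (h' : ∃ v, C.supp a' b' v) (e : M ≅ C.thin a b) (e' : N ≅ C.thin a' b') :
    (∃ f : M ⟶ N, IsIrreducibleMorphism f) ↔ (a' = a + 1 ∧ b' = b) ∨ (a' = a ∧ b' = b + 1) := by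
  constructor
  · rintro ⟨f, hf⟩
    have hirr := hf.of_iso e.symm e'
    obtain ⟨k, hk⟩ := C.sink_almostSplit _ _ hirr.2.1
    rcases hirr.2.2 _ k _ hk with ⟨⟨⟨r, hr⟩⟩⟩ | hsplit
    · have htot : (k ≫ biprod.fst) ≫ (biprod.inl ≫ r) + (k ≫ biprod.snd) ≫ (biprod.inr ≫ r) =
          𝟙 _ := by
        rw [← hr, Category.assoc, Category.assoc, ← Preadditive.comp_add, ← Category.assoc,
          ← Category.assoc biprod.snd, ← Preadditive.add_comp, biprod.total, Category.id_comp]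
      by_cases h1 : (k ≫ biprod.fst) ≫ (biprod.inl ≫ r) = 0
      · by_cases h2 : (k ≫ biprod.snd) ≫ (biprod.inr ≫ r) = 0
        · rw [h1, h2, add_zero] at htot
          exact absurd htot.symm (C.id_ne_zero h)
        · have := C.eq_of_comp_ne_zero h2
          omega
      · have := C.eq_of_comp_ne_zero h1
        omega
    · exact absurd hsplit (C.not_isSplitEpi_sink h')
  · rintro (⟨ha, hb⟩ | ⟨ha, hb⟩)
    · obtain rfl : a = a' - 1 := by omega
      subst hb
      exact ⟨_, (C.isIrreducible_can_left h h').of_iso e e'.symm⟩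
    · obtain rfl : b = b' - 1 := by omega
      subst ha
      exact ⟨_, (C.isIrreducible_can_right h h').of_iso e e'.symm⟩

end ZigzagCoords

end AuslanderReitenQuiver

/-! ### Projectives, injectives and almost split sequences -/

section AlmostSplitSequences

variable {V : Type} [Quiver.{0} V]

theorem QuiverRep.biprod_total_apply {M N : QuiverRep V} (i : V) (z : (M ⊞ N).space i) :
    component (biprod.inl : M ⟶ M ⊞ N) i (component biprod.fst i z) +
      component (biprod.inr : N ⟶ M ⊞ N) i (component biprod.snd i z) = z := by
  have h := congrArg (fun f => component f i z) (biprod.total (X := M) (Y := N))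
  exact h

theorem QuiverRep.biprod_ext {M N : QuiverRep V} {i : V} {z z' : (M ⊞ N).space i}
    (h1 : component (biprod.fst : M ⊞ N ⟶ M) i z = component (biprod.fst : M ⊞ N ⟶ M) i z')
    (h2 : component (biprod.snd : M ⊞ N ⟶ N) i z = component (biprod.snd : M ⊞ N ⟶ N) i z') :
    z = z' := by
  rw [← biprod_total_apply i z, ← biprod_total_apply i z', h1, h2]

theorem QuiverRep.shortExact_of_pointwise {M B N : QuiverRep V} {f : M ⟶ B} {g : B ⟶ N}
    (w : f ≫ g = 0) (inj : ∀ i, Function.Injective (component f i))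
    (exact : ∀ i z, component g i z = 0 → ∃ t, component f i t = z)
    (surj : ∀ i, Function.Surjective (component g i)) : (ShortComplex.mk f g w).ShortExact := by
  have hf := mono_of_injective f inj
  have hg := epi_of_surjective g surj
  have hι : kernel.lift g f w ≫ kernel.ι g = f := kernel.lift_ι _ _ _
  have hj : IsIso (kernel.lift g f w) := by
    apply isIso_of_bijective
    intro i
    constructor
    · intro t t' h
      apply inj i
      rw [← hι, component_comp_apply, component_comp_apply, h]
    · intro t
      obtain ⟨t', ht'⟩ := exact i (component (kernel.ι g) i t) (by
        rw [← component_comp_apply, kernel.condition]; rfl)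
      refine ⟨t', injective_of_mono (kernel.ι g) i ?_⟩
      rw [← component_comp_apply, hι, ht']
  have hinv : inv (kernel.lift g f w) ≫ f = kernel.ι g := by rw [IsIso.inv_comp_eq, hι]
  have hk : IsLimit (KernelFork.ofι f w) := KernelFork.IsLimit.ofι f w
    (fun k hk => kernel.lift g k hk ≫ inv (kernel.lift g f w))
    (fun k hk => by rw [Category.assoc, hinv, kernel.lift_ι])
    (fun k hk m hm => by rw [← cancel_mono f, hm, Category.assoc, hinv, kernel.lift_ι])
  exact { exact := ShortComplex.exact_of_f_is_kernel _ hk, mono_f := hf, epi_g := hg }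

theorem IsProjectiveAt.of_iso {i : V} {M M' : QuiverRep V} (h : IsProjectiveAt i M) (e : M ≅ M') :
    IsProjectiveAt i M' := by
  obtain ⟨v, hv⟩ := h
  refine ⟨QuiverRep.component e.hom i v, fun N w => ?_⟩
  obtain ⟨f, hf, huniq⟩ := hv N w
  refine ⟨e.inv ≫ f, ?_, fun f' hf' => ?_⟩
  · simp only [← QuiverRep.component_comp_apply, e.hom_inv_id_assoc, hf]
  · rw [Iso.eq_inv_comp]
    exact huniq _ hf'

theorem IsProjectiveAt.iso {i : V} {M M' : QuiverRep V} (h : IsProjectiveAt i M)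
    (h' : IsProjectiveAt i M') : Nonempty (M ≅ M') := by
  obtain ⟨v, hv⟩ := h
  obtain ⟨v', hv'⟩ := h'
  obtain ⟨f, hf, -⟩ := hv M' v'
  obtain ⟨g, hg, -⟩ := hv' M v
  refine ⟨⟨f, g, (hv M v).unique ?_ rfl, (hv' M' v').unique ?_ rfl⟩⟩
  · rw [QuiverRep.component_comp_apply, hf, hg]
  · rw [QuiverRep.component_comp_apply, hg, hf]

theorem IsInjectiveAt.of_iso {i : V} {M M' : QuiverRep V} (h : IsInjectiveAt i M) (e : M ≅ M') :
    IsInjectiveAt i M' := by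
  obtain ⟨φ, hφ⟩ := h
  refine ⟨φ ∘ₗ QuiverRep.component e.inv i, fun N ψ => ?_⟩
  obtain ⟨f, hf, huniq⟩ := hφ N ψ
  refine ⟨f ≫ e.hom, ?_, fun f' hf' => ?_⟩
  · simp only [LinearMap.comp_assoc, ← QuiverRep.component_comp, Category.assoc, e.hom_inv_id,
      Category.comp_id, hf]
  · rw [← Iso.comp_inv_eq]
    exact huniq _ hf'

theorem IsInjectiveAt.iso {i : V} {M M' : QuiverRep V} (h : IsInjectiveAt i M)
    (h' : IsInjectiveAt i M') : Nonempty (M ≅ M') := by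
  obtain ⟨v, hv⟩ := h
  obtain ⟨v', hv'⟩ := h'
  obtain ⟨f, hf, -⟩ := hv M' v'
  obtain ⟨g, hg, -⟩ := hv' M v
  refine ⟨⟨g, f, (hv M v).unique ?_ rfl, (hv' M' v').unique ?_ rfl⟩⟩
  · rw [QuiverRep.component_comp, ← LinearMap.comp_assoc, hf, hg]
  · rw [QuiverRep.component_comp, ← LinearMap.comp_assoc, hg, hf]

/-- Lifting the free generator through the epimorphism gives a section. -/
theorem IsProjectiveAt.not_almostSplit {i : V} {S : ShortComplex (QuiverRep V)}
    (h : IsProjectiveAt i S.X₃) : ¬ IsAlmostSplit S := by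
  rintro ⟨hS, -, -, hsplit, -⟩
  obtain ⟨v, hv⟩ := h
  have := hS.epi_g
  obtain ⟨z, hz⟩ := QuiverRep.surjective_of_epi S.g i v
  obtain ⟨s, hs, -⟩ := hv S.X₂ z
  refine hsplit ⟨⟨⟨s, (hv _ v).unique ?_ rfl⟩⟩⟩
  rw [QuiverRep.component_comp_apply, hs, hz]

namespace ZigzagCoords

variable {n : ℕ} (C : ZigzagCoords V n) {a b a' b' : ℤ}

theorem component_can_apply {ha : a ≤ a'} {hb : b ≤ b'} {v : V} (z : (C.thin a b).space v) :
    QuiverRep.component (C.can a b a' b' ha hb) v z = C.coord a b v z • C.gen a' b' v := rfl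

theorem exists_supp_of_hom_ne_zero {f : C.thin a b ⟶ C.thin a' b'} (h : f ≠ 0) :
    a ≤ a' ∧ b ≤ b' ∧ ∃ v, C.supp a b v ∧ C.supp a' b' v := by
  have hle := C.le_of_hom_ne_zero h
  refine ⟨hle.1, hle.2, ?_⟩
  by_contra hv
  exact h (C.hom_eq_zero_of_scalar fun v h1 h2 => absurd ⟨v, h1, h2⟩ hv)

theorem supp_projective (i : V) : C.supp (C.l i + 1) (C.r i + 1) i := by
  have := C.r_eq i
  have := C.idx_lt i
  unfold supp
  omega

theorem supp_injective (i : V) : C.supp (C.r i - 1) (C.l i + n + 2) i := by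
  have := C.r_eq i
  have := C.idx_lt i
  unfold supp
  omega

/-- The arc is that of `i` rotated by one step. Evaluation at the generator is compatible with
direct sums, so it suffices to map into thin representations, where it is bijective because nonzero
morphisms are multiples of canonical ones and live at `i`. -/
theorem isProjectiveAt_thin (i : V) : IsProjectiveAt i (C.thin (C.l i + 1) (C.r i + 1)) := by
  refine ⟨C.gen _ _ i, fun L w => Function.Bijective.existsUnique (f := fun
    f : C.thin (C.l i + 1) (C.r i + 1) ⟶ L => QuiverRep.component f i (C.gen _ _ i)) ?_ w⟩
  clear w
  refine C.thin_induction (P := fun L => Function.Bijective (fun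
    f : C.thin (C.l i + 1) (C.r i + 1) ⟶ L => QuiverRep.component f i (C.gen _ _ i)))
    ?_ ?_ ?_ ?_ L
  · intro M N e h
    constructor
    · intro f f' hff
      rw [← cancel_mono e.inv]
      apply h.1
      simp only [QuiverRep.component_comp_apply] at hff ⊢
      rw [hff]
    · intro w
      obtain ⟨f, hf⟩ := h.2 (QuiverRep.component e.inv i w)
      refine ⟨f ≫ e.hom, ?_⟩
      simp only [QuiverRep.component_comp_apply] at hf ⊢
      rw [hf, ← QuiverRep.component_comp_apply, e.inv_hom_id]
      rfl
  · intro M hM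
    refine ⟨fun f f' _ => hM.eq_of_tgt _ _, fun w => ⟨0, ?_⟩⟩
    exact (QuiverRep.isZero_iff.1 hM i _).trans (QuiverRep.isZero_iff.1 hM i w).symm
  · intro a b _
    have hinj : ∀ f : C.thin (C.l i + 1) (C.r i + 1) ⟶ C.thin a b,
        QuiverRep.component f i (C.gen _ _ i) = 0 → f = 0 := by
      intro f hf
      by_contra h0
      obtain ⟨h1, h2, v, hv, hv'⟩ := C.exists_supp_of_hom_ne_zero h0
      obtain ⟨c, rfl⟩ := C.exists_eq_smul_can h1 h2 f
      rw [QuiverRep.component_smul, LinearMap.smul_apply, C.can_gen (C.supp_projective i)] at hf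
      rcases smul_eq_zero.1 hf with h | h
      · exact h0 (by rw [h, zero_smul])
      -- The vertices that support the projective have arcs whose endpoints are bounded by those of
      -- `i`; so the second arc, crossing one of them, crosses the arc at `i` too.
      · refine C.gen_ne_zero ?_ h
        unfold supp at *
        omega
    constructor
    · intro f f' hff
      rw [← sub_eq_zero]
      apply hinj
      simp only at hff
      rw [sub_eq_add_neg f f', ← neg_one_smul ℂ f', QuiverRep.component_add, QuiverRep.component_smul,
        LinearMap.add_apply, LinearMap.smul_apply, hff, neg_one_smul, add_neg_cancel]
    · intro w
      by_cases hi : C.supp a b i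
      · refine ⟨C.coord a b i w • C.can _ _ a b ?_ ?_, ?_⟩
        · unfold supp at hi; omega
        · unfold supp at hi; omega
        · simp only
          rw [QuiverRep.component_smul, LinearMap.smul_apply, C.can_gen (C.supp_projective i),
            C.coord_smul_gen]
      · refine ⟨0, ?_⟩
        rw [← C.coord_smul_gen w, C.gen_eq_zero hi, smul_zero]
        rfl
  · intro M N hM hN
    constructor
    · intro f f' hff
      simp only at hff
      apply biprod.hom_ext
      · apply hM.1
        simp only [QuiverRep.component_comp_apply]
        rw [hff]
      · apply hN.1
        simp only [QuiverRep.component_comp_apply]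
        rw [hff]
    · intro w
      obtain ⟨f, hf⟩ := hM.2 (QuiverRep.component biprod.fst i w)
      obtain ⟨g, hg⟩ := hN.2 (QuiverRep.component biprod.snd i w)
      simp only at hf hg
      refine ⟨biprod.lift f g, ?_⟩
      apply QuiverRep.biprod_ext
      · rw [← QuiverRep.component_comp_apply, biprod.lift_fst, hf]
      · rw [← QuiverRep.component_comp_apply, biprod.lift_snd, hg]

/-- The dual argument; the arc is the other lift of the diagonal at `i`, $[r_i,l_i+n+3]$, rotated
back by one step. -/
theorem isInjectiveAt_thin (i : V) : IsInjectiveAt i (C.thin (C.r i - 1) (C.l i + n + 2)) := by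
  refine ⟨C.coord _ _ i, fun L w => Function.Bijective.existsUnique (f := fun
    f : L ⟶ C.thin (C.r i - 1) (C.l i + n + 2) => C.coord _ _ i ∘ₗ QuiverRep.component f i) ?_ w⟩
  clear w
  refine C.thin_induction (P := fun L => Function.Bijective (fun
    f : L ⟶ C.thin (C.r i - 1) (C.l i + n + 2) => C.coord _ _ i ∘ₗ QuiverRep.component f i))
    ?_ ?_ ?_ ?_ L
  · intro M N e h
    constructor
    · intro f f' hff
      rw [← cancel_epi e.hom]
      apply h.1
      simp only [QuiverRep.component_comp, ← LinearMap.comp_assoc] at hff ⊢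
      rw [hff]
    · intro w
      obtain ⟨f, hf⟩ := h.2 (w ∘ₗ QuiverRep.component e.hom i)
      refine ⟨e.inv ≫ f, ?_⟩
      simp only [QuiverRep.component_comp, ← LinearMap.comp_assoc] at hf ⊢
      rw [hf, LinearMap.comp_assoc, ← QuiverRep.component_comp, e.inv_hom_id]
      rfl
  · intro M hM
    refine ⟨fun f f' _ => hM.eq_of_src _ _, fun w => ⟨0, ?_⟩⟩
    ext z
    rw [QuiverRep.isZero_iff.1 hM i z, map_zero, map_zero]
  · intro a b _
    have hinj : ∀ f : C.thin a b ⟶ C.thin (C.r i - 1) (C.l i + n + 2),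
        C.coord _ _ i ∘ₗ QuiverRep.component f i = 0 → f = 0 := by
      intro f hf
      by_contra h0
      obtain ⟨h1, h2, v, hv, hv'⟩ := C.exists_supp_of_hom_ne_zero h0
      obtain ⟨c, rfl⟩ := C.exists_eq_smul_can h1 h2 f
      have hi : C.supp a b i := by
        unfold supp at *
        omega
      have := LinearMap.congr_fun hf (C.gen a b i)
      rw [QuiverRep.component_smul, LinearMap.comp_apply, LinearMap.smul_apply, map_smul,
        C.can_gen hi, C.coord_gen (C.supp_injective i), smul_eq_mul, mul_one] at this
      exact h0 (by rw [this, LinearMap.zero_apply, zero_smul])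
    constructor
    · intro f f' hff
      rw [← sub_eq_zero]
      apply hinj
      simp only at hff
      rw [sub_eq_add_neg f f', ← neg_one_smul ℂ f', QuiverRep.component_add, QuiverRep.component_smul,
        LinearMap.comp_add, LinearMap.comp_smul, hff, neg_one_smul, add_neg_cancel]
    · intro w
      by_cases hi : C.supp a b i
      · have ha : a ≤ C.r i - 1 := by unfold supp at hi; omega
        have hb : b ≤ C.l i + n + 2 := by unfold supp at hi; omega
        refine ⟨w (C.gen a b i) • C.can a b _ _ ha hb, C.thin_linearMap_ext fun _ => ?_⟩
        change C.coord _ _ i (w (C.gen a b i) •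
          QuiverRep.component (C.can a b _ _ ha hb) i (C.gen a b i)) = _
        rw [map_smul, C.can_gen hi, C.coord_gen (C.supp_injective i), smul_eq_mul, mul_one]
      · exact ⟨0, C.thin_linearMap_ext fun h => absurd h hi⟩
  · intro M N hM hN
    constructor
    · intro f f' hff
      simp only at hff
      apply biprod.hom_ext'
      · apply hM.1
        simp only [QuiverRep.component_comp, ← LinearMap.comp_assoc]
        rw [hff]
      · apply hN.1
        simp only [QuiverRep.component_comp, ← LinearMap.comp_assoc]
        rw [hff]
    · intro w
      obtain ⟨f, hf⟩ := hM.2 (w ∘ₗ QuiverRep.component biprod.inl i)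
      obtain ⟨g, hg⟩ := hN.2 (w ∘ₗ QuiverRep.component biprod.inr i)
      simp only at hf hg
      refine ⟨biprod.desc f g, ?_⟩
      ext z
      rw [← QuiverRep.biprod_total_apply i z, map_add, map_add]
      congr 1
      · rw [LinearMap.comp_apply, ← QuiverRep.component_comp_apply, biprod.inl_desc]
        exact LinearMap.congr_fun hf _
      · rw [LinearMap.comp_apply, ← QuiverRep.component_comp_apply, biprod.inr_desc]
        exact LinearMap.congr_fun hg _

theorem isProjectiveAt_iff {M : QuiverRep V} (e : M ≅ C.thin a b) (i : V) :
    IsProjectiveAt i M ↔ a = C.l i + 1 ∧ b = C.r i + 1 := by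
  constructor
  · intro h
    obtain ⟨e'⟩ := (C.isProjectiveAt_thin i).iso (h.of_iso e)
    have := C.eq_of_iso ⟨i, C.supp_projective i⟩ e'
    omega
  · rintro ⟨rfl, rfl⟩
    exact (C.isProjectiveAt_thin i).of_iso e.symm

theorem isInjectiveAt_iff {M : QuiverRep V} (e : M ≅ C.thin a b) (i : V) :
    IsInjectiveAt i M ↔ a = C.r i - 1 ∧ b = C.l i + n + 2 := by
  constructor
  · intro h
    obtain ⟨e'⟩ := (C.isInjectiveAt_thin i).iso (h.of_iso e)
    have := C.eq_of_iso ⟨i, C.supp_injective i⟩ e'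
    omega
  · rintro ⟨rfl, rfl⟩
    exact (C.isInjectiveAt_thin i).of_iso e.symm

/-- The minimal left almost split morphism that starts at a thin representation. -/
def source (a b : ℤ) : C.thin (a - 1) (b - 1) ⟶ C.thin (a - 1) b ⊞ C.thin a (b - 1) :=
  biprod.lift (C.can _ _ _ _ (by omega) (by omega)) (-C.can _ _ _ _ (by omega) (by omega))

theorem source_sink : C.source a b ≫ C.sink a b = 0 := by
  rw [source, sink, biprod.lift_desc, Preadditive.neg_comp, C.can_comp, C.can_comp,
    add_neg_cancel]

theorem component_source_fst {v : V} (t : (C.thin (a - 1) (b - 1)).space v) :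
    QuiverRep.component biprod.fst v (QuiverRep.component (C.source a b) v t) =
      C.coord _ _ v t • C.gen (a - 1) b v := by
  rw [← QuiverRep.component_comp_apply, source, biprod.lift_fst, C.component_can_apply]

theorem component_source_snd {v : V} (t : (C.thin (a - 1) (b - 1)).space v) :
    QuiverRep.component biprod.snd v (QuiverRep.component (C.source a b) v t) =
      -(C.coord _ _ v t) • C.gen a (b - 1) v := by
  rw [← QuiverRep.component_comp_apply, source, biprod.lift_snd, ← neg_one_smul ℂ (C.can _ _ _ _ _ _),
    QuiverRep.component_smul, LinearMap.smul_apply, C.component_can_apply, smul_smul, neg_one_mul]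

theorem component_sink {v : V} (z : (C.thin (a - 1) b ⊞ C.thin a (b - 1)).space v) :
    QuiverRep.component (C.sink a b) v z =
      (C.coord _ _ v (QuiverRep.component biprod.fst v z) +
        C.coord _ _ v (QuiverRep.component biprod.snd v z)) • C.gen a b v := by
  conv_lhs => rw [← QuiverRep.biprod_total_apply v z, map_add]
  rw [← QuiverRep.component_comp_apply biprod.inl, ← QuiverRep.component_comp_apply biprod.inr,
    sink, biprod.inl_desc, biprod.inr_desc, C.component_can_apply, C.component_can_apply, add_smul]

/-- At each vertex this compares which of the four arcs cross the initial arc there. Exactness can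
fail in only two ways: the right term alone is supported at `i`, so that it is $P_i$, or the left
term alone, so that it is $I_i$. These are the cases excluded by `hP` and `hI`. -/
theorem shortExact_source_sink (hab : a + 2 ≤ b) (hab' : b ≤ a + n + 1)
    (hP : ∀ i, ¬ (a = C.l i + 1 ∧ b = C.r i + 1)) (hI : ∀ i, ¬ (a = C.r i ∧ b = C.l i + n + 3)) :
    (ShortComplex.mk (C.source a b) (C.sink a b) C.source_sink).ShortExact := by
  apply QuiverRep.shortExact_of_pointwise
  · intro v
    rw [← LinearMap.ker_eq_bot, LinearMap.ker_eq_bot']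
    intro t ht
    have h1 := C.component_source_fst t
    have h2 := C.component_source_snd t
    rw [ht, map_zero] at h1 h2
    by_cases hv : C.supp (a - 1) (b - 1) v
    · apply C.coord_injective
      rw [map_zero]
      by_cases hv1 : C.supp (a - 1) b v
      · exact (smul_eq_zero.1 h1.symm).resolve_right (C.gen_ne_zero hv1)
      · by_cases hv2 : C.supp a (b - 1) v
        · exact neg_eq_zero.1 ((smul_eq_zero.1 h2.symm).resolve_right (C.gen_ne_zero hv2))
        · have := hI v
          unfold supp at *
          omega
    · rw [← C.coord_smul_gen t, C.gen_eq_zero hv, smul_zero]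
  · intro v z hz
    rw [C.component_sink] at hz
    have hP := hP v
    have hI := hI v
    have hz1 := C.coord_smul_gen (QuiverRep.component biprod.fst v z)
    have hz2 := C.coord_smul_gen (QuiverRep.component biprod.snd v z)
    have hs1 : ¬ C.supp (a - 1) b v →
      C.coord _ _ v (QuiverRep.component biprod.fst v z) = 0 := fun h => C.coord_eq_zero h _
    have hs2 : ¬ C.supp a (b - 1) v →
      C.coord _ _ v (QuiverRep.component biprod.snd v z) = 0 := fun h => C.coord_eq_zero h _
    generalize hα : C.coord _ _ v (QuiverRep.component biprod.fst v z) = α at *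
    generalize hβ : C.coord _ _ v (QuiverRep.component biprod.snd v z) = β at *
    have hsum : C.supp a b v → α + β = 0 := fun h =>
      (smul_eq_zero.1 hz).resolve_right (C.gen_ne_zero h)
    -- In coordinates, a kernel element is a pair `α`, `β` with `α + β = 0` wherever the target
    -- lives, and it must be `(t, -t)` on the support of the left term.
    suffices H : ∃ t : ℂ, (C.supp (a - 1) b v → (C.supp (a - 1) (b - 1) v ∧ t = α) ∨
        (¬ C.supp (a - 1) (b - 1) v ∧ α = 0)) ∧
        (C.supp a (b - 1) v → (C.supp (a - 1) (b - 1) v ∧ -t = β) ∨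
        (¬ C.supp (a - 1) (b - 1) v ∧ β = 0)) by
      obtain ⟨t, h1, h2⟩ := H
      refine ⟨t • C.gen _ _ v, QuiverRep.biprod_ext ?_ ?_⟩
      · rw [C.component_source_fst, map_smul, smul_eq_mul, ← hz1]
        by_cases h : C.supp (a - 1) b v
        · rcases h1 h with ⟨h00, rfl⟩ | ⟨h00, rfl⟩
          · rw [C.coord_gen h00, mul_one]
          · rw [C.gen_eq_zero h00, map_zero, mul_zero]
        · rw [C.gen_eq_zero h, smul_zero, smul_zero]
      · rw [C.component_source_snd, map_smul, smul_eq_mul, ← hz2]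
        by_cases h : C.supp a (b - 1) v
        · rcases h2 h with ⟨h00, rfl⟩ | ⟨h00, rfl⟩
          · rw [C.coord_gen h00, mul_one]
          · rw [C.gen_eq_zero h00, map_zero, mul_zero, neg_zero]
        · rw [C.gen_eq_zero h, smul_zero, smul_zero]
    by_cases h01 : C.supp (a - 1) b v
    · by_cases h10 : C.supp a (b - 1) v
      · have h00 : C.supp (a - 1) (b - 1) v := by unfold supp at *; omega
        have h11 : C.supp a b v := by unfold supp at *; omega
        exact ⟨α, fun _ => Or.inl ⟨h00, rfl⟩,
          fun _ => Or.inl ⟨h00, neg_eq_of_add_eq_zero_right (hsum h11)⟩⟩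
      · refine ⟨α, fun _ => ?_, fun h => absurd h h10⟩
        by_cases h00 : C.supp (a - 1) (b - 1) v
        · exact Or.inl ⟨h00, rfl⟩
        · have h11 : C.supp a b v := by unfold supp at *; omega
          have := hsum h11
          rw [hs2 h10, add_zero] at this
          exact Or.inr ⟨h00, this⟩
    · refine ⟨-β, fun h => absurd h h01, fun h10 => ?_⟩
      by_cases h00 : C.supp (a - 1) (b - 1) v
      · exact Or.inl ⟨h00, neg_neg β⟩
      · have h11 : C.supp a b v := by unfold supp at *; omega
        have := hsum h11
        rw [hs1 h01, zero_add] at this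
        exact Or.inr ⟨h00, this⟩
  · intro v t
    have hP := hP v
    by_cases h11 : C.supp a b v
    · by_cases h01 : C.supp (a - 1) b v
      · refine ⟨QuiverRep.component biprod.inl v (C.coord a b v t • C.gen _ _ v), ?_⟩
        rw [← QuiverRep.component_comp_apply, sink, biprod.inl_desc, C.component_can_apply,
          map_smul, C.coord_gen h01, smul_eq_mul, mul_one, C.coord_smul_gen]
      · have h10 : C.supp a (b - 1) v := by unfold supp at *; omega
        refine ⟨QuiverRep.component biprod.inr v (C.coord a b v t • C.gen _ _ v), ?_⟩
        rw [← QuiverRep.component_comp_apply, sink, biprod.inr_desc, C.component_can_apply,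
          map_smul, C.coord_gen h10, smul_eq_mul, mul_one, C.coord_smul_gen]
    · exact ⟨0, by rw [map_zero, ← C.coord_smul_gen t, C.gen_eq_zero h11, smul_zero]⟩

/-- The exclusion of injectives is automatic: $[r_i,l_i+n+3]$ lifts an initial diagonal and
therefore crosses none of them. -/
theorem shortExact_of_supp (h : ∃ v, C.supp a b v)
    (hP : ∀ i, ¬ (a = C.l i + 1 ∧ b = C.r i + 1)) :
    (ShortComplex.mk (C.source a b) (C.sink a b) C.source_sink).ShortExact := by
  obtain ⟨v, hv⟩ := h
  apply C.shortExact_source_sink _ _ hP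
  · intro i hi
    unfold supp at hv
    rcases le_total (C.idx v : ℕ) (C.idx i) with h | h
    · have := C.r_mono h
      omega
    · have := C.l_anti h
      omega
  · unfold supp at hv; omega
  · unfold supp at hv; omega

/-- If the left term were zero, exactness would make the sink map an isomorphism, but it is not a
split epimorphism. -/
theorem exists_supp_translate (h : ∃ v, C.supp a b v)
    (hP : ∀ i, ¬ (a = C.l i + 1 ∧ b = C.r i + 1)) : ∃ v, C.supp (a - 1) (b - 1) v := by
  by_contra h0
  have hS := C.shortExact_of_supp h hP
  have hz : IsZero (C.thin (a - 1) (b - 1)) := C.isZero_thin_iff.2 fun v hv => h0 ⟨v, hv⟩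
  have hmono : Mono (C.sink a b) := hS.exact.mono_g (hz.eq_of_src _ _)
  have hepi : Epi (C.sink a b) := hS.epi_g
  have := isIso_of_mono_of_epi (C.sink a b)
  exact C.not_isSplitEpi_sink h inferInstance

/-- Uniqueness of almost split sequences: each of the two sequences maps to the other over their
common right end. On the left, the composite endomorphism of the thin representation is a nonzero
scalar, so `M` contains that representation as a summand. -/
theorem exists_almostSplit_iff {M N : QuiverRep V} (hM : Indecomposable M) (hN : Indecomposable N)
    (h : ∃ v, C.supp a b v) (e : N ≅ C.thin a b)
    (hP : ∀ i, ¬ (a = C.l i + 1 ∧ b = C.r i + 1)) :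
    (∃ (B : QuiverRep V) (f : M ⟶ B) (g : B ⟶ N) (w : f ≫ g = 0),
      IsAlmostSplit (ShortComplex.mk f g w)) ↔ Nonempty (M ≅ C.thin (a - 1) (b - 1)) := by
  have hS := C.shortExact_of_supp h hP
  have h0 := C.exists_supp_translate h hP
  constructor
  · rintro ⟨B, f, g, w, hex, -, -, hns, has⟩
    simp only at hns has
    obtain ⟨u, hu⟩ := C.sink_almostSplit B (g ≫ e.hom) fun ⟨⟨⟨s, hs⟩⟩⟩ =>
      hns ⟨⟨⟨e.hom ≫ s, by
        have := congrArg (fun t => e.hom ≫ t ≫ e.inv) hs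
        simpa using this⟩⟩⟩
    obtain ⟨u', hu'⟩ := has _ (C.sink a b ≫ e.inv) fun ⟨⟨⟨s, hs⟩⟩⟩ =>
      C.not_isSplitEpi_sink h ⟨⟨⟨e.inv ≫ s, by
        have := congrArg (fun t => e.inv ≫ t ≫ e.hom) hs
        simpa using this⟩⟩⟩
    have := hex.mono_f
    have := hS.mono_f
    obtain ⟨s, hs⟩ : ∃ s, s ≫ f = C.source a b ≫ u' :=
      ⟨hex.exact.lift (C.source a b ≫ u') (by
        simp only [Category.assoc, hu', reassoc_of% C.source_sink, zero_comp]),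
        hex.exact.lift_f _ _⟩
    obtain ⟨t, ht⟩ : ∃ t, t ≫ C.source a b = f ≫ u :=
      ⟨hS.exact.lift (f ≫ u) (by
        simp only [Category.assoc, hu, reassoc_of% w, zero_comp]), hS.exact.lift_f _ _⟩
    obtain ⟨c, hc⟩ := C.thin_endomorphism (s ≫ t)
    have hc0 : c ≠ 0 := by
      rintro rfl
      -- With `c = 0` the middle composite would factor through the cokernel of the source map,
      -- giving a section of the sink map.
      have hz : C.source a b ≫ (u' ≫ u) = 0 := by
        rw [← reassoc_of% hs, ← ht, ← Category.assoc, hc, zero_smul, zero_comp]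
      have hepi := hS.epi_g
      obtain ⟨σ, hσ⟩ : ∃ σ, C.sink a b ≫ σ = u' ≫ u :=
        ⟨hS.exact.desc (u' ≫ u) hz, hS.exact.g_desc _ _⟩
      refine C.not_isSplitEpi_sink h ⟨⟨⟨σ, ?_⟩⟩⟩
      have : Epi (C.sink a b) := hepi
      rw [← cancel_epi (C.sink a b), reassoc_of% hσ, hu, reassoc_of% hu', e.inv_hom_id,
        Category.comp_id]
    refine QuiverRep.iso_of_indecomposable hM (C.not_isZero_thin h0) s (c⁻¹ • t) ?_
    rw [Linear.comp_smul, hc, smul_smul, inv_mul_cancel₀ hc0, one_smul]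
  · rintro ⟨e'⟩
    have w : (e'.hom ≫ C.source a b) ≫ (C.sink a b ≫ e.inv) = 0 := by
      rw [Category.assoc, reassoc_of% C.source_sink, zero_comp, comp_zero]
    refine ⟨_, e'.hom ≫ C.source a b, C.sink a b ≫ e.inv, w, ?_, hM, hN, ?_, ?_⟩
    · exact ShortComplex.shortExact_of_iso
        (S₁ := ShortComplex.mk (C.source a b) (C.sink a b) C.source_sink)
        (S₂ := ShortComplex.mk _ _ w) (ShortComplex.isoMk e'.symm (Iso.refl _) e.symm
        (by simp) (by simp)) hS
    · rintro ⟨⟨⟨s, hs⟩⟩⟩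
      refine C.not_isSplitEpi_sink h ⟨⟨⟨e.inv ≫ s, ?_⟩⟩⟩
      have := congrArg (fun t => e.inv ≫ t ≫ e.hom) hs
      simpa using this
    · intro L k hk
      obtain ⟨k', hk'⟩ := C.sink_almostSplit L (k ≫ e.hom) fun ⟨⟨⟨s, hs⟩⟩⟩ =>
        hk ⟨⟨⟨e.hom ≫ s, by
          have := congrArg (fun t => e.hom ≫ t ≫ e.inv) hs
          simpa using this⟩⟩⟩
      exact ⟨k', by
        simp only
        rw [reassoc_of% hk', e.hom_inv_id, Category.comp_id]⟩

end ZigzagCoords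

end AlmostSplitSequences

/-! ### Diagonals, their lifts, and the positions of cluster objects -/

section StripPositions

/-- Two arcs `[a, b]` and `[a', b']` of the universal cover of the `(n+3)`-gon are lifts of the same
diagonal. -/
def SameDiagonal (n : ℕ) (a b a' b' : ℤ) : Prop :=
  ((n : ℤ) + 3 ∣ a' - a ∧ b' - a' = b - a) ∨ ((n : ℤ) + 3 ∣ a' - b ∧ b' - a' = n + 3 - (b - a))

namespace SameDiagonal

variable {n : ℕ} {a b a' b' a'' b'' : ℤ}

theorem refl (n : ℕ) (a b : ℤ) : SameDiagonal n a b a b := Or.inl ⟨by simp, rfl⟩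

theorem symm (h : SameDiagonal n a b a' b') : SameDiagonal n a' b' a b := by
  rcases h with ⟨⟨t, ht⟩, h⟩ | ⟨⟨t, ht⟩, h⟩
  · exact Or.inl ⟨⟨-t, by linarith⟩, h.symm⟩
  · exact Or.inr ⟨⟨-t - 1, by linarith⟩, by linarith⟩

theorem trans (h : SameDiagonal n a b a' b') (h' : SameDiagonal n a' b' a'' b'') :
    SameDiagonal n a b a'' b'' := by
  rcases h with ⟨⟨t, ht⟩, h⟩ | ⟨⟨t, ht⟩, h⟩ <;> rcases h' with ⟨⟨s, hs⟩, h'⟩ | ⟨⟨s, hs⟩, h'⟩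
  · exact Or.inl ⟨⟨t + s, by linarith⟩, by linarith⟩
  · exact Or.inr ⟨⟨t + s, by linarith⟩, by linarith⟩
  · exact Or.inr ⟨⟨t + s, by linarith⟩, by linarith⟩
  · exact Or.inl ⟨⟨t + s + 1, by linarith⟩, by linarith⟩

theorem flip (n : ℕ) (a b : ℤ) : SameDiagonal n a b b (a + n + 3) :=
  Or.inr ⟨by simp, by ring⟩

theorem shift (h : SameDiagonal n a b a' b') (t : ℤ) :
    SameDiagonal n (a + t) (b + t) (a' + t) (b' + t) := by
  rcases h with ⟨h1, h2⟩ | ⟨h1, h2⟩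
  · exact Or.inl ⟨by convert h1 using 1; ring, by linarith⟩
  · exact Or.inr ⟨by convert h1 using 1; ring, by linarith⟩

/-- The point $(r,k)$ stands for the arc $[k-1,k+r]$; the glide reflection passes to the other lift
of the same diagonal. -/
theorem glideEquiv_iff {r s : ℕ} {k l : ℤ} :
    GlideEquiv n r k s l ↔ SameDiagonal n (k - 1) (k + r) (l - 1) (l + s) := by
  unfold GlideEquiv SameDiagonal
  refine or_congr (and_comm.trans (and_congr ?_ ?_)) (and_comm.trans (and_congr ?_ ?_))
  · rw [sub_sub_sub_cancel_right]
  · omega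
  · rw [show l - 1 - (k + r) = l - (k + r + 1) by ring]
  · omega

end SameDiagonal

theorem Int.eq_zero_of_dvd_of_lt {N d : ℤ} (h : N ∣ d) (h1 : -N < d) (h2 : d < N) : d = 0 :=
  Int.eq_zero_of_abs_lt_dvd h (abs_lt.2 ⟨h1, h2⟩)

namespace ZigzagCoords

variable {V : Type} [Quiver.{0} V] {n : ℕ} (C : ZigzagCoords V n) {a b a' b' : ℤ}

theorem l_lt_r (u v : V) : C.l u < C.r v := by
  have := C.r_eq u
  have := C.r_eq v
  rcases le_total (C.idx u : ℕ) (C.idx v) with h | h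
  · have := C.r_mono h
    omega
  · have := C.l_anti h
    omega

theorem exists_mirror (i : V) : ∃ j, (C.idx i : ℕ) + C.idx j + 1 = n := by
  have := C.idx_lt i
  obtain ⟨j, hj⟩ := C.exists_idx (i := n - 1 - C.idx i) (by omega)
  exact ⟨j, by omega⟩

theorem exists_gap (h1 : a + 2 ≤ b) (h2 : b ≤ a + n + 1) :
    ∃ i j : V, (C.idx i : ℕ) + C.idx j + 1 = n ∧ b = a + (C.idx i : ℕ) + 2 := by
  obtain ⟨i, hi⟩ := C.exists_idx (i := (b - a - 2).toNat) (by omega)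
  obtain ⟨j, hj⟩ := C.exists_mirror i
  exact ⟨i, j, hj, by omega⟩

/-- The arcs that cross some diagonal are the ones between the two slices of the initial
triangulation. -/
theorem exists_supp_iff_bounds {i j : V} (hij : (C.idx i : ℕ) + C.idx j + 1 = n)
    (hb : b = a + (C.idx i : ℕ) + 2) : (∃ v, C.supp a b v) ↔ C.l i < a ∧ a < C.r j := by
  have hri := C.r_eq i
  have hrj := C.r_eq j
  constructor
  · rintro ⟨v, hv⟩
    unfold supp at hv
    constructor
    · rcases le_total (C.idx v : ℕ) (C.idx i) with h | h
      · have := C.l_anti h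
        omega
      · have := C.r_mono h
        omega
    · rcases le_total (C.idx v : ℕ) (C.idx j) with h | h
      · have := C.r_mono h
        omega
      · have := C.l_anti h
        omega
  · rintro ⟨h1, h2⟩
    classical
    rcases le_total (C.idx i : ℕ) (C.idx j) with h | h
    -- Climbing from `i`, take the first arc whose right end lies beyond `a`. Right ends grow by at
    -- most one, so this end has not reached `b`; the bound at `j` gives the remaining inequality.
    · have hex : ∃ k : ℕ, ∃ v, (C.idx v : ℕ) = k ∧ (C.idx i : ℕ) ≤ k ∧ a < C.r v :=
        ⟨_, j, rfl, h, h2⟩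
      obtain ⟨v, hvk, hik, hav⟩ := Nat.find_spec hex
      have hvj : (C.idx v : ℕ) ≤ C.idx j := by
        rw [hvk]
        exact Nat.find_min' hex ⟨j, rfl, h, h2⟩
      have hrv : C.r v < b := by
        rcases hik.eq_or_lt with heq | hlt
        · obtain rfl := C.idx_inj (v := v) (w := i) (by omega)
          omega
        · obtain ⟨u, hu⟩ := C.exists_idx (i := C.idx v - 1) (by have := C.idx_lt v; omega)
          have hu' : ¬ a < C.r u := fun h' =>
            Nat.find_min hex (m := C.idx u) (by omega) ⟨u, rfl, by omega, h'⟩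
          have := C.edge (v := u) (w := v) (by omega)
          omega
      have := C.l_anti (v := i) (w := v) (by omega)
      have := C.l_anti hvj
      exact ⟨v, by unfold supp; omega⟩
    -- Dually, climb from `j` to the first arc whose left end lies before `a`.
    · have hex : ∃ k : ℕ, ∃ v, (C.idx v : ℕ) = k ∧ (C.idx j : ℕ) ≤ k ∧ C.l v < a :=
        ⟨_, i, rfl, h, h1⟩
      obtain ⟨v, hvk, hjk, hav⟩ := Nat.find_spec hex
      have hvi : (C.idx v : ℕ) ≤ C.idx i := by
        rw [hvk]
        exact Nat.find_min' hex ⟨i, rfl, h, h1⟩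
      have hlv : b < C.l v + n + 3 := by
        rcases hjk.eq_or_lt with heq | hlt
        · obtain rfl := C.idx_inj (v := v) (w := j) (by omega)
          omega
        · obtain ⟨u, hu⟩ := C.exists_idx (i := C.idx v - 1) (by have := C.idx_lt v; omega)
          have hu' : ¬ C.l u < a := fun h' =>
            Nat.find_min hex (m := C.idx u) (by omega) ⟨u, rfl, by omega, h'⟩
          have := C.edge (v := u) (w := v) (by omega)
          have := C.idx_lt i
          omega
      have := C.r_mono (v := j) (w := v) (by omega)
      have := C.r_mono hvi
      exact ⟨v, by unfold supp; omega⟩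

theorem gap_of_supp (h : ∃ v, C.supp a b v) : a + 2 ≤ b ∧ b ≤ a + n + 1 := by
  obtain ⟨v, hv⟩ := h
  unfold supp at hv
  omega

/-- The arc from `a` to `b` lies weakly between the two slices of the initial triangulation. -/
def Between (a b : ℤ) : Prop :=
  ∃ i j, (C.idx i : ℕ) + C.idx j + 1 = n ∧ b = a + (C.idx i : ℕ) + 2 ∧ C.l i ≤ a ∧ a ≤ C.r j

theorem between_of_supp (h : ∃ v, C.supp a b v) : C.Between a b := by
  have := C.gap_of_supp h
  obtain ⟨i, j, hij, hb⟩ := C.exists_gap this.1 this.2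
  have := (C.exists_supp_iff_bounds hij hb).1 h
  exact ⟨i, j, hij, hb, by omega, by omega⟩

/-- The region between the slices is a fundamental domain for the lifts: for arcs of a given length
it is narrower than `n + 3`, and it excludes flipped lifts. -/
theorem eq_of_sameDiagonal (h : C.Between a b) (h' : ∃ v, C.supp a' b' v)
    (hs : SameDiagonal n a b a' b') : a = a' ∧ b = b' := by
  obtain ⟨i, j, hij, hb, h1, h2⟩ := h
  have hg := C.gap_of_supp h'
  obtain ⟨i', j', hij', hb'⟩ := C.exists_gap hg.1 hg.2
  have h3 := (C.exists_supp_iff_bounds hij' hb').1 h'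
  have hri := C.r_eq i
  have hrj := C.r_eq j
  rcases hs with ⟨hd, hs⟩ | ⟨hd, hs⟩
  · obtain rfl := C.idx_inj (v := i) (w := i') (by omega)
    obtain rfl := C.idx_inj (v := j) (w := j') (by omega)
    have hsmall : C.r j - C.l i < n + 3 := by
      rcases le_total (C.idx i : ℕ) (C.idx j) with h | h
      · have := C.l_anti h
        omega
      · have := C.r_mono h
        omega
    have := Int.eq_zero_of_dvd_of_lt hd (by omega) (by omega)
    omega
  · obtain rfl := C.idx_inj (v := i') (w := j) (by omega)
    obtain rfl := C.idx_inj (v := j') (w := i) (by omega)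
    have := Int.eq_zero_of_dvd_of_lt hd (by omega) (by omega)
    omega

/-- In the closed region an initial diagonal has two lifts, one on each bounding slice. -/
theorem eq_of_sameDiagonal_arc (h : C.Between a b) {t : V}
    (hs : SameDiagonal n a b (C.l t) (C.r t)) :
    (a = C.l t ∧ b = C.r t) ∨ (a = C.r t ∧ b = C.l t + n + 3) := by
  obtain ⟨i, j, hij, hb, h1, h2⟩ := h
  have hri := C.r_eq i
  have hrj := C.r_eq j
  have hrt := C.r_eq t
  rcases hs with ⟨hd, hs⟩ | ⟨hd, hs⟩
  · obtain rfl := C.idx_inj (v := i) (w := t) (by omega)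
    have hsmall : C.r j - C.l i < n + 3 := by
      rcases le_total (C.idx i : ℕ) (C.idx j) with h | h
      · have := C.l_anti h
        omega
      · have := C.r_mono h
        omega
    have := Int.eq_zero_of_dvd_of_lt hd (by omega) (by omega)
    omega
  · obtain rfl := C.idx_inj (v := t) (w := j) (by omega)
    have hd' : (n : ℤ) + 3 ∣ C.l t - b + (n + 3) := hd.add (dvd_refl _)
    have := C.l_lt_r t i
    have := Int.eq_zero_of_dvd_of_lt hd' (by omega) (by omega)
    omega

theorem between_arc (t : V) : C.Between (C.l t) (C.r t) := by
  obtain ⟨j, hj⟩ := C.exists_mirror t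
  have := C.l_lt_r t j
  exact ⟨t, j, hj, C.r_eq t, le_rfl, by omega⟩

/-- The initial arcs are nested, so initial diagonals do not cross each other; no representation
shares its position with a shifted projective. -/
theorem not_sameDiagonal_arc (h : ∃ v, C.supp a b v) {t : V} :
    ¬ SameDiagonal n a b (C.l t) (C.r t) := fun hs => by
  have h1 := C.eq_of_sameDiagonal (C.between_arc t) h hs.symm
  obtain ⟨v, hv⟩ := h
  unfold supp at hv
  rcases le_total (C.idx v : ℕ) (C.idx t) with h | h
  · have := C.l_anti h
    omega
  · have := C.r_mono h
    omega

theorem arc_injective {t u : V} (hs : SameDiagonal n (C.l t) (C.r t) (C.l u) (C.r u)) : t = u := by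
  have h := C.eq_of_sameDiagonal_arc (C.between_arc t) hs
  have := C.l_lt_r t u
  have := C.r_eq t
  have := C.r_eq u
  exact C.idx_inj (by omega)

/-- An indecomposable object of the cluster category lies at the arc from `a` to `b`. -/
def At (X : ClusterObject V) (a b : ℤ) : Prop :=
  match X with
  | .rep M _ => ∃ a' b', (∃ v, C.supp a' b' v) ∧ Nonempty (M ≅ C.thin a' b') ∧
      SameDiagonal n a b a' b'
  | .shiftedProjective i => SameDiagonal n a b (C.l i) (C.r i)

theorem At.of_sameDiagonal {C : ZigzagCoords V n} {X : ClusterObject V} (h : C.At X a b)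
    (hs : SameDiagonal n a b a' b') : C.At X a' b' := by
  cases X with
  | rep M hM =>
    obtain ⟨p, q, hpq, e, hs'⟩ := h
    exact ⟨p, q, hpq, e, hs.symm.trans hs'⟩
  | shiftedProjective i => exact hs.symm.trans h

theorem at_rep_iff {M : QuiverRep V} {hM : Indecomposable M} (h : ∃ v, C.supp a' b' v)
    (e : M ≅ C.thin a' b') : C.At (.rep M hM) a b ↔ SameDiagonal n a b a' b' := by
  constructor
  · rintro ⟨p, q, hpq, ⟨e'⟩, hs⟩
    obtain ⟨rfl, rfl⟩ := C.eq_of_iso h (e.symm ≪≫ e')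
    exact hs
  · exact fun hs => ⟨_, _, h, ⟨e⟩, hs⟩

theorem At.unique {C : ZigzagCoords V n} {X : ClusterObject V} (h : C.At X a b)
    (h' : C.At X a' b') : SameDiagonal n a b a' b' := by
  cases X with
  | rep M hM =>
    obtain ⟨p, q, hpq, ⟨e⟩, hs⟩ := h
    exact hs.trans ((C.at_rep_iff hpq e).1 h').symm
  | shiftedProjective i => exact SameDiagonal.trans h (SameDiagonal.symm h')

theorem At.iso_iff {C : ZigzagCoords V n} {X Y : ClusterObject V} (h : C.At X a b) :
    X.Iso Y ↔ C.At Y a b := by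
  cases X with
  | rep M hM =>
    obtain ⟨p, q, hpq, ⟨e⟩, hs⟩ := h
    cases Y with
    | rep N hN =>
      constructor
      · rintro ⟨e'⟩
        exact ⟨p, q, hpq, ⟨e'.symm ≪≫ e⟩, hs⟩
      · rintro ⟨p', q', hpq', ⟨e'⟩, hs'⟩
        obtain ⟨rfl, rfl⟩ := C.eq_of_sameDiagonal (C.between_of_supp hpq) hpq' (hs.symm.trans hs')
        exact ⟨e ≪≫ e'.symm⟩
    | shiftedProjective j =>
      exact ⟨False.elim, fun h' => C.not_sameDiagonal_arc hpq (hs.symm.trans h')⟩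
  | shiftedProjective i =>
    cases Y with
    | rep N hN =>
      refine ⟨False.elim, ?_⟩
      rintro ⟨p', q', hpq', -, hs'⟩
      exact C.not_sameDiagonal_arc hpq' (hs'.symm.trans h)
    | shiftedProjective j =>
      constructor
      · rintro rfl
        exact h
      · exact fun h' => C.arc_injective (SameDiagonal.trans (SameDiagonal.symm h) h')

theorem exists_at_position (X : ClusterObject V) :
    ∃ a b : ℤ, a + 2 ≤ b ∧ b ≤ a + n + 1 ∧ C.At X a b := by
  cases X with
  | rep M hM =>
    obtain ⟨a, b, h, e⟩ := C.exists_iso_thin hM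
    have := C.gap_of_supp h
    exact ⟨a, b, this.1, this.2, a, b, h, e, .refl _ _ _⟩
  | shiftedProjective i =>
    have := C.r_eq i
    have := C.idx_lt i
    exact ⟨C.l i, C.r i, by omega, by omega, .refl _ _ _⟩

theorem exists_at_of_bounds {i j : V} (hij : (C.idx i : ℕ) + C.idx j + 1 = n)
    (hb : b = a + (C.idx i : ℕ) + 2) (h1 : C.l i ≤ a) (h2 : a < C.r j) : ∃ X, C.At X a b := by
  rcases h1.eq_or_lt with rfl | h1
  · refine ⟨.shiftedProjective i, ?_⟩
    rw [hb, ← C.r_eq i]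
    exact SameDiagonal.refl _ _ _
  · have h := (C.exists_supp_iff_bounds hij hb).2 ⟨h1, h2⟩
    exact ⟨.rep _ (C.indecomposable_thin h), a, b, h, ⟨Iso.refl _⟩, .refl _ _ _⟩

theorem exists_at (h1 : a + 2 ≤ b) (h2 : b ≤ a + n + 1) : ∃ X, C.At X a b := by
  obtain ⟨i, j, hij, hb⟩ := C.exists_gap h1 h2
  have hri := C.r_eq i
  have hrj := C.r_eq j
  obtain ⟨a₀, hd, hlo, hhi⟩ : ∃ a₀, (n : ℤ) + 3 ∣ a₀ - a ∧ C.l i ≤ a₀ ∧ a₀ < C.l i + (n + 3) := by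
    refine ⟨C.l i + (a - C.l i) % (n + 3), ?_, ?_, ?_⟩
    · refine ⟨-((a - C.l i) / (n + 3)), ?_⟩
      have := Int.emod_add_mul_ediv (a - C.l i) (n + 3)
      linarith
    · have := Int.emod_nonneg (a - C.l i) (b := n + 3) (by omega)
      omega
    · have := Int.emod_lt_of_pos (a - C.l i) (b := n + 3) (by omega)
      omega
  have hs : SameDiagonal n a b a₀ (a₀ + (C.idx i : ℕ) + 2) := Or.inl ⟨hd, by omega⟩
  by_cases hj : a₀ < C.r j
  · obtain ⟨X, hX⟩ := C.exists_at_of_bounds hij rfl hlo hj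
    exact ⟨X, hX.of_sameDiagonal hs.symm⟩
  -- An arc on or beyond the right slice is replaced by its flip, moved back by one period; this
  -- lies between the slices, with `i` and `j` exchanged.
  · obtain ⟨X, hX⟩ := C.exists_at_of_bounds (i := j) (j := i) (a := a₀ + (C.idx i : ℕ) + 2 - (n + 3))
      (b := a₀) (by omega) (by omega) (by omega) (by omega)
    have hf := SameDiagonal.flip n (a₀ + (C.idx i : ℕ) + 2 - (n + 3)) a₀
    refine ⟨X, (hX.of_sameDiagonal hf).of_sameDiagonal ?_⟩
    convert hs.symm using 1
    ring

end ZigzagCoords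

end StripPositions

/-! ### The Auslander–Reiten quiver of the cluster category in the strip -/

section StripDisplay

namespace ZigzagCoords

variable {V : Type} [Quiver.{0} V] {n : ℕ} (C : ZigzagCoords V n) {a b a' b' : ℤ}

theorem between_right (h1 : b - a ≤ n) {i j : V} (hij : (C.idx i : ℕ) + C.idx j + 1 = n)
    (hb : b = a + (C.idx i : ℕ) + 2) (hl : C.l i ≤ a) (hr : a < C.r j) : C.Between a (b + 1) := by
  obtain ⟨i', hi'⟩ := C.exists_idx (i := C.idx i + 1) (by omega)
  obtain ⟨j', hj'⟩ := C.exists_mirror i'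
  have := C.edge (v := i) (w := i') (by omega)
  have := C.edge (v := j') (w := j) (by omega)
  exact ⟨i', j', hj', by omega, by omega, by omega⟩

theorem between_left (h1 : a + 3 ≤ b) {i j : V} (hij : (C.idx i : ℕ) + C.idx j + 1 = n)
    (hb : b = a + (C.idx i : ℕ) + 2) (hl : C.l i ≤ a) (hr : a < C.r j) : C.Between (a + 1) b := by
  obtain ⟨i', hi'⟩ := C.exists_idx (i := C.idx i - 1) (by have := C.idx_lt i; omega)
  obtain ⟨j', hj'⟩ := C.exists_mirror i'
  have := C.edge (v := i') (w := i) (by omega)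
  have := C.edge (v := j) (w := j') (by omega)
  exact ⟨i', j', hj', by omega, by omega, by omega⟩

/-- An object lies at one of the right neighbours of the arc from `a` to `b`. -/
def AtSuccessor (Y : ClusterObject V) (a b : ℤ) : Prop :=
  (b - a ≤ n ∧ C.At Y a (b + 1)) ∨ (a + 3 ≤ b ∧ C.At Y (a + 1) b)

/-- Passing to the other lift exchanges the ends of an arc, and with them the upper and the lower
neighbour. -/
theorem AtSuccessor.of_sameDiagonal {C : ZigzagCoords V n} {Y : ClusterObject V}
    (h : C.AtSuccessor Y a b) (hs : SameDiagonal n a b a' b') : C.AtSuccessor Y a' b' := by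
  rcases h with ⟨h1, h⟩ | ⟨h1, h⟩ <;> rcases hs with ⟨hd, hs⟩ | ⟨hd, hs⟩
  · exact Or.inl ⟨by omega, h.of_sameDiagonal (Or.inl ⟨hd, by omega⟩)⟩
  · refine Or.inr ⟨by omega, h.of_sameDiagonal (Or.inr ⟨?_, by omega⟩)⟩
    rwa [add_sub_add_right_eq_sub]
  · refine Or.inr ⟨by omega, h.of_sameDiagonal (Or.inl ⟨?_, by omega⟩)⟩
    rwa [add_sub_add_right_eq_sub]
  · exact Or.inl ⟨by omega, h.of_sameDiagonal (Or.inr ⟨hd, by omega⟩)⟩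

theorem hasArrow_rep_rep {M N : QuiverRep V} {hM : Indecomposable M} {hN : Indecomposable N}
    (h : ∃ v, C.supp a b v) (e : M ≅ C.thin a b) :
    (ClusterObject.rep M hM).HasArrow (.rep N hN) ↔ C.AtSuccessor (.rep N hN) a b := by
  obtain ⟨a', b', h', ⟨e'⟩⟩ := C.exists_iso_thin hN
  change (∃ f : M ⟶ N, IsIrreducibleMorphism f) ↔ _
  rw [C.exists_irreducible_iff h h' e e']
  unfold AtSuccessor
  rw [C.at_rep_iff h' e', C.at_rep_iff h' e']
  have hg := C.gap_of_supp h
  have hg' := C.gap_of_supp h'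
  obtain ⟨i, j, hij, hb⟩ := C.exists_gap hg.1 hg.2
  have hbd := (C.exists_supp_iff_bounds hij hb).1 h
  constructor
  · rintro (⟨rfl, rfl⟩ | ⟨rfl, rfl⟩)
    · exact Or.inr ⟨by omega, .refl _ _ _⟩
    · exact Or.inl ⟨by omega, .refl _ _ _⟩
  · rintro (⟨h1, hs⟩ | ⟨h1, hs⟩)
    · have := C.eq_of_sameDiagonal (C.between_right h1 hij hb hbd.1.le hbd.2) h' hs
      omega
    · have := C.eq_of_sameDiagonal (C.between_left h1 hij hb hbd.1.le hbd.2) h' hs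
      omega

/-- A neighbour that lifts an initial diagonal must lie on the right slice, as $[r_t,l_t+n+3]$.
Moving one of its ends back gives the arc of $I_k$ for a neighbour `k` of `t`, and the crossing
forces the edge to point from `k` to `t`. -/
theorem hasArrow_rep_shift {M : QuiverRep V} {hM : Indecomposable M} {t : V}
    (h : ∃ v, C.supp a b v) (e : M ≅ C.thin a b) :
    (ClusterObject.rep M hM).HasArrow (.shiftedProjective t) ↔
      C.AtSuccessor (.shiftedProjective t) a b := by
  change (∃ k, Nonempty (k ⟶ t) ∧ IsInjectiveAt k M) ↔
    (b - a ≤ n ∧ SameDiagonal n a (b + 1) (C.l t) (C.r t)) ∨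
      (a + 3 ≤ b ∧ SameDiagonal n (a + 1) b (C.l t) (C.r t))
  simp only [C.isInjectiveAt_iff e]
  have hg := C.gap_of_supp h
  obtain ⟨i, j, hij, hb⟩ := C.exists_gap hg.1 hg.2
  have hbd := (C.exists_supp_iff_bounds hij hb).1 h
  have hrt := C.r_eq t
  have htn := C.idx_lt t
  constructor
  · rintro ⟨k, ⟨f⟩, rfl, rfl⟩
    have hle := C.arrow_le f
    have hrk := C.r_eq k
    have hf := (SameDiagonal.flip n (C.l t) (C.r t)).symm
    rcases C.arrow_adj f with hadj | hadj
    · have := C.edge hadj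
      refine Or.inr ⟨by omega, ?_⟩
      convert hf using 1 <;> omega
    · have := C.edge hadj
      refine Or.inl ⟨by omega, ?_⟩
      convert hf using 1 <;> omega
  · obtain ⟨v, hv⟩ := h
    unfold supp at hv
    have hrv := C.r_eq v
    have hvn := C.idx_lt v
    rintro (⟨h1, hs⟩ | ⟨h1, hs⟩)
    · have heq := C.eq_of_sameDiagonal_arc (C.between_right h1 hij hb hbd.1.le hbd.2) hs
      rcases le_total (C.idx v : ℕ) (C.idx t) with hvt | hvt
      · have := C.r_mono hvt
        have := C.l_anti hvt
        have := C.l_lt_r t j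
        have := C.l_lt_r v t
        omega
      · have := C.r_mono hvt
        have := C.l_anti hvt
        obtain ⟨k, hk⟩ := C.exists_idx (i := C.idx t + 1) (by omega)
        have := C.l_anti (v := k) (w := v) (by omega)
        rcases C.edge (v := t) (w := k) (by omega) with ⟨h2, h3, g⟩ | ⟨h2, h3, g⟩
        · exact ⟨k, g, by omega, by omega⟩
        · omega
    · have heq := C.eq_of_sameDiagonal_arc (C.between_left h1 hij hb hbd.1.le hbd.2) hs
      rcases le_total (C.idx v : ℕ) (C.idx t) with hvt | hvt
      · have := C.r_mono hvt
        have := C.l_anti hvt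
        have := C.l_lt_r v t
        obtain ⟨k, hk⟩ := C.exists_idx (i := C.idx t - 1) (by omega)
        have := C.r_mono (v := v) (w := k) (by omega)
        rcases C.edge (v := k) (w := t) (by omega) with ⟨h2, h3, g⟩ | ⟨h2, h3, g⟩
        · omega
        · exact ⟨k, g, by omega, by omega⟩
      · have := C.r_mono hvt
        have := C.l_anti hvt
        omega

/-- The same at the left slice: moving one end of the arc of `t` forward gives a crossing arc
exactly when it is the arc of $P_k$ for an arrow from `t` to `k`. -/
theorem hasArrow_shift_rep {N : QuiverRep V} {hN : Indecomposable N} (t : V) :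
    (ClusterObject.shiftedProjective t).HasArrow (.rep N hN) ↔
      C.AtSuccessor (.rep N hN) (C.l t) (C.r t) := by
  obtain ⟨a', b', h', ⟨e'⟩⟩ := C.exists_iso_thin hN
  change (∃ j, Nonempty (t ⟶ j) ∧ IsProjectiveAt j N) ↔ _
  simp only [C.isProjectiveAt_iff e']
  unfold AtSuccessor
  rw [C.at_rep_iff h' e', C.at_rep_iff h' e']
  have hrt := C.r_eq t
  have htn := C.idx_lt t
  obtain ⟨j, hj⟩ := C.exists_mirror t
  constructor
  · rintro ⟨k, ⟨f⟩, rfl, rfl⟩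
    have hle := C.arrow_le f
    have hrk := C.r_eq k
    have := C.idx_lt k
    rcases C.arrow_adj f with hadj | hadj
    · have := C.edge hadj
      refine Or.inl ⟨by omega, ?_⟩
      convert SameDiagonal.refl n (C.l t) (C.r t + 1) using 1 <;> omega
    · have := C.edge hadj
      refine Or.inr ⟨by omega, ?_⟩
      convert SameDiagonal.refl n (C.l t + 1) (C.r t) using 1 <;> omega
  · rintro (⟨h1, hs⟩ | ⟨h1, hs⟩)
    · have heq := C.eq_of_sameDiagonal (C.between_right h1 hj hrt le_rfl (C.l_lt_r t j)) h' hs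
      obtain ⟨v, hv⟩ := h'
      unfold supp at hv
      rcases le_total (C.idx v : ℕ) (C.idx t) with hvt | hvt
      · have := C.l_anti hvt
        omega
      · have := C.r_mono hvt
        have : (C.idx v : ℕ) ≠ C.idx t := fun h => by
          obtain rfl := C.idx_inj h
          omega
        obtain ⟨k, hk⟩ := C.exists_idx (i := C.idx t + 1) (by have := C.idx_lt v; omega)
        have := C.r_mono (v := k) (w := v) (by omega)
        rcases C.edge (v := t) (w := k) (by omega) with ⟨h2, h3, g⟩ | ⟨h2, h3, g⟩
        · omega
        · exact ⟨k, g, by omega, by omega⟩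
    · have heq := C.eq_of_sameDiagonal (C.between_left (by omega) hj hrt le_rfl (C.l_lt_r t j)) h' hs
      obtain ⟨v, hv⟩ := h'
      unfold supp at hv
      rcases le_total (C.idx v : ℕ) (C.idx t) with hvt | hvt
      · have := C.l_anti hvt
        have : (C.idx v : ℕ) ≠ C.idx t := fun h => by
          obtain rfl := C.idx_inj h
          omega
        obtain ⟨k, hk⟩ := C.exists_idx (i := C.idx t - 1) (by omega)
        have := C.l_anti (v := v) (w := k) (by omega)
        rcases C.edge (v := k) (w := t) (by omega) with ⟨h2, h3, g⟩ | ⟨h2, h3, g⟩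
        · exact ⟨k, g, by omega, by omega⟩
        · omega
      · have := C.r_mono hvt
        omega

theorem hasArrow_shift_shift (t u : V) :
    (ClusterObject.shiftedProjective t).HasArrow (.shiftedProjective u) ↔
      C.AtSuccessor (.shiftedProjective u) (C.l t) (C.r t) := by
  change Nonempty (u ⟶ t) ↔
    (C.r t - C.l t ≤ n ∧ SameDiagonal n (C.l t) (C.r t + 1) (C.l u) (C.r u)) ∨
      (C.l t + 3 ≤ C.r t ∧ SameDiagonal n (C.l t + 1) (C.r t) (C.l u) (C.r u))
  have hrt := C.r_eq t
  have htn := C.idx_lt t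
  have hru := C.r_eq u
  have hun := C.idx_lt u
  have := C.l_lt_r t u
  obtain ⟨j, hj⟩ := C.exists_mirror t
  constructor
  · rintro ⟨f⟩
    have hle := C.arrow_le f
    rcases C.arrow_adj f with hadj | hadj
    · have := C.edge hadj
      refine Or.inr ⟨by omega, ?_⟩
      convert SameDiagonal.refl n (C.l t + 1) (C.r t) using 1 <;> omega
    · have := C.edge hadj
      refine Or.inl ⟨by omega, ?_⟩
      convert SameDiagonal.refl n (C.l t) (C.r t + 1) using 1 <;> omega
  · rintro (⟨h1, hs⟩ | ⟨h1, hs⟩)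
    · have heq := C.eq_of_sameDiagonal_arc (C.between_right h1 hj hrt le_rfl (C.l_lt_r t j)) hs
      rcases C.edge (v := t) (w := u) (by omega) with ⟨h2, h3, g⟩ | ⟨h2, h3, g⟩
      · exact g
      · omega
    · have heq := C.eq_of_sameDiagonal_arc
        (C.between_left (by omega) hj hrt le_rfl (C.l_lt_r t j)) hs
      have hne : ¬ (C.l t + 1 = C.r u) := fun h => by
        have := C.r_eq u
        rcases le_total (C.idx t : ℕ) (C.idx u) with h | h
        · have := C.r_mono h
          omega
        · have := C.l_anti h
          omega
      rcases C.edge (v := u) (w := t) (by omega) with ⟨h2, h3, g⟩ | ⟨h2, h3, g⟩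
      · omega
      · exact g

theorem hasArrow_iff {X Y : ClusterObject V} (h : C.At X a b) :
    X.HasArrow Y ↔ C.AtSuccessor Y a b := by
  cases X with
  | rep M hM =>
    obtain ⟨p, q, hpq, ⟨e⟩, hs⟩ := h
    have key : (ClusterObject.rep M hM).HasArrow Y ↔ C.AtSuccessor Y p q := by
      cases Y with
      | rep N hN => exact C.hasArrow_rep_rep hpq e
      | shiftedProjective t => exact C.hasArrow_rep_shift hpq e
    exact key.trans ⟨fun h => h.of_sameDiagonal hs.symm, fun h => h.of_sameDiagonal hs⟩
  | shiftedProjective t =>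
    have key : (ClusterObject.shiftedProjective t).HasArrow Y ↔
        C.AtSuccessor Y (C.l t) (C.r t) := by
      cases Y with
      | rep N hN => exact C.hasArrow_shift_rep t
      | shiftedProjective u => exact C.hasArrow_shift_shift t u
    exact key.trans ⟨fun h' => h'.of_sameDiagonal (SameDiagonal.symm h),
      fun h' => h'.of_sameDiagonal h⟩

/-- All three rules are the rotation by $-1$: almost split sequences for nonprojective
representations, $P_i$ going to the arc of `i`, and the other lift of that arc going to $I_i$. -/
theorem isTau_iff {X Y : ClusterObject V} (h : C.At Y a b) :
    X.IsTau Y ↔ C.At X (a - 1) (b - 1) := by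
  cases Y with
  | rep N hN =>
    obtain ⟨p, q, hpq, ⟨e⟩, hs⟩ := h
    have hs' := hs.shift (-1)
    rw [← sub_eq_add_neg, ← sub_eq_add_neg, ← sub_eq_add_neg, ← sub_eq_add_neg] at hs'
    suffices H : X.IsTau (.rep N hN) ↔ C.At X (p - 1) (q - 1) from
      H.trans ⟨fun h => h.of_sameDiagonal hs'.symm, fun h => h.of_sameDiagonal hs'⟩
    by_cases hP : ∃ i, p = C.l i + 1 ∧ q = C.r i + 1
    · obtain ⟨i, rfl, rfl⟩ := hP
      rw [add_sub_cancel_right, add_sub_cancel_right]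
      cases X with
      | rep M hM =>
        constructor
        · rintro ⟨B, f, g, w, hS⟩
          exact absurd hS (IsProjectiveAt.not_almostSplit ((C.isProjectiveAt_iff e i).2 ⟨rfl, rfl⟩))
        · rintro ⟨p', q', hpq', -, hs⟩
          exact absurd hs.symm (C.not_sameDiagonal_arc hpq')
      | shiftedProjective t =>
        change IsProjectiveAt t N ↔ SameDiagonal n (C.l i) (C.r i) (C.l t) (C.r t)
        rw [C.isProjectiveAt_iff e]
        constructor
        · rintro ⟨h1, h2⟩
          convert SameDiagonal.refl n (C.l i) (C.r i) using 1 <;> omega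
        · intro h
          obtain rfl := C.arc_injective h
          exact ⟨rfl, rfl⟩
    · push Not at hP
      have h' := C.exists_supp_translate hpq fun i hi => hP i hi.1 hi.2
      cases X with
      | rep M hM =>
        change (∃ (B : QuiverRep V) (f : M ⟶ B) (g : B ⟶ N) (w : f ≫ g = 0),
          IsAlmostSplit (ShortComplex.mk f g w)) ↔ _
        rw [C.exists_almostSplit_iff hM hN hpq e fun i hi => hP i hi.1 hi.2]
        exact ⟨fun ⟨e'⟩ => ⟨_, _, h', ⟨e'⟩, .refl _ _ _⟩, fun ⟨p', q', hpq', ⟨e'⟩, hs⟩ => by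
          obtain ⟨rfl, rfl⟩ := C.eq_of_sameDiagonal (C.between_of_supp h') hpq' hs
          exact ⟨e'⟩⟩
      | shiftedProjective t =>
        change IsProjectiveAt t N ↔ SameDiagonal n (p - 1) (q - 1) (C.l t) (C.r t)
        rw [C.isProjectiveAt_iff e]
        exact ⟨fun h => absurd h.2 (hP t h.1), fun h => absurd h (C.not_sameDiagonal_arc h')⟩
  | shiftedProjective i =>
    have hs : SameDiagonal n (a - 1) (b - 1) (C.r i - 1) (C.l i + n + 2) := by
      have := (SameDiagonal.trans h (SameDiagonal.flip n _ _)).shift (-1)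
      convert this using 1 <;> ring
    suffices H : X.IsTau (.shiftedProjective i) ↔ C.At X (C.r i - 1) (C.l i + n + 2) from
      H.trans ⟨fun h => h.of_sameDiagonal hs.symm, fun h => h.of_sameDiagonal hs⟩
    have hI : ∃ v, C.supp (C.r i - 1) (C.l i + n + 2) v := ⟨i, C.supp_injective i⟩
    cases X with
    | rep M hM =>
      obtain ⟨p, q, hpq, ⟨e⟩⟩ := C.exists_iso_thin hM
      change IsInjectiveAt i M ↔ _
      rw [C.isInjectiveAt_iff e, C.at_rep_iff hpq e]
      constructor
      · rintro ⟨rfl, rfl⟩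
        exact .refl _ _ _
      · intro h
        have := C.eq_of_sameDiagonal (C.between_of_supp hI) hpq h
        omega
    | shiftedProjective t =>
      exact ⟨False.elim, fun h => absurd h (C.not_sameDiagonal_arc hI)⟩

/-- An object at each point of the strip. -/
def stripObject (v₀ : V) (r : ℕ) (k : ℤ) : ClusterObject V :=
  open Classical in
  if h : ∃ X, C.At X (k - 1) (k + r) then h.choose else .shiftedProjective v₀

theorem at_stripObject (v₀ : V) {r : ℕ} (hr : stripPoint n r) (k : ℤ) :
    C.At (C.stripObject v₀ r k) (k - 1) (k + r) := by
  have h : ∃ X, C.At X (k - 1) (k + r) := by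
    unfold stripPoint at hr
    exact C.exists_at (by omega) (by omega)
  unfold stripObject
  rw [dif_pos h]
  exact h.choose_spec

theorem stripObject_iso_iff (v₀ : V) {r : ℕ} (hr : stripPoint n r) (k : ℤ) (Y : ClusterObject V) :
    (C.stripObject v₀ r k).Iso Y ↔ C.At Y (k - 1) (k + r) :=
  (C.at_stripObject v₀ hr k).iso_iff

theorem stripArrow_iff (v₀ : V) {r : ℕ} (k : ℤ) (Y : ClusterObject V) :
    (∃ s l, stripPoint n s ∧ StripArrow r k s l ∧ (C.stripObject v₀ s l).Iso Y) ↔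
      (r + 1 ≤ n ∧ C.At Y (k - 1) (k + r + 1)) ∨ (2 ≤ r ∧ r ≤ n + 1 ∧ C.At Y k (k + r)) := by
  constructor
  · rintro ⟨s, l, hs, (⟨rfl, rfl⟩ | ⟨rfl, rfl⟩), h⟩
    · rw [C.stripObject_iso_iff v₀ hs] at h
      push_cast at h
      exact Or.inl ⟨hs.2, by rwa [← add_assoc] at h⟩
    · rw [C.stripObject_iso_iff v₀ hs] at h
      unfold stripPoint at hs
      refine Or.inr ⟨by omega, by omega, ?_⟩
      convert h using 1
      · ring
      · push_cast; ring
  · rintro (⟨h1, h⟩ | ⟨h1, h2, h⟩)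
    · have hs : stripPoint n (r + 1) := ⟨by omega, h1⟩
      refine ⟨r + 1, k, hs, Or.inl ⟨rfl, rfl⟩, (C.stripObject_iso_iff v₀ hs _ _).2 ?_⟩
      push_cast
      rwa [← add_assoc]
    · have hs : stripPoint n (r - 1) := ⟨by omega, by omega⟩
      refine ⟨r - 1, k + 1, hs, Or.inr ⟨by omega, rfl⟩, (C.stripObject_iso_iff v₀ hs _ _).2 ?_⟩
      convert h using 1
      · ring
      · omega

theorem isStripDisplay (v₀ : V) : IsStripDisplay n (C.stripObject v₀) := by
  have hright : ∀ r k, stripPoint n r → ∀ Y : ClusterObject V,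
      ((C.stripObject v₀ r k).HasArrow Y ↔
        ∃ s l, stripPoint n s ∧ StripArrow r k s l ∧ (C.stripObject v₀ s l).Iso Y) := by
    intro r k hr Y
    rw [C.stripArrow_iff, C.hasArrow_iff (C.at_stripObject v₀ hr k)]
    unfold AtSuccessor
    unfold stripPoint at hr
    rw [sub_add_cancel]
    refine or_congr (and_congr_left' (by omega)) ?_
    rw [← and_assoc]
    exact and_congr_left' (by omega)
  refine ⟨?_, ?_, hright, ?_, ?_⟩
  · intro X
    obtain ⟨a, b, h1, h2, h⟩ := C.exists_at_position X
    have hr : stripPoint n (b - a - 1).toNat := ⟨by omega, by omega⟩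
    refine ⟨_, a + 1, hr, (C.stripObject_iso_iff v₀ hr _ _).2 ?_⟩
    convert h using 1 <;> omega
  · intro r k s l hr hs
    rw [C.stripObject_iso_iff v₀ hr, SameDiagonal.glideEquiv_iff]
    exact ⟨fun h => h.unique (C.at_stripObject v₀ hs l),
      fun h => (C.at_stripObject v₀ hs l).of_sameDiagonal h.symm⟩
  · intro r k hr Y
    -- Incoming arrows are read off at their source, wherever it lies. Which lift of the source
    -- precedes $(r,k)$ decides whether it is the left neighbour below or the one above.
    obtain ⟨a, b, h1, h2, h⟩ := C.exists_at_position Y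
    rw [C.hasArrow_iff h]
    have hX := C.at_stripObject v₀ hr k
    constructor
    · rintro (⟨h3, h4⟩ | ⟨h3, h4⟩)
      · rcases h4.unique hX with ⟨hd, hg⟩ | ⟨hd, hg⟩
        · have hs : stripPoint n (r - 1) := ⟨by omega, by have := hr.2; omega⟩
          refine ⟨r - 1, k, hs, Or.inl ⟨by have := hr.1; omega, rfl⟩,
            (C.stripObject_iso_iff v₀ hs _ _).2 (h.of_sameDiagonal (Or.inl ⟨hd, by omega⟩))⟩
        · have hs : stripPoint n (r + 1) := ⟨by omega, by omega⟩
          refine ⟨r + 1, k - 1, hs, Or.inr ⟨rfl, by ring⟩,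
            (C.stripObject_iso_iff v₀ hs _ _).2 (h.of_sameDiagonal (Or.inr ⟨?_, by omega⟩))⟩
          convert hd using 1
          ring
      · rcases h4.unique hX with ⟨hd, hg⟩ | ⟨hd, hg⟩
        · have hs : stripPoint n (r + 1) := ⟨by omega, by omega⟩
          refine ⟨r + 1, k - 1, hs, Or.inr ⟨rfl, by ring⟩,
            (C.stripObject_iso_iff v₀ hs _ _).2 (h.of_sameDiagonal (Or.inl ⟨?_, by omega⟩))⟩
          convert hd using 1
          ring
        · have hs : stripPoint n (r - 1) := ⟨by omega, by have := hr.2; omega⟩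
          refine ⟨r - 1, k, hs, Or.inl ⟨by have := hr.1; omega, rfl⟩,
            (C.stripObject_iso_iff v₀ hs _ _).2 (h.of_sameDiagonal (Or.inr ⟨hd, by omega⟩))⟩
    · rintro ⟨s, l, hs, hsl, hiso⟩
      have hY := (C.stripObject_iso_iff v₀ hs _ _).1 hiso
      refine AtSuccessor.of_sameDiagonal (a := l - 1) (b := l + s) ?_ (hY.unique h)
      unfold stripPoint at hr hs
      rcases hsl with ⟨rfl, rfl⟩ | ⟨rfl, rfl⟩
      · refine Or.inl ⟨by omega, ?_⟩
        convert hX using 1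
        push_cast; ring
      · refine Or.inr ⟨by omega, ?_⟩
        convert hX using 1 <;> push_cast <;> ring
  · intro r k hr Y
    rw [C.stripObject_iso_iff v₀ hr, C.isTau_iff (C.at_stripObject v₀ hr k)]
    rw [show k + (r : ℤ) - 1 = k - 1 + r by ring]

end ZigzagCoords

end StripDisplay

/-! ### Euler characteristics of the empty space and the point, and evaluation at 1 -/

section EulerCharacteristic

/-- Homology of a totally disconnected space sits in degree `0`, where it is a coproduct over the
points, here an empty one. -/
theorem eulerPoincare_of_isEmpty (X : Type) [TopologicalSpace X] [IsEmpty X] :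
    eulerPoincare X = 0 := by
  unfold eulerPoincare
  apply finsum_eq_zero_of_forall_eq_zero
  intro i
  suffices h : Subsingleton (((AlgebraicTopology.singularHomologyFunctor (ModuleCat.{0} ℚ) i).obj
      (ModuleCat.of ℚ ℚ)).obj (TopCat.of X)) by
    rw [Module.finrank_zero_of_subsingleton]
    simp
  have : TotallyDisconnectedSpace (TopCat.of X) := inferInstanceAs (TotallyDisconnectedSpace X)
  rw [← ModuleCat.isZero_iff_subsingleton]
  by_cases hi : i = 0
  · subst hi
    refine IsZero.of_iso ?_
      (AlgebraicTopology.singularHomologyFunctorZeroOfTotallyDisconnectedSpace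
        (ModuleCat.{0} ℚ) (ModuleCat.of ℚ ℚ) (TopCat.of X))
    have : IsEmpty (TopCat.of X) := inferInstanceAs (IsEmpty X)
    rw [IsZero.iff_id_eq_zero]
    exact Sigma.hom_ext _ _ fun x => isEmptyElim x
  · exact AlgebraicTopology.isZero_singularHomologyFunctor_of_totallyDisconnectedSpace _ _ _ _ hi

theorem eulerPoincare_of_unique (X : Type) [TopologicalSpace X] [Unique X] :
    eulerPoincare X = 1 := by
  have : TotallyDisconnectedSpace (TopCat.of X) := inferInstanceAs (TotallyDisconnectedSpace X)
  unfold eulerPoincare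
  rw [finsum_eq_single _ 0]
  · have : Unique (TopCat.of X) := inferInstanceAs (Unique X)
    have e := (AlgebraicTopology.singularHomologyFunctorZeroOfTotallyDisconnectedSpace
      (ModuleCat.{0} ℚ) (ModuleCat.of ℚ ℚ) (TopCat.of X)).toLinearEquiv.finrank_eq
    have e' :=
      (coproductUniqueIso (fun _ : TopCat.of X => ModuleCat.of ℚ ℚ)).toLinearEquiv.finrank_eq
    rw [e, e']
    simp
  · intro i hi
    have h := ModuleCat.isZero_iff_subsingleton.1
      (AlgebraicTopology.isZero_singularHomologyFunctor_of_totallyDisconnectedSpace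
        (ModuleCat.{0} ℚ) i (ModuleCat.of ℚ ℚ) (TopCat.of X) hi)
    rw [Module.finrank_zero_of_subsingleton]
    simp

theorem laurentEval_one_sum {V : Type} [Fintype V] {ι : Type*} (s : Finset ι) (f : ι → V → ℤ)
    (c : ι → ℚ) :
    laurentEval (∑ e ∈ s, AddMonoidAlgebra.single (f e) (c e)) (fun _ => 1) = ∑ e ∈ s, c e := by
  simp only [laurentEval, one_zpow, Finset.prod_const_one, mul_one]
  classical
  induction s using Finset.induction_on with
  | empty => simp
  | insert a s ha ih =>
    rw [Finset.sum_insert ha, Finset.sum_insert ha, AddMonoidAlgebra.coeff_add,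
      Finsupp.sum_add_index', ih]
    · simp
    · simp
    · simp

theorem ComplexGrassmannian.subsingleton (d : ℕ) (W : Type) [AddCommGroup W] [Module ℂ W]
    [FiniteDimensional ℂ W] (h : Module.finrank ℂ W ≤ 1) :
    Subsingleton (ComplexGrassmannian d W) := by
  constructor
  rintro ⟨N, hN⟩ ⟨N', hN'⟩
  apply Subtype.ext
  change N = N'
  rcases Nat.eq_zero_or_pos d with rfl | hd
  · rw [Submodule.finrank_eq_zero.1 hN, Submodule.finrank_eq_zero.1 hN']
  · have := Submodule.finrank_le N
    have := Submodule.finrank_le N'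
    rw [Submodule.eq_top_of_finrank_eq (S := N) (by omega),
      Submodule.eq_top_of_finrank_eq (S := N') (by omega)]

end EulerCharacteristic

/-! ### Quiver Grassmannians of thin representations -/

section ThinGrassmannians

variable {V : Type} [Quiver.{0} V]

namespace QuiverRep

/-- The dimension vector `e` is that of a subrepresentation of a thin representation of
dimension vector `d`. -/
def IsClosedVec (d e : V → ℕ) : Prop :=
  ∀ v w, Nonempty (v ⟶ w) → e v = 1 → d w = 1 → e w = 1

variable {M : QuiverRep V}

theorem quiverGrassmannian_subsingleton (h1 : ∀ v, M.dimVec v ≤ 1) (e : V → ℕ) :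
    Subsingleton (QuiverGrassmannian M e) := by
  constructor
  intro N N'
  apply Subtype.ext
  funext v
  exact (ComplexGrassmannian.subsingleton (e v) (M.space v) (h1 v)).elim _ _

theorem quiverGrassmannian_nonempty (h1 : ∀ v, M.dimVec v ≤ 1) {e : V → ℕ}
    (he : e ≤ M.dimVec)
    (hc : IsClosedVec M.dimVec e) : Nonempty (QuiverGrassmannian M e) := by
  classical
  refine ⟨⟨fun v => ⟨if e v = 0 then ⊥ else ⊤, ?_⟩, ?_⟩⟩
  · have h3 : e v ≤ M.dimVec v := he v
    have h4 := h1 v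
    by_cases h0 : e v = 0
    · rw [if_pos h0, h0]
      exact finrank_bot ℂ _
    · rw [if_neg h0]
      refine (finrank_top ℂ _).trans ?_
      change M.dimVec v = e v
      omega
  · intro v w f
    have h3 : e v ≤ M.dimVec v := he v
    have h4 : e w ≤ M.dimVec w := he w
    have h5 := h1 v
    have h6 := h1 w
    change (if e v = 0 then (⊥ : Submodule ℂ (M.space v)) else ⊤) ≤
      Submodule.comap (M.arrowMap f) (if e w = 0 then (⊥ : Submodule ℂ (M.space w)) else ⊤)
    split_ifs with hv hw hw
    · exact bot_le
    · exact bot_le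
    · have hd : M.dimVec w = 0 := by
        by_contra hd
        have := hc v w ⟨f⟩ (by omega) (by omega)
        omega
      intro z _
      exact (Module.finrank_zero_iff.1 hd).elim _ _
    · exact le_top

theorem isClosedVec_of_nonempty (h1 : ∀ v, M.dimVec v ≤ 1)
    (h2 : ∀ {v w} (f : v ⟶ w), M.dimVec v = 1 → M.dimVec w = 1 →
      Function.Injective (M.arrowMap f))
    {e : V → ℕ} (he : e ≤ M.dimVec)
    (hN : Nonempty (QuiverGrassmannian M e)) : IsClosedVec M.dimVec e := by
  obtain ⟨N, hN⟩ := hN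
  rintro v w ⟨f⟩ hv hw
  by_contra hw'
  have hev : e v ≤ M.dimVec v := he v
  have hew : e w ≤ M.dimVec w := he w
  have hdv := h1 v
  have hv1 : M.dimVec v = 1 := by omega
  have hNw : (N w).1 = ⊥ := Submodule.finrank_eq_zero.1 ((N w).2.trans (by omega))
  have hNv : (N v).1 = ⊤ := Submodule.eq_top_of_finrank_eq ((N v).2.trans (hv.trans hv1.symm))
  have hle := hN v w f
  rw [hNv, hNw] at hle
  have : Subsingleton (M.space v) := ⟨fun z z' => h2 f hv1 hw
    (((Submodule.mem_bot ℂ).1 (hle (x := z) trivial)).trans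
      ((Submodule.mem_bot ℂ).1 (hle (x := z') trivial)).symm)⟩
  have : M.dimVec v = 0 := Module.finrank_zero_of_subsingleton
  omega

-- Each space is at most a line, so a dimension vector determines the subspaces: its Grassmannian is
-- a point if the vector is closed under the arrows and empty otherwise.
open Classical in
theorem number_rep_eq_card [Fintype V] [DecidableEq V] (h1 : ∀ v, M.dimVec v ≤ 1)
    (h2 : ∀ {v w} (f : v ⟶ w), M.dimVec v = 1 → M.dimVec w = 1 →
      Function.Injective (M.arrowMap f))
    (hM : Indecomposable M) :
    (ClusterObject.rep M hM).number =
      ((Finset.Iic M.dimVec).filter (IsClosedVec M.dimVec)).card := by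
  unfold ClusterObject.number
  change laurentEval (clusterCharacter M) _ = _
  unfold clusterCharacter
  rw [laurentEval_one_sum, Finset.card_filter, Nat.cast_sum]
  refine Finset.sum_congr rfl fun e he => ?_
  have he' := Finset.mem_Iic.1 he
  have hs := quiverGrassmannian_subsingleton h1 e
  split_ifs with hc
  · obtain ⟨N⟩ := quiverGrassmannian_nonempty h1 he' hc
    have : Unique (QuiverGrassmannian M e) := ⟨⟨N⟩, fun _ => hs.elim _ _⟩
    rw [eulerPoincare_of_unique]
    norm_num
  · have : IsEmpty (QuiverGrassmannian M e) :=
      not_nonempty_iff.1 fun hN => hc (isClosedVec_of_nonempty h1 h2 he' hN)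
    rw [eulerPoincare_of_isEmpty]
    norm_num

end QuiverRep

theorem ClusterObject.number_shiftedProjective [Fintype V] [DecidableEq V] (i : V) :
    (ClusterObject.shiftedProjective i : ClusterObject V).number = 1 := by
  have h := laurentEval_one_sum (V := V) {()} (fun _ => Pi.single i 1) (fun _ => (1 : ℚ))
  rwa [Finset.sum_singleton, Finset.sum_singleton] at h

namespace ZigzagCoords

variable {n : ℕ} (C : ZigzagCoords V n) {a b : ℤ}

open Classical in
theorem dimVec_of_iso {M : QuiverRep V} (e : M ≅ C.thin a b) (v : V) :
    M.dimVec v = if C.supp a b v then 1 else 0 := by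
  have he : Function.Bijective (QuiverRep.component e.hom v) :=
    ⟨(QuiverRep.injective_of_splitMono _ _ e.hom_inv_id v).injective,
      (QuiverRep.injective_of_splitMono _ _ e.inv_hom_id v).surjective⟩
  have h := (LinearEquiv.ofBijective _ he).finrank_eq
  change Module.finrank ℂ (M.space v) = _
  rw [h]
  split_ifs with hv
  · exact finrank_eq_one_iff_of_nonzero' _ (C.gen_ne_zero hv) |>.2
      fun z => ⟨_, C.coord_smul_gen z⟩
  · rw [Module.finrank_zero_iff]
    exact ⟨fun z z' => C.coord_injective ((C.coord_eq_zero hv z).trans (C.coord_eq_zero hv z').symm)⟩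

theorem arrowMap_injective_of_iso {M : QuiverRep V} (e : M ≅ C.thin a b) {v w : V} (f : v ⟶ w)
    (hv : M.dimVec v = 1) (hw : M.dimVec w = 1) : Function.Injective (M.arrowMap f) := by
  classical
  rw [C.dimVec_of_iso e] at hv hw
  replace hv : C.supp a b v := by by_contra h; simp [h] at hv
  replace hw : C.supp a b w := by by_contra h; simp [h] at hw
  intro z z' h
  apply (QuiverRep.injective_of_splitMono _ _ e.hom_inv_id v).injective
  apply C.coord_injective
  have h' := congrArg (fun t => C.coord a b w (QuiverRep.component e.hom w t)) h
  simp only [QuiverRep.component_naturality_apply] at h'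
  rw [← C.coord_smul_gen (QuiverRep.component e.hom v z),
    ← C.coord_smul_gen (QuiverRep.component e.hom v z'), map_smul, map_smul, map_smul, map_smul,
    C.arrowMap_gen f hv, C.coord_gen hw] at h'
  simpa using h'

end ZigzagCoords

end ThinGrassmannians

/-! ### Counting closed subsets of an oriented path -/

section ClosedSets

open Classical in
/-- The subsets of the path from `s` to `t` that are closed under its arrows, where the edge
between `i` and `i + 1` points to `i + 1` if and only if `d i`. -/
def closedSets (d : ℕ → Prop) (s t : ℕ) : Finset (Finset ℕ) :=
  (Finset.Icc s t).powerset.filter fun E =>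
    ∀ i, s ≤ i → i < t → (d i → i ∈ E → i + 1 ∈ E) ∧ (¬ d i → i + 1 ∈ E → i ∈ E)

variable {d : ℕ → Prop} {s t : ℕ} {E : Finset ℕ}

theorem mem_closedSets : E ∈ closedSets d s t ↔ (∀ i ∈ E, s ≤ i ∧ i ≤ t) ∧
    ∀ i, s ≤ i → i < t → (d i → i ∈ E → i + 1 ∈ E) ∧ (¬ d i → i + 1 ∈ E → i ∈ E) := by
  classical
  unfold closedSets
  rw [Finset.mem_filter, Finset.mem_powerset]
  exact and_congr_left fun _ => forall₂_congr fun i _ => Finset.mem_Icc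

theorem empty_mem_closedSets : ∅ ∈ closedSets d s t := by
  simp [mem_closedSets]

/-- The closed sets that contain the last point. -/
def closedSetsWith (d : ℕ → Prop) (s t : ℕ) : Finset (Finset ℕ) :=
  (closedSets d s t).filter fun E => t ∈ E

/-- The closed sets that do not contain the last point. -/
def closedSetsWithout (d : ℕ → Prop) (s t : ℕ) : Finset (Finset ℕ) :=
  (closedSets d s t).filter fun E => t ∉ E

theorem card_closedSets :
    (closedSets d s t).card = (closedSetsWithout d s t).card + (closedSetsWith d s t).card := by
  unfold closedSetsWith closedSetsWithout
  rw [add_comm]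
  exact (Finset.card_filter_add_card_filter_not _).symm

theorem closedSetsWithout_self : closedSetsWithout d s s = {∅} := by
  ext E
  unfold closedSetsWithout
  rw [Finset.mem_filter, mem_closedSets, Finset.mem_singleton]
  constructor
  · rintro ⟨⟨h, -⟩, h'⟩
    apply Finset.eq_empty_of_forall_notMem
    intro i hi
    have := h i hi
    obtain rfl : i = s := by omega
    exact h' hi
  · rintro rfl
    simp

theorem closedSetsWith_self : closedSetsWith d s s = {{s}} := by
  ext E
  unfold closedSetsWith
  rw [Finset.mem_filter, mem_closedSets, Finset.mem_singleton]
  constructor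
  · rintro ⟨⟨h, -⟩, h'⟩
    ext i
    rw [Finset.mem_singleton]
    constructor
    · intro hi
      have := h i hi
      omega
    · rintro rfl
      exact h'
  · rintro rfl
    refine ⟨⟨?_, ?_⟩, ?_⟩
    · simp
    · intro i h1 h2
      omega
    · simp

/-- The edge points to `t + 1`, so a set avoiding `t + 1` must avoid `t`. -/
theorem closedSetsWithout_succ_of_pos (hst : s ≤ t) (h : d t) :
    closedSetsWithout d s (t + 1) = closedSetsWithout d s t := by
  ext E
  unfold closedSetsWithout
  rw [Finset.mem_filter, Finset.mem_filter, mem_closedSets, mem_closedSets]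
  constructor
  · rintro ⟨⟨h1, h2⟩, h3⟩
    have ht : t ∉ E := fun ht => h3 ((h2 t hst (by omega)).1 h ht)
    refine ⟨⟨fun i hi => ?_, fun i hi hi' => h2 i hi (by omega)⟩, ht⟩
    have := h1 i hi
    have : i ≠ t + 1 := fun h => h3 (h ▸ hi)
    omega
  · rintro ⟨⟨h1, h2⟩, h3⟩
    have ht : t + 1 ∉ E := fun ht => by have := h1 _ ht; omega
    refine ⟨⟨fun i hi => ?_, fun i hi hi' => ?_⟩, ht⟩
    · have := h1 i hi
      omega
    · rcases (by omega : i < t ∨ i = t) with hit | rfl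
      · exact h2 i hi hit
      · exact ⟨fun _ hi => absurd hi h3, fun hd => absurd h hd⟩

/-- The edge leaves `t + 1`, so it imposes nothing on a set avoiding `t + 1`. -/
theorem closedSetsWithout_succ_of_neg (hst : s ≤ t) (h : ¬ d t) :
    closedSetsWithout d s (t + 1) = closedSets d s t := by
  ext E
  unfold closedSetsWithout
  rw [Finset.mem_filter, mem_closedSets, mem_closedSets]
  constructor
  · rintro ⟨⟨h1, h2⟩, h3⟩
    refine ⟨fun i hi => ?_, fun i hi hi' => h2 i hi (by omega)⟩
    have := h1 i hi
    have : i ≠ t + 1 := fun h => h3 (h ▸ hi)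
    omega
  · rintro ⟨h1, h2⟩
    have ht : t + 1 ∉ E := fun ht => by have := h1 _ ht; omega
    refine ⟨⟨fun i hi => ?_, fun i hi hi' => ?_⟩, ht⟩
    · have := h1 i hi
      omega
    · rcases (by omega : i < t ∨ i = t) with hit | rfl
      · exact h2 i hi hit
      · exact ⟨fun hd => absurd hd h, fun _ hi => absurd hi ht⟩

-- Erasing `t + 1` is a bijection; the new edge is the only condition that remains on the shorter
-- path.
open Classical in
theorem card_closedSetsWith_succ (hst : s ≤ t) :
    (closedSetsWith d s (t + 1)).card =
      ((closedSets d s t).filter fun E => ¬ d t → t ∈ E).card := by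
  symm
  have hnot : ∀ E ∈ closedSets d s t, t + 1 ∉ E := by
    intro E hE ht
    have := (mem_closedSets.1 hE).1 _ ht
    omega
  apply Finset.card_nbij' (fun E => insert (t + 1) E) (fun E => E.erase (t + 1))
  · intro E hE
    obtain ⟨hE, hd⟩ := Finset.mem_filter.1 hE
    obtain ⟨h1, h2⟩ := mem_closedSets.1 hE
    refine Finset.mem_filter.2 ⟨mem_closedSets.2 ⟨fun i hi => ?_, fun i hi hi' => ?_⟩,
      Finset.mem_insert_self _ _⟩
    · rcases Finset.mem_insert.1 hi with rfl | hi
      · omega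
      · have := h1 i hi
        omega
    · have hi1 : i ≠ t + 1 := by omega
      simp only [Finset.mem_insert, hi1, false_or]
      rcases (by omega : i < t ∨ i = t) with hit | rfl
      · have := h2 i hi hit
        exact ⟨fun h3 h4 => Or.inr (this.1 h3 h4), fun h3 h4 => this.2 h3
          (h4.resolve_left (by omega))⟩
      · exact ⟨fun _ _ => Or.inl rfl, fun h3 _ => hd h3⟩
  · intro E hE
    obtain ⟨hE, ht⟩ := Finset.mem_filter.1 hE
    obtain ⟨h1, h2⟩ := mem_closedSets.1 hE
    refine Finset.mem_filter.2 ⟨mem_closedSets.2 ⟨fun i hi => ?_, fun i hi hi' => ?_⟩, ?_⟩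
    · have := Finset.mem_erase.1 hi
      have := h1 i this.2
      omega
    · have hi1 : i ≠ t + 1 := by omega
      have hi2 : i + 1 ≠ t + 1 := by omega
      simp only [Finset.mem_erase, hi1, hi2, ne_eq, not_false_eq_true, true_and]
      exact h2 i hi (by omega)
    · intro hd
      exact Finset.mem_erase.2 ⟨by omega, (h2 t hst (by omega)).2 hd ht⟩
  · intro E hE
    exact Finset.erase_insert (hnot E (Finset.mem_filter.1 hE).1)
  · intro E hE
    exact Finset.insert_erase (Finset.mem_filter.1 hE).2

theorem card_closedSetsWith_succ_of_pos (hst : s ≤ t) (h : d t) :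
    (closedSetsWith d s (t + 1)).card = (closedSets d s t).card := by
  classical
  rw [card_closedSetsWith_succ hst, Finset.filter_true_of_mem fun E _ hd => absurd h hd]

theorem card_closedSetsWith_succ_of_neg (hst : s ≤ t) (h : ¬ d t) :
    (closedSetsWith d s (t + 1)).card = (closedSetsWith d s t).card := by
  classical
  rw [card_closedSetsWith_succ hst]
  unfold closedSetsWith
  congr 1
  ext E
  rw [Finset.mem_filter, Finset.mem_filter]
  exact and_congr_right fun _ => ⟨fun h' => h' h, fun h' _ => h'⟩

end ClosedSets

/-! ### Integral vectors whose determinants count closed sets -/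

section FriezeVectors

/-- The determinant of two integral vectors. -/
def det₂ (z w : ℤ × ℤ) : ℤ := z.1 * w.2 - z.2 * w.1

variable {V : Type} [Quiver.{0} V] {n : ℕ}

namespace ZigzagCoords

variable (C : ZigzagCoords V n)

/-- A sequence of integral vectors whose determinants are the entries of the frieze. -/
structure IsFriezeVectors (z : ℤ → ℤ × ℤ) : Prop where
  anti : ∀ j, z (j + n + 3) = - z j
  det : ∀ i, i < n → det₂ (z (C.x i)) (z (C.y i)) = 1
  first : z (C.x 0 + 1) = z (C.x 0) + z (C.y 0)
  left : ∀ i, i + 1 < n → C.x (i + 1) = C.x i - 1 → z (C.x (i + 1)) = z (C.x i) - z (C.y i)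
  right : ∀ i, i + 1 < n → C.x (i + 1) = C.x i → z (C.y (i + 1)) = z (C.y i) - z (C.x i)
  last : ∀ i, i + 1 = n → z (C.y i + 1) = z (C.y i) - z (C.x i)

/-- The `i`-th arc is crossed by the arc from `a` to `b`. -/
def crossedAt (a b : ℤ) (i : ℕ) : Prop :=
  i < n ∧ C.x i < a ∧ a < C.y i ∧ C.y i < b ∧ b < C.x i + n + 3

variable {C} {z : ℤ → ℤ × ℤ} {a b : ℤ} {s t : ℕ}

/-- As the arc crosses no earlier diagonal, `a` is the third vertex of the triangle before the
`s`-th one: the tip of the first ear, or the endpoint of the preceding arc that is left behind. The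
triangle relation then gives both determinants. -/
theorem IsFriezeVectors.det_of_first (hz : C.IsFriezeVectors z) (hs : C.crossedAt a b s)
    (hs' : ∀ i, i + 1 = s → ¬ C.crossedAt a b i) :
    det₂ (z a) (z (C.y s)) = 1 ∧ det₂ (z (C.x s)) (z a) = 1 := by
  have hg := C.gap s
  unfold crossedAt at *
  rcases s with _ | s
  · have ha : a = C.x 0 + 1 := by push_cast at hg; omega
    have hd := hz.det 0 hs.1
    rw [ha, hz.first]
    unfold det₂ at *
    simp only [Prod.fst_add, Prod.snd_add]
    constructor <;> linarith
  · have h' := hs' s rfl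
    have hg' := C.gap s
    have hd := hz.det s (by omega)
    push_cast at hg
    rcases C.step s with h | h
    · have ha : a = C.y s := by omega
      rw [hz.right s hs.1 h, h, ha]
      unfold det₂ at *
      simp only [Prod.fst_sub, Prod.snd_sub]
      constructor <;> linarith
    · have ha : a = C.x s := by omega
      rw [hz.left s hs.1 h, ha, show C.y (s + 1) = C.y s by omega]
      unfold det₂ at *
      simp only [Prod.fst_sub, Prod.snd_sub]
      constructor <;> linarith

/-- Here `b` is the third vertex of the triangle after the last crossed diagonal. If the left end
moves, `b` is the new end shifted by a period, and antiperiodicity supplies the sign. -/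
theorem IsFriezeVectors.det_of_last (hz : C.IsFriezeVectors z) (ht : C.crossedAt a b t)
    (ht' : ¬ C.crossedAt a b (t + 1)) : z b = z (C.y t) - z (C.x t) := by
  have hg := C.gap t
  have hg' := C.gap (t + 1)
  unfold crossedAt at *
  push_cast at hg'
  by_cases h1 : t + 1 = n
  · rw [show b = C.y t + 1 by omega, hz.last t h1]
  · have h2 : t + 1 < n := by omega
    rcases C.step t with h | h
    · rw [show b = C.y (t + 1) by omega, hz.right t h2 h]
    · rw [show b = C.x (t + 1) + n + 3 by omega, hz.anti, hz.left t h2 h, neg_sub]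

theorem IsFriezeVectors.card_closedSets_eq (hz : C.IsFriezeVectors z)
    (h : ∀ i, C.crossedAt a b i ↔ s ≤ i ∧ i ≤ t) (hst : s ≤ t) :
    ((closedSets (fun i => C.x (i + 1) = C.x i - 1) s t).card : ℤ) = det₂ (z a) (z b) := by
  -- Moving one end of the arc changes one of these determinants to their sum and keeps the other,
  -- which is the recursion for the two kinds of closed sets.
  have hmain : ∀ m, s ≤ m → m ≤ t →
      ((closedSetsWithout (fun i => C.x (i + 1) = C.x i - 1) s m).card : ℤ) =
          det₂ (z a) (z (C.y m)) ∧
        ((closedSetsWith (fun i => C.x (i + 1) = C.x i - 1) s m).card : ℤ) =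
          det₂ (z (C.x m)) (z a) := by
    intro m hsm
    induction m, hsm using Nat.le_induction with
    | base =>
      intro _
      rw [closedSetsWith_self, closedSetsWithout_self]
      have := hz.det_of_first ((h s).2 ⟨le_rfl, hst⟩) (fun i hi h' => by have := (h i).1 h'; omega)
      rw [this.1, this.2]
      simp
    | succ m hsm ih =>
      intro hm
      obtain ⟨h0, h1⟩ := ih (by omega)
      have hn := ((h (m + 1)).2 ⟨by omega, hm⟩).1
      have hg := C.gap m
      have hg' := C.gap (m + 1)
      push_cast at hg'
      rcases C.step m with hx | hx
      · have hd : ¬ (C.x (m + 1) = C.x m - 1) := by omega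
        rw [closedSetsWithout_succ_of_neg hsm hd, card_closedSetsWith_succ_of_neg hsm hd,
          card_closedSets, hz.right m hn hx, h1, hx]
        push_cast
        rw [h0, h1]
        unfold det₂
        simp only [Prod.fst_sub, Prod.snd_sub]
        exact ⟨by ring, trivial⟩
      · rw [closedSetsWithout_succ_of_pos hsm hx, card_closedSetsWith_succ_of_pos hsm hx,
          card_closedSets, hz.left m hn hx, h0, show C.y (m + 1) = C.y m by omega]
        push_cast
        rw [h0, h1]
        unfold det₂
        simp only [Prod.fst_sub, Prod.snd_sub]
        exact ⟨trivial, by ring⟩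
  obtain ⟨h0, h1⟩ := hmain t hst le_rfl
  rw [card_closedSets, hz.det_of_last ((h t).2 ⟨hst, le_rfl⟩)
    (fun h' => by have := (h _).1 h'; omega)]
  push_cast
  rw [h0, h1]
  unfold det₂
  simp only [Prod.fst_sub, Prod.snd_sub]
  ring

end ZigzagCoords

end FriezeVectors
-- The numbers of cluster objects as frieze entries
section Numbers

variable {V : Type} [Quiver.{0} V] {n : ℕ}

namespace ZigzagCoords

variable (C : ZigzagCoords V n) {a b : ℤ}

theorem crossedAt_idx {v : V} : C.crossedAt a b (C.idx v) ↔ C.supp a b v := by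
  have := C.idx_lt v
  unfold crossedAt supp l r
  omega

theorem exists_crossedAt_iff (h : ∃ v, C.supp a b v) :
    ∃ s t, s ≤ t ∧ ∀ i, C.crossedAt a b i ↔ s ≤ i ∧ i ≤ t := by
  classical
  obtain ⟨v, hv⟩ := h
  have hv := C.crossedAt_idx.2 hv
  have hex : ∃ i, C.crossedAt a b i := ⟨_, hv⟩
  have ht : C.crossedAt a b (Nat.findGreatest (C.crossedAt a b) n) :=
    Nat.findGreatest_spec (C.idx_lt v).le hv
  have hs := Nat.find_spec hex
  have hle : ∀ i, C.crossedAt a b i → i ≤ Nat.findGreatest (C.crossedAt a b) n :=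
    fun i hi => Nat.le_findGreatest hi.1.le hi
  have hge : ∀ i, C.crossedAt a b i → Nat.find hex ≤ i := fun i hi => Nat.find_min' hex hi
  generalize Nat.findGreatest (C.crossedAt a b) n = t at *
  generalize Nat.find hex = s at *
  refine ⟨s, t, hle _ hs, fun i => ⟨fun hi => ⟨hge i hi, hle i hi⟩, fun hi => ?_⟩⟩
  have := C.x_anti hi.1
  have := C.x_anti hi.2
  have := C.y_mono hi.1
  have := C.y_mono hi.2
  unfold crossedAt at hs ht ⊢
  omega

-- A vector bounded by the indicator of the support is itself an indicator. Along `C.idx`, the arrow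
-- goes to the larger index exactly when the left end moves.
open Classical in
theorem card_isClosedVec [Fintype V] {s t : ℕ} (h : ∀ i, C.crossedAt a b i ↔ s ≤ i ∧ i ≤ t)
    {δ : V → ℕ} (hδ : ∀ v, δ v = if C.supp a b v then 1 else 0) :
    ((Finset.Iic δ).filter (QuiverRep.IsClosedVec δ)).card =
      (closedSets (fun i => C.x (i + 1) = C.x i - 1) s t).card := by
  have hδ1 : ∀ v, δ v = 1 ↔ s ≤ (C.idx v : ℕ) ∧ (C.idx v : ℕ) ≤ t := by
    intro v
    rw [← h, C.crossedAt_idx, hδ]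
    split_ifs with hv <;> simp [hv]
  have hδ2 : ∀ v, δ v ≤ 1 := by
    intro v
    rw [hδ]
    split_ifs <;> omega
  have hidx : ∀ i, s ≤ i → i ≤ t → ∃ v, (C.idx v : ℕ) = i :=
    fun i h1 h2 => C.exists_idx ((h i).2 ⟨h1, h2⟩).1
  apply Finset.card_nbij' (fun e => (Finset.Icc s t).filter fun i => ∃ v, (C.idx v : ℕ) = i ∧ e v = 1)
    (fun E v => if (C.idx v : ℕ) ∈ E then 1 else 0)
  · intro e he
    obtain ⟨he, hc⟩ := Finset.mem_filter.1 he
    refine mem_closedSets.2 ⟨fun i hi => Finset.mem_Icc.1 (Finset.mem_filter.1 hi).1,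
      fun i h1 h2 => ?_⟩
    obtain ⟨v, hv⟩ := hidx i h1 (by omega)
    obtain ⟨w, hw⟩ := hidx (i + 1) (by omega) (by omega)
    have hvw := C.edge (v := v) (w := w) (by omega)
    have hm : ∀ u : V, s ≤ (C.idx u : ℕ) ∧ (C.idx u : ℕ) ≤ t → ((C.idx u : ℕ) ∈
        (Finset.Icc s t).filter (fun i => ∃ v, (C.idx v : ℕ) = i ∧ e v = 1) ↔ e u = 1) := by
      intro u hu
      rw [Finset.mem_filter, Finset.mem_Icc]
      refine ⟨fun ⟨_, u', hu', heu⟩ => ?_, fun heu => ⟨hu, u, rfl, heu⟩⟩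
      rwa [← C.idx_inj hu']
    have hmv := hm v (by omega)
    have hmw := hm w (by omega)
    rw [hv] at hmv
    rw [hw] at hmw
    have hlv : C.l v = C.x i := by unfold l; rw [hv]
    have hlw : C.l w = C.x (i + 1) := by unfold l; rw [hw]
    simp only
    rw [hmv, hmw]
    refine ⟨fun hd hev => hc v w ?_ hev ((hδ1 w).2 (by omega)),
      fun hd hew => hc w v ?_ hew ((hδ1 v).2 (by omega))⟩
    · rcases hvw with hvw | hvw
      · omega
      · exact hvw.2.2
    · rcases hvw with hvw | hvw
      · exact hvw.2.2
      · omega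
  · intro E hE
    obtain ⟨hE, hc⟩ := mem_closedSets.1 hE
    refine Finset.mem_filter.2 ⟨Finset.mem_Iic.2 fun v => ?_, fun v w hvw hv hw => ?_⟩
    · change (if (C.idx v : ℕ) ∈ E then 1 else 0) ≤ δ v
      split_ifs with hv
      · exact ((hδ1 v).2 (hE _ hv)).ge
      · omega
    · have hv' : (C.idx v : ℕ) ∈ E := by
        by_contra hv'
        exact zero_ne_one ((if_neg hv').symm.trans hv)
      refine if_pos ?_
      rw [hδ1] at hw
      have hv1 := hE _ hv'
      obtain ⟨hadj, hx, hy⟩ := (C.hom_iff v w).1 hvw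
      rcases hadj with hadj | hadj
      · have := C.step (C.idx v)
        have := C.gap (C.idx v)
        have := C.gap (C.idx w)
        rw [← hadj] at hx hy this ⊢
        push_cast at *
        exact (hc _ hv1.1 (by omega)).1 (by omega) hv'
      · have := C.step (C.idx w)
        have := C.gap (C.idx v)
        have := C.gap (C.idx w)
        rw [← hadj] at hx hy hv'
        exact (hc _ hw.1 (by omega)).2 (by omega) hv'
  · intro e he
    obtain ⟨he, hc⟩ := Finset.mem_filter.1 he
    funext v
    have h1 : e v ≤ δ v := Finset.mem_Iic.1 he v
    have h2 := hδ2 v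
    have h3 := hδ1 v
    simp only [Finset.mem_filter, Finset.mem_Icc]
    split_ifs with hv
    · obtain ⟨_, u, hu, heu⟩ := hv
      rw [← C.idx_inj hu, heu]
    · by_contra h0
      have h4 : e v = 1 := by omega
      exact hv ⟨h3.1 (by omega), v, rfl, h4⟩
  · intro E hE
    obtain ⟨hE, hc⟩ := mem_closedSets.1 hE
    ext i
    rw [Finset.mem_filter, Finset.mem_Icc]
    constructor
    · rintro ⟨_, v, rfl, hv⟩
      by_contra h0
      exact zero_ne_one ((if_neg h0).symm.trans hv)
    · intro hi
      obtain ⟨v, rfl⟩ := hidx i (hE i hi).1 (hE i hi).2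
      exact ⟨hE _ hi, v, rfl, if_pos hi⟩

variable {C} {z : ℤ → ℤ × ℤ}

theorem IsFriezeVectors.number_rep [Fintype V] [DecidableEq V] (hz : C.IsFriezeVectors z)
    (h : ∃ v, C.supp a b v) {M : QuiverRep V} (hM : Indecomposable M) (e : M ≅ C.thin a b) :
    (ClusterObject.rep M hM).number = det₂ (z a) (z b) ∧ 0 < det₂ (z a) (z b) := by
  classical
  obtain ⟨s, t, hst, hs⟩ := C.exists_crossedAt_iff h
  have hc := C.card_isClosedVec hs (C.dimVec_of_iso e)
  rw [← hz.card_closedSets_eq hs hst, QuiverRep.number_rep_eq_card]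
  · refine ⟨?_, by exact_mod_cast Finset.card_pos.2 ⟨∅, empty_mem_closedSets⟩⟩
    rw [Int.cast_natCast, ← hc]
    congr!
  · intro v
    rw [C.dimVec_of_iso e]
    split_ifs <;> omega
  · exact fun f => C.arrowMap_injective_of_iso e f

theorem det₂_swap (z w : ℤ × ℤ) : det₂ w (-z) = det₂ z w := by
  unfold det₂
  simp only [Prod.fst_neg, Prod.snd_neg]
  ring

theorem det₂_neg_neg (z w : ℤ × ℤ) : det₂ (-z) (-w) = det₂ z w := by
  unfold det₂
  simp only [Prod.fst_neg, Prod.snd_neg]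
  ring

theorem IsFriezeVectors.det_add_mul (hz : C.IsFriezeVectors z) (a b t : ℤ) :
    det₂ (z (a + (n + 3) * t)) (z (b + (n + 3) * t)) = det₂ (z a) (z b) := by
  have h1 : ∀ a b, det₂ (z (a + (n + 3))) (z (b + (n + 3))) = det₂ (z a) (z b) := by
    intro a b
    rw [← add_assoc, ← add_assoc, hz.anti, hz.anti, det₂_neg_neg]
  induction t using Int.induction_on with
  | zero => simp
  | succ t ih =>
    rw [← ih, ← h1 (a + (n + 3) * t) (b + (n + 3) * t)]
    congr 2 <;> ring
  | pred t ih =>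
    rw [← ih, ← h1]
    congr 2 <;> ring

/-- Passing to the other lift swaps the two vectors and negates one of them, so the signs cancel. -/
theorem IsFriezeVectors.det_eq (hz : C.IsFriezeVectors z) {a' b' : ℤ}
    (h : SameDiagonal n a b a' b') : det₂ (z a') (z b') = det₂ (z a) (z b) := by
  rcases h with ⟨⟨t, ht⟩, h⟩ | ⟨⟨t, ht⟩, h⟩
  · rw [show a' = a + (n + 3) * t by linarith, show b' = b + (n + 3) * t by linarith,
      hz.det_add_mul]
  · rw [show a' = b + (n + 3) * t by linarith, show b' = a + n + 3 + (n + 3) * t by linarith,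
      hz.det_add_mul, hz.anti, det₂_swap]

theorem IsFriezeVectors.number_eq [Fintype V] [DecidableEq V] (hz : C.IsFriezeVectors z)
    {X : ClusterObject V} (h : C.At X a b) :
    X.number = det₂ (z a) (z b) ∧ 0 < det₂ (z a) (z b) := by
  cases X with
  | rep M hM =>
    obtain ⟨a', b', hs, ⟨e⟩, hd⟩ := h
    rw [← hz.det_eq hd]
    exact hz.number_rep hs hM e
  | shiftedProjective i =>
    rw [← hz.det_eq h, ClusterObject.number_shiftedProjective]
    have := hz.det (C.idx i) (C.idx_lt i)
    unfold l r
    rw [this]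
    norm_num

/-- On a linearly oriented path the closed sets are the final segments, together with the empty set.
-/
theorem card_closedSets_of_pos {d : ℕ → Prop} {s t : ℕ} (hst : s ≤ t)
    (hd : ∀ i, s ≤ i → i < t → d i) : (closedSets d s t).card = t - s + 2 := by
  suffices h : ∀ m, s ≤ m → m ≤ t →
      (closedSetsWithout d s m).card = 1 ∧ (closedSetsWith d s m).card = m - s + 1 by
    obtain ⟨h0, h1⟩ := h t hst le_rfl
    rw [card_closedSets]
    omega
  intro m hm
  induction m, hm using Nat.le_induction with
  | base => simp [closedSetsWith_self, closedSetsWithout_self]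
  | succ m hm ih =>
    intro hmt
    obtain ⟨h0, h1⟩ := ih (by omega)
    have := hd m hm (by omega)
    rw [closedSetsWithout_succ_of_pos hm this, card_closedSetsWith_succ_of_pos hm this,
      card_closedSets]
    omega

theorem card_closedSets_of_neg {d : ℕ → Prop} {s t : ℕ} (hst : s ≤ t)
    (hd : ∀ i, s ≤ i → i < t → ¬ d i) : (closedSets d s t).card = t - s + 2 := by
  suffices h : ∀ m, s ≤ m → m ≤ t →
      (closedSetsWithout d s m).card = m - s + 1 ∧ (closedSetsWith d s m).card = 1 by
    obtain ⟨h0, h1⟩ := h t hst le_rfl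
    rw [card_closedSets]
    omega
  intro m hm
  induction m, hm using Nat.le_induction with
  | base => simp [closedSetsWith_self, closedSetsWithout_self]
  | succ m hm ih =>
    intro hmt
    obtain ⟨h0, h1⟩ := ih (by omega)
    have := hd m hm (by omega)
    rw [closedSetsWithout_succ_of_neg hm this, card_closedSetsWith_succ_of_neg hm this,
      card_closedSets]
    omega

variable (C) in
/-- The number of arcs that have an endpoint congruent to `k`. -/
def arcCount (k : ℤ) : ℕ :=
  ((Finset.range n).filter fun i => (n : ℤ) + 3 ∣ k - C.x i ∨ (n : ℤ) + 3 ∣ k - C.y i).card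

variable (C) in
theorem bounds {i : ℕ} (hi : i < n) : C.x (n - 1) ≤ C.x i ∧ C.x i ≤ C.x 0 ∧ C.y 0 ≤ C.y i ∧
    C.y i ≤ C.y (n - 1) ∧ C.y 0 = C.x 0 + 2 ∧ C.y (n - 1) = C.x (n - 1) + n + 1 := by
  have h0 := C.gap 0
  have h1 := C.gap (n - 1)
  have := C.x_anti (Nat.zero_le i)
  have := C.y_mono (Nat.zero_le i)
  have := C.x_anti (show i ≤ n - 1 by omega)
  have := C.y_mono (show i ≤ n - 1 by omega)
  push_cast at h0
  omega

variable (C) in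
theorem arcCount_eq_zero {k m : ℤ} (hkm : (n : ℤ) + 3 ∣ k - m)
    (h : ∀ i, i < n → -(n + 3) < m - C.x i ∧ m - C.x i < n + 3 ∧ m - C.x i ≠ 0 ∧
      -(n + 3) < m - C.y i ∧ m - C.y i < n + 3 ∧ m - C.y i ≠ 0) : C.arcCount k = 0 := by
  unfold arcCount
  rw [Finset.card_eq_zero, Finset.filter_eq_empty_iff]
  intro i hi
  have hb := h i (Finset.mem_range.1 hi)
  rintro (h' | h')
  · have := Int.eq_zero_of_dvd_of_lt (by simpa using dvd_sub h' hkm) hb.1 hb.2.1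
    omega
  · have := Int.eq_zero_of_dvd_of_lt (by simpa using dvd_sub h' hkm) hb.2.2.2.1 hb.2.2.2.2.1
    omega

variable (C) in
theorem arcCount_eq_of_crossedAt {k : ℤ} {s t : ℕ} (h : ∀ i, C.crossedAt a b i ↔ s ≤ i ∧ i ≤ t)
    (hk : ∀ i, i < n → (((n : ℤ) + 3 ∣ k - C.x i ∨ (n : ℤ) + 3 ∣ k - C.y i) ↔
      C.crossedAt a b i)) : C.arcCount k = t + 1 - s := by
  unfold arcCount
  rw [← Nat.card_Icc]
  congr 1
  ext i
  rw [Finset.mem_filter, Finset.mem_range, Finset.mem_Icc, ← h]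
  exact ⟨fun hi => (hk i hi.1).1 hi.2, fun hi => ⟨hi.1, (hk i hi.1).2 hi⟩⟩

/-- The diagonal joining the neighbours of `k` crosses exactly the diagonals at `k`. Their lifts
share one endpoint, so they form a linearly oriented path. If that diagonal belongs to the
triangulation, no diagonal ends at `k`. -/
theorem IsFriezeVectors.det_eq_arcCount [Fintype V] [DecidableEq V] (hz : C.IsFriezeVectors z)
    {X : ClusterObject V} {k : ℤ} (h : C.At X (k - 1) (k + 1)) :
    det₂ (z (k - 1)) (z (k + 1)) = C.arcCount k + 1 := by
  cases X with
  | rep M hM =>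
    obtain ⟨a, b, hs, -, hd⟩ := h
    rw [← hz.det_eq hd]
    have hgap := C.gap_of_supp hs
    obtain ⟨v, w, hvw, hb⟩ := C.exists_gap hgap.1 hgap.2
    have hbd := (C.exists_supp_iff_bounds hvw hb).1 hs
    obtain ⟨s, t, hst, hs⟩ := C.exists_crossedAt_iff hs
    have hst' := ((hs t).2 ⟨hst, le_rfl⟩).1
    rw [← hz.card_closedSets_eq hs hst]
    unfold l r at hbd
    rcases hd with ⟨hd, hg⟩ | ⟨hd, hg⟩
    · have hv : (C.idx v : ℕ) = 0 := by omega
      have hw : (C.idx w : ℕ) = n - 1 := by omega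
      rw [hv, hw] at hbd
      -- Here `b = a + 2` and `a + 1` lifts `k`: the crossed arcs share their right end.
      have hiff : ∀ i, i < n → (C.crossedAt a b i ↔ C.y i = a + 1) := by
        intro i hi
        have := C.gap i
        have := C.bounds hi
        unfold crossedAt
        omega
      rw [C.arcCount_eq_of_crossedAt hs, card_closedSets_of_pos hst]
      · push_cast [show s ≤ t + 1 by omega, hst]
        ring
      · intro i h1 h2
        have h3 := (hiff i (by omega)).1 ((hs i).2 (by omega))
        have h4 := (hiff (i + 1) (by omega)).1 ((hs (i + 1)).2 (by omega))
        have := C.gap i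
        have := C.gap (i + 1)
        push_cast at this
        omega
      · intro i hi
        have := C.bounds hi
        rw [hiff i hi]
        constructor
        · rintro (h | h)
          · have := Int.eq_zero_of_dvd_of_lt (N := n + 3) (d := a + 1 - C.x i)
              (by obtain ⟨c, hc⟩ := h; obtain ⟨e, he⟩ := hd; exact ⟨c + e, by linarith⟩) (by omega) (by omega)
            omega
          · have := Int.eq_zero_of_dvd_of_lt (N := n + 3) (d := a + 1 - C.y i)
              (by obtain ⟨c, hc⟩ := h; obtain ⟨e, he⟩ := hd; exact ⟨c + e, by linarith⟩) (by omega) (by omega)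
            omega
        · intro h
          right
          rw [h]
          obtain ⟨e, he⟩ := hd
          exact ⟨-e, by linarith⟩
    · have hv : (C.idx v : ℕ) = n - 1 := by omega
      have hw : (C.idx w : ℕ) = 0 := by omega
      rw [hv, hw] at hbd
      -- Here `[a, b]` is the long lift and `a - 1` lifts `k`: the crossed arcs share their left
      -- end.
      have hiff : ∀ i, i < n → (C.crossedAt a b i ↔ C.x i = a - 1) := by
        intro i hi
        have := C.gap i
        have := C.bounds hi
        unfold crossedAt
        omega
      rw [C.arcCount_eq_of_crossedAt hs, card_closedSets_of_neg hst]
      · push_cast [show s ≤ t + 1 by omega, hst]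
        ring
      · intro i h1 h2
        have h3 := (hiff i (by omega)).1 ((hs i).2 (by omega))
        have h4 := (hiff (i + 1) (by omega)).1 ((hs (i + 1)).2 (by omega))
        omega
      · intro i hi
        have := C.bounds hi
        rw [hiff i hi]
        constructor
        · rintro (h | h)
          · have := Int.eq_zero_of_dvd_of_lt (N := n + 3) (d := a - 1 - C.x i)
              (by obtain ⟨c, hc⟩ := h; obtain ⟨e, he⟩ := hd; exact ⟨c + e, by linarith⟩) (by omega) (by omega)
            omega
          · have := Int.eq_zero_of_dvd_of_lt (N := n + 3) (d := a - 1 - C.y i)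
              (by obtain ⟨c, hc⟩ := h; obtain ⟨e, he⟩ := hd; exact ⟨c + e, by linarith⟩) (by omega) (by omega)
            omega
        · intro h
          left
          rw [h]
          obtain ⟨e, he⟩ := hd
          exact ⟨-e, by linarith⟩
  | shiftedProjective v =>
    rw [← hz.det_eq h]
    unfold l r
    rw [hz.det _ (C.idx_lt v)]
    have hv := C.idx_lt v
    have hr := C.r_eq v
    unfold At at h
    rcases h with ⟨hd, hg⟩ | ⟨hd, hg⟩
    -- `k` is the tip of the ear cut off by the first diagonal.
    · rw [C.arcCount_eq_zero (k := k) (m := C.x 0 + 1)]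
      · rfl
      · rw [show C.x 0 = C.l v by unfold l; congr 1; omega]
        obtain ⟨e, he⟩ := hd
        exact ⟨-e, by linarith⟩
      · intro i hi
        have := C.bounds hi
        omega
    -- `k` is the tip of the ear cut off by the last diagonal.
    · rw [C.arcCount_eq_zero (k := k) (m := C.x (n - 1) - 1)]
      · rfl
      · rw [show C.x (n - 1) = C.l v by unfold l; congr 1; omega]
        obtain ⟨e, he⟩ := hd
        exact ⟨-e, by linarith⟩
      · intro i hi
        have := C.bounds hi
        omega

theorem IsFriezeVectors.isCoxeterConwayFrieze {T : PolygonTriangulation n}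
    {C : ZigzagCoords T.Vertex n} (hz : C.IsFriezeVectors z)
    (hdet : ∀ j, det₂ (z j) (z (j + 1)) = 1) (v₀ : T.Vertex)
    (hval : ∀ k : ℤ, T.valency (k : ZMod (n + 3)) = C.arcCount k) :
    T.IsCoxeterConwayFrieze fun r k => (det₂ (z (k - 1)) (z (k + r)) : ℚ) where
  bottom k := by
    have := hdet (k - 1)
    rw [sub_add_cancel] at this
    rw [Nat.cast_zero, add_zero, this, Int.cast_one]
  first k := by
    have hr : stripPoint n 1 := ⟨le_rfl, by have := C.idx_lt v₀; omega⟩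
    rw [hval]
    have := hz.det_eq_arcCount (k := k) (X := C.stripObject v₀ 1 k) (by
      have := C.at_stripObject v₀ hr k
      rwa [Nat.cast_one] at this)
    rw [Nat.cast_one, this]
    push_cast
    rfl
  diamond r h1 _ k := by
    have e1 := hdet (k - 1)
    have e2 := hdet (k + r)
    rw [sub_add_cancel] at e1
    have e3 : (((r - 1 : ℕ) : ℤ)) = r - 1 := by omega
    rw [e3, show k + 1 + ((r : ℤ) - 1) = k + r by ring, show k + 1 - 1 = k by ring,
      show k + 1 + (r : ℤ) = k + r + 1 by ring,
      show k + ((r + 1 : ℕ) : ℤ) = k + r + 1 by push_cast; ring]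
    norm_cast
    -- The Plücker relation of four vectors; the two determinants of consecutive vectors are `1`.
    have key : det₂ (z (k - 1)) (z (k + r)) * det₂ (z k) (z (k + r + 1)) =
        det₂ (z (k - 1)) (z k) * det₂ (z (k + r)) (z (k + r + 1)) +
          det₂ (z (k - 1)) (z (k + r + 1)) * det₂ (z k) (z (k + r)) := by
      unfold det₂
      ring
    rwa [e1, e2, one_mul] at key
  top k := by
    have := hdet (k - 2)
    rw [show k - 2 + 1 = k - 1 by ring, ← det₂_swap, ← hz.anti] at this
    rw [show k + ((n + 1 : ℕ) : ℤ) = k - 2 + n + 3 by push_cast; ring, this, Int.cast_one]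
  pos r hr k := by
    have hpos : 0 < det₂ (z (k - 1)) (z (k + r)) := by
      rcases (by omega : r = 0 ∨ r = n + 1 ∨ (1 ≤ r ∧ r ≤ n)) with rfl | rfl | hr
      · have := hdet (k - 1)
        rw [sub_add_cancel] at this
        rw [Nat.cast_zero, add_zero, this]
        exact one_pos
      · have := hdet (k - 2)
        rw [show k - 2 + 1 = k - 1 by ring, ← det₂_swap, ← hz.anti] at this
        rw [show k + ((n + 1 : ℕ) : ℤ) = k - 2 + n + 3 by push_cast; ring, this]
        exact one_pos
      · exact (hz.number_eq (C.at_stripObject v₀ hr k)).2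
    exact_mod_cast hpos

end ZigzagCoords

end Numbers

/-! ### Construction of the frieze vectors -/

section FriezeVectorsExistence

/-- The antiperiodic extension of a sequence from the interval `[x, x + N)`. -/
def antiperiodicExtension (x N : ℤ) (w : ℤ → ℤ × ℤ) (j : ℤ) : ℤ × ℤ :=
  if Even ((j - x) / N) then w (x + (j - x) % N) else - w (x + (j - x) % N)

theorem antiperiodicExtension_add {x N : ℤ} (hN : 0 < N) (w : ℤ → ℤ × ℤ) (j : ℤ) :
    antiperiodicExtension x N w (j + N) = - antiperiodicExtension x N w j := by
  unfold antiperiodicExtension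
  rw [show j + N - x = j - x + N by ring, Int.add_ediv_of_dvd_right dvd_rfl,
    Int.ediv_self hN.ne', Int.add_emod_right]
  by_cases h : Even ((j - x) / N)
  · rw [if_pos h, if_neg (Int.not_even_iff_odd.2 h.add_one)]
  · rw [if_neg h, if_pos (Int.not_even_iff_odd.1 h).add_one, neg_neg]

theorem antiperiodicExtension_of_mem {x N : ℤ} (w : ℤ → ℤ × ℤ) {j : ℤ} (h1 : x ≤ j)
    (h2 : j < x + N) : antiperiodicExtension x N w j = w j := by
  unfold antiperiodicExtension
  rw [Int.ediv_eq_zero_of_lt (by omega) (by omega), Int.emod_eq_of_lt (by omega) (by omega),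
    if_pos Even.zero, add_sub_cancel]

namespace ZigzagCoords

variable {V : Type} [Quiver.{0} V] {n : ℕ} (C : ZigzagCoords V n)

/-- The vectors are built triangle by triangle: each new arc adds one point to the window, and the
triangle relation dictates its vector and preserves unimodularity. -/
theorem exists_friezeVectors_window (m : ℕ) : ∃ w : ℤ → ℤ × ℤ,
    (∀ i, i ≤ m → det₂ (w (C.x i)) (w (C.y i)) = 1) ∧
    w (C.x 0 + 1) = w (C.x 0) + w (C.y 0) ∧
    (∀ i, i < m → C.x (i + 1) = C.x i - 1 → w (C.x (i + 1)) = w (C.x i) - w (C.y i)) ∧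
    (∀ i, i < m → C.x (i + 1) = C.x i → w (C.y (i + 1)) = w (C.y i) - w (C.x i)) ∧
    ∀ j, C.x m ≤ j → j < C.y m → det₂ (w j) (w (j + 1)) = 1 := by
  induction m with
  | zero =>
    have hg := C.gap 0
    refine ⟨fun j => if j = C.x 0 then (1, 0) else if j = C.x 0 + 1 then (1, 1) else (0, 1),
      ?_, ?_, ?_, ?_, ?_⟩
    · intro i hi
      obtain rfl : i = 0 := by omega
      simp [hg, det₂]
    · simp [hg]
    · intro i hi
      omega
    · intro i hi
      omega
    · intro j h1 h2
      push_cast at hg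
      rcases (by omega : j = C.x 0 ∨ j = C.x 0 + 1) with rfl | rfl
      · simp [det₂]
      · have h3 : C.x 0 + 1 + 1 ≠ C.x 0 := by omega
        simp [det₂, h3]
  | succ m ih =>
    obtain ⟨w, hdet, hfirst, hleft, hright, hsucc⟩ := ih
    have hg := C.gap m
    have hg' := C.gap (m + 1)
    push_cast at hg'
    have hb : ∀ i, i ≤ m → C.x m ≤ C.x i ∧ C.x i ≤ C.x 0 ∧ C.y i ≤ C.y m ∧ C.y i = C.x i + i + 2 :=
      fun i hi => ⟨C.x_anti hi, C.x_anti (Nat.zero_le _), C.y_mono hi, C.gap i⟩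
    have hdm := hdet m le_rfl
    -- `p` is the endpoint that is new in the arc `m + 1`, outside the old window, and `u` is its
    -- vector.
    obtain ⟨p, u, hp, hpu⟩ : ∃ (p : ℤ) (u : ℤ × ℤ),
        ((C.x (m + 1) = C.x m - 1 ∧ p = C.x m - 1 ∧ C.y (m + 1) = C.y m ∧
            u = w (C.x m) - w (C.y m)) ∨
          (C.x (m + 1) = C.x m ∧ p = C.y m + 1 ∧ C.y (m + 1) = C.y m + 1 ∧
            u = w (C.y m) - w (C.x m))) ∧ (p < C.x m ∨ C.y m < p) := by
      rcases C.step m with h | h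
      · exact ⟨_, _, Or.inr ⟨h, rfl, by omega, rfl⟩, by omega⟩
      · exact ⟨_, _, Or.inl ⟨h, rfl, by omega, rfl⟩, by omega⟩
    have hold : ∀ j, C.x m ≤ j → j ≤ C.y m → Function.update w p u j = w j := by
      intro j h1 h2
      rw [Function.update_of_ne]
      omega
    have hnew : Function.update w p u p = u := Function.update_self _ _ _
    generalize hw' : Function.update w p u = w' at *
    have hdu : (p = C.x m - 1 → det₂ u (w (C.x m)) = 1 ∧ det₂ u (w (C.y m)) = 1) ∧
        (p = C.y m + 1 → det₂ (w (C.y m)) u = 1 ∧ det₂ (w (C.x m)) u = 1) := by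
      unfold det₂ at *
      rcases hp with ⟨-, h2, -, rfl⟩ | ⟨-, h2, -, rfl⟩
      · refine ⟨fun _ => ?_, fun h => by omega⟩
        simp only [Prod.fst_sub, Prod.snd_sub]
        constructor <;> linarith
      · refine ⟨fun h => by omega, fun _ => ?_⟩
        simp only [Prod.fst_sub, Prod.snd_sub]
        constructor <;> linarith
    refine ⟨w', ?_, ?_, ?_, ?_, ?_⟩
    · intro i hi
      rcases (by omega : i ≤ m ∨ i = m + 1) with hi | rfl
      · have := hb i hi
        rw [hold _ (by omega) (by omega), hold _ (by omega) (by omega), hdet i hi]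
      · rcases hp with ⟨h1, h2, h3, -⟩ | ⟨h1, h2, h3, -⟩
        · rw [h1, h3, ← h2, hnew, hold _ (by omega) (by omega)]
          exact (hdu.1 h2).2
        · rw [h1, h3, ← h2, hnew, hold _ (by omega) (by omega)]
          exact (hdu.2 h2).2
    · have := hb 0 (by omega)
      push_cast at this
      rw [hold _ (by omega) (by omega), hold _ (by omega) (by omega),
        hold _ (by omega) (by omega), hfirst]
    · intro i hi hx
      have hbi := hb i (by omega)
      rw [hold (C.x i) (by omega) (by omega), hold (C.y i) (by omega) (by omega)]
      rcases (by omega : i < m ∨ i = m) with hi | rfl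
      · have := hb (i + 1) hi
        rw [hold _ (by omega) (by omega), hleft i hi hx]
      · rcases hp with ⟨h1, h2, h3, h4⟩ | ⟨h1, h2, h3, h4⟩
        · rw [h1, ← h2, hnew, h4]
        · omega
    · intro i hi hx
      have hbi := hb i (by omega)
      rw [hold (C.x i) (by omega) (by omega), hold (C.y i) (by omega) (by omega)]
      rcases (by omega : i < m ∨ i = m) with hi | rfl
      · have := hb (i + 1) hi
        rw [hold _ (by omega) (by omega), hright i hi hx]
      · rcases hp with ⟨h1, h2, h3, h4⟩ | ⟨h1, h2, h3, h4⟩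
        · omega
        · rw [h3, ← h2, hnew, h4]
    · intro j h5 h6
      by_cases hj : C.x m ≤ j ∧ j < C.y m
      · rw [hold _ hj.1 (by omega), hold _ (by omega) (by omega), hsucc j hj.1 hj.2]
      · rcases hp with ⟨h1, h2, h3, -⟩ | ⟨h1, h2, h3, -⟩
        · obtain rfl : j = p := by omega
          rw [hnew, hold _ (by omega) (by omega), show j + 1 = C.x m by omega]
          exact (hdu.1 h2).1
        · obtain rfl : p = j + 1 := by omega
          rw [hnew, hold _ (by omega) (by omega), show j = C.y m by omega]
          exact (hdu.2 h2).1

/-- The window of the last arc misses one vertex of the polygon, the tip `y + 1` of the last ear.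
Its vector comes from the last triangle, and the full period is then extended antiperiodically. -/
theorem exists_isFriezeVectors (hn : 1 ≤ n) :
    ∃ z : ℤ → ℤ × ℤ, C.IsFriezeVectors z ∧ ∀ j, det₂ (z j) (z (j + 1)) = 1 := by
  obtain ⟨w, hdet, hfirst, hleft, hright, hsucc⟩ := C.exists_friezeVectors_window (n - 1)
  have hb := fun i (hi : i < n) => C.bounds hi
  have hb0 := hb 0 (by omega)
  generalize hx : C.x (n - 1) = x at *
  generalize hy : C.y (n - 1) = y at *
  set u := w y - w x with hu
  set z := antiperiodicExtension x (n + 3) (Function.update w (y + 1) u) with hz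
  have hanti : ∀ j, z (j + n + 3) = - z j := fun j => by
    rw [add_assoc]
    exact antiperiodicExtension_add (by omega) _ j
  have hold : ∀ j, x ≤ j → j ≤ y → z j = w j := by
    intro j h1 h2
    rw [hz, antiperiodicExtension_of_mem _ h1 (by omega), Function.update_of_ne (by omega)]
  have hnew : z (y + 1) = u := by
    rw [hz, antiperiodicExtension_of_mem _ (by omega) (by omega), Function.update_self]
  have hd : det₂ (w x) (w y) = 1 := by rw [← hx, ← hy]; exact hdet _ le_rfl
  have hF : C.IsFriezeVectors z := by
    refine ⟨hanti, ?_, ?_, ?_, ?_, ?_⟩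
    · intro i hi
      have := hb i hi
      have := C.gap i
      rw [hold _ (by omega) (by omega), hold _ (by omega) (by omega), hdet i (by omega)]
    · rw [hold _ (by omega) (by omega), hold _ (by omega) (by omega),
        hold _ (by omega) (by omega), hfirst]
    · intro i hi h
      have := hb i (by omega)
      have := hb (i + 1) hi
      have := C.gap i
      rw [hold _ (by omega) (by omega), hold _ (by omega) (by omega),
        hold _ (by omega) (by omega), hleft i (by omega) h]
    · intro i hi h
      have := hb i (by omega)
      have := hb (i + 1) hi
      have := C.gap i
      rw [hold _ (by omega) (by omega), hold _ (by omega) (by omega),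
        hold _ (by omega) (by omega), hright i (by omega) h]
    · intro i hi
      obtain rfl : i = n - 1 := by omega
      rw [hx, hy, hnew, hold _ (by omega) (by omega), hold _ (by omega) (by omega)]
  refine ⟨z, hF, fun j => ?_⟩
  obtain ⟨j', t, h1, h2, rfl⟩ : ∃ j' t : ℤ, x ≤ j' ∧ j' < x + (n + 3) ∧ j = j' + (n + 3) * t := by
    refine ⟨x + (j - x) % (n + 3), (j - x) / (n + 3), ?_, ?_, ?_⟩
    · have := Int.emod_nonneg (j - x) (show (n : ℤ) + 3 ≠ 0 by omega)
      omega
    · have := Int.emod_lt_of_pos (j - x) (show 0 < (n : ℤ) + 3 by omega)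
      omega
    · have := Int.emod_add_mul_ediv (j - x) (n + 3)
      linarith
  rw [show j' + (n + 3) * t + 1 = j' + 1 + (n + 3) * t by ring, hF.det_add_mul]
  rcases (by omega : j' < y ∨ j' = y ∨ j' = y + 1) with hj | rfl | rfl
  · rw [hold _ h1 hj.le, hold _ (by omega) (by omega), hsucc j' h1 hj]
  · rw [hnew, hold _ (by omega) le_rfl, ← hd, hu]
    unfold det₂
    simp only [Prod.fst_sub, Prod.snd_sub]
    ring
  · rw [hnew, show y + 1 + 1 = x + n + 3 by omega, hanti, hold _ le_rfl (by omega), ← hd, hu]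
    unfold det₂
    simp only [Prod.fst_sub, Prod.snd_sub, Prod.fst_neg, Prod.snd_neg]
    ring

end ZigzagCoords

end FriezeVectorsExistence

/-! ### Lifting a triangulation of type A to zigzag coordinates -/

section Triangulations

variable {n : ℕ}

theorem intCast_zmod_eq_iff {x y : ℤ} :
    (x : ZMod (n + 3)) = y ↔ (n : ℤ) + 3 ∣ x - y := by
  rw [eq_comm, ZMod.intCast_eq_intCast_iff_dvd_sub]
  push_cast
  rfl

theorem val_intCast_of_lt {m : ℤ} (h1 : 0 ≤ m) (h2 : m < n + 3) :
    (((m : ZMod (n + 3)).val : ℕ) : ℤ) = m := by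
  rw [ZMod.val_intCast]
  exact Int.emod_eq_of_lt h1 (by push_cast; omega)

theorem ZMod.add_three_natCast_ne_zero {m : ℕ} (h1 : 0 < m) (h2 : m < n + 3) :
    (m : ZMod (n + 3)) ≠ 0 := by
  rw [Ne, ZMod.natCast_eq_zero_iff]
  exact Nat.not_dvd_of_pos_of_lt h1 h2

variable (n) in
/-- The segment between two vertices of the polygon that are given by integers. -/
def arc (x y : ℤ) : Sym2 (ZMod (n + 3)) := s((x : ZMod (n + 3)), (y : ZMod (n + 3)))

theorem arc_swap (x y : ℤ) : arc n y x = arc n x y := Sym2.eq_swap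

theorem intCast_add_period (x : ℤ) : ((x + (n + 3) : ℤ) : ZMod (n + 3)) = x := by
  rw [intCast_zmod_eq_iff]
  simp

theorem arc_flip (x y : ℤ) : arc n y (x + (n + 3)) = arc n x y := by
  unfold arc
  rw [intCast_add_period, Sym2.eq_swap]

theorem mem_arc {k x y : ℤ} :
    (k : ZMod (n + 3)) ∈ arc n x y ↔ (n : ℤ) + 3 ∣ k - x ∨ (n : ℤ) + 3 ∣ k - y := by
  unfold arc
  rw [Sym2.mem_iff, intCast_zmod_eq_iff, intCast_zmod_eq_iff]

theorem arc_bounds {x y : ℤ} (h : IsDiagonal (arc n x y)) (h1 : x < y) (h2 : y < x + (n + 3)) :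
    x + 2 ≤ y ∧ y ≤ x + n + 1 := by
  by_contra hc
  rcases (by omega : y = x + 1 ∨ x + (n + 3) = y + 1) with rfl | h3
  · exact h.2 ⟨x, by unfold arc; push_cast; rfl⟩
  · refine h.2 ⟨y, ?_⟩
    rw [← arc_flip, h3]
    unfold arc
    push_cast
    rfl

theorem exists_arc {D : Sym2 (ZMod (n + 3))} (h : IsDiagonal D) :
    ∃ x y : ℤ, D = arc n x y ∧ x + 2 ≤ y ∧ y ≤ x + n + 1 := by
  induction D using Sym2.inductionOn with
  | hf a b =>
    have ha : ((a.val : ℤ) : ZMod (n + 3)) = a := by simp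
    have hb : ((b.val : ℤ) : ZMod (n + 3)) = b := by simp
    have hab : a.val ≠ b.val := fun hab => h.1 (ZMod.val_injective _ hab)
    have hla := a.val_lt
    have hlb := b.val_lt
    rcases lt_or_gt_of_ne hab with hab | hab
    · have he : s(a, b) = arc n a.val b.val := by unfold arc; rw [ha, hb]
      rw [he] at h ⊢
      exact ⟨_, _, rfl, arc_bounds h (by omega) (by omega)⟩
    · have he : s(a, b) = arc n b.val a.val := by unfold arc; rw [ha, hb, Sym2.eq_swap]
      rw [he] at h ⊢
      exact ⟨_, _, rfl, arc_bounds h (by omega) (by omega)⟩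

theorem crosses_arc {x y c d : ℤ} (h1 : x < c) (h2 : c < y) (h3 : y < d) (h4 : d < x + (n + 3)) :
    Crosses (arc n x y) (arc n c d) := by
  refine ⟨x, y, c, d, rfl, rfl, ?_⟩
  rw [← Int.cast_sub, ← Int.cast_sub, ← Int.cast_sub]
  have e1 := val_intCast_of_lt (n := n) (m := c - x) (by omega) (by omega)
  have e2 := val_intCast_of_lt (n := n) (m := y - x) (by omega) (by omega)
  have e3 := val_intCast_of_lt (n := n) (m := d - x) (by omega) (by omega)
  omega

theorem val_sub_one_lt {a : ZMod (n + 3)} (h : a ≠ 0) : (a - 1).val < a.val := by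
  have hv : a.val ≠ 0 := fun h' => h ((ZMod.val_eq_zero a).1 h')
  have hl := a.val_lt
  have h1 := val_intCast_of_lt (n := n) (m := (a.val : ℤ) - 1) (by omega) (by omega)
  rw [Int.cast_sub, Int.cast_natCast, ZMod.natCast_zmod_val, Int.cast_one] at h1
  omega

namespace PolygonTriangulation

variable (T : PolygonTriangulation n)

theorem ne_of_mem {v a : ZMod (n + 3)} (h : s(v, a) ∈ T.diagonals) : v ≠ a :=
  fun hva => (T.isDiagonal _ h).1 hva

theorem arrow_or_arrow {v a b : ZMod (n + 3)} {D E : T.Vertex} (hD : D.1 = s(v, a))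
    (hE : E.1 = s(v, b)) (hab : a ≠ b) (h : IsSide s(a, b) ∨ s(a, b) ∈ T.diagonals) :
    (SimpleGraph.fromRel T.Arrow).Adj D E := by
  rw [SimpleGraph.fromRel_adj]
  constructor
  · intro hDE
    rw [← hDE, hD] at hE
    exact hab (Sym2.congr_right.1 hE)
  · have hne : (a - v).val ≠ (b - v).val := fun h' => hab (sub_left_injective (ZMod.val_injective _ h'))
    rcases lt_or_gt_of_ne hne with h' | h'
    · exact Or.inr ⟨v, b, a, hE, hD, by rwa [Sym2.eq_swap], h'⟩
    · exact Or.inl ⟨v, a, b, hD, hE, h, h'⟩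

variable {T}

/-- A triangle made of three diagonals would be a 3-cycle in a path graph. So the third edge is a
side of the polygon, and an arrow moves one endpoint back by one vertex. -/
theorem IsTypeA.arrow_iff (hT : T.IsTypeA) {D E : T.Vertex} :
    T.Arrow D E ↔ ∃ v a, D.1 = s(v, a) ∧ E.1 = s(v, a - 1) := by
  constructor
  · rintro ⟨v, a, b, hD, hE, hab, hlt⟩
    have hva : v ≠ a := T.ne_of_mem (hD ▸ D.2)
    have hvb : v ≠ b := T.ne_of_mem (hE ▸ E.2)
    have hne : a ≠ b := fun h => by rw [h] at hlt; exact lt_irrefl _ hlt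
    have hside : IsSide s(a, b) := by
      rcases hab with hab | hG
      · exact hab
      exfalso
      obtain ⟨φ⟩ := hT
      have h1 := T.arrow_or_arrow hD hE hne (Or.inr hG)
      have h2 := T.arrow_or_arrow (D := ⟨_, hG⟩) (E := D) (v := a) (a := b) (b := v) rfl
        (hD.trans Sym2.eq_swap) hvb.symm (Or.inr (by rw [Sym2.eq_swap, ← hE]; exact E.2))
      have h3 := T.arrow_or_arrow (D := ⟨_, hG⟩) (E := E) (v := b) (a := a) (b := v) Sym2.eq_swap
        (hE.trans Sym2.eq_swap) hva.symm (Or.inr (by rw [Sym2.eq_swap, ← hD]; exact D.2))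
      rw [← φ.map_adj_iff, SimpleGraph.pathGraph_adj] at h1 h2 h3
      omega
    obtain ⟨c, hc⟩ := hside
    rcases Sym2.eq_iff.1 hc with ⟨rfl, rfl⟩ | ⟨rfl, rfl⟩
    · exfalso
      -- The opposite orientation of the side would put `a` before `b` on the clockwise way from
      -- `v`.
      have h0 : a + 1 - v ≠ 0 := fun h => hvb (sub_eq_zero.1 h).symm
      have := val_sub_one_lt h0
      rw [show a + 1 - v - 1 = a - v by ring] at this
      omega
    · exact ⟨v, b + 1, hD, by rw [hE, add_sub_cancel_right]⟩
  · rintro ⟨v, a, hD, hE⟩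
    refine ⟨v, a, a - 1, hD, hE, Or.inl ⟨a - 1, by rw [sub_add_cancel, Sym2.eq_swap]⟩, ?_⟩
    have hva : v ≠ a := T.ne_of_mem (hD ▸ D.2)
    rw [show a - 1 - v = a - v - 1 by ring]
    exact val_sub_one_lt (sub_ne_zero.2 hva.symm)

theorem IsTypeA.arrow_asymm (hT : T.IsTypeA) {D E : T.Vertex} (h : T.Arrow D E) :
    ¬ T.Arrow E D := by
  rw [hT.arrow_iff] at h ⊢
  obtain ⟨v, a, hD, hE⟩ := h
  rintro ⟨w, c, hE', hD'⟩
  have h1 : (1 : ZMod (n + 3)) ≠ 0 := by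
    exact_mod_cast ZMod.add_three_natCast_ne_zero (n := n) (m := 1) (by omega) (by omega)
  have h2 : (2 : ZMod (n + 3)) ≠ 0 := by
    exact_mod_cast ZMod.add_three_natCast_ne_zero (n := n) (m := 2) (by omega) (by omega)
  have hv : v ≠ a - 1 := T.ne_of_mem (hE ▸ E.2)
  rw [hD] at hD'
  rw [hE] at hE'
  rcases Sym2.eq_iff.1 hE' with ⟨rfl, rfl⟩ | ⟨rfl, rfl⟩
  · have h3 := Sym2.congr_right.1 hD'
    exact h2 (by linear_combination h3)
  · rcases Sym2.eq_iff.1 hD' with ⟨h3, -⟩ | ⟨-, h3⟩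
    · exact hv h3
    · exact h1 (by linear_combination h3)

/-- The arcs that are obtained from `(x, y)` by moving one end outwards. -/
def IsExpansion (D : Sym2 (ZMod (n + 3))) (x y : ℤ) : Prop :=
  D = arc n x (y + 1) ∨ D = arc n (x - 1) y

theorem IsTypeA.neighbour (hT : T.IsTypeA) {D E : T.Vertex} {x y : ℤ} (hD : D.1 = arc n x y)
    (h : (SimpleGraph.fromRel T.Arrow).Adj D E) :
    IsExpansion E.1 x y ∨ E.1 = arc n x (y - 1) ∨ E.1 = arc n (x + 1) y := by
  rw [SimpleGraph.fromRel_adj, hT.arrow_iff, hT.arrow_iff] at h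
  unfold IsExpansion arc
  unfold arc at hD
  push_cast
  rcases h.2 with ⟨v, a, hD', hE⟩ | ⟨v, a, hE, hD'⟩
  · rw [hD] at hD'
    rcases Sym2.eq_iff.1 hD' with ⟨rfl, rfl⟩ | ⟨rfl, rfl⟩
    · exact Or.inr (Or.inl hE)
    · exact Or.inl (Or.inr (hE.trans Sym2.eq_swap))
  · obtain ⟨c, rfl⟩ : ∃ c, a = c + 1 := ⟨a - 1, (sub_add_cancel a 1).symm⟩
    rw [add_sub_cancel_right, hD] at hD'
    rcases Sym2.eq_iff.1 hD' with ⟨rfl, rfl⟩ | ⟨rfl, rfl⟩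
    · exact Or.inl (Or.inl hE)
    · exact Or.inr (Or.inr (hE.trans Sym2.eq_swap))

/-- Of the two lifts of a diagonal, one sees a given neighbour as an expansion, since flipping turns
contractions into expansions. -/
theorem IsTypeA.exists_expansion (hT : T.IsTypeA) {D E : T.Vertex}
    (h : (SimpleGraph.fromRel T.Arrow).Adj D E) :
    ∃ x y : ℤ, D.1 = arc n x y ∧ x + 2 ≤ y ∧ y ≤ x + n + 1 ∧ IsExpansion E.1 x y := by
  obtain ⟨x, y, hD, h1, h2⟩ := exists_arc (T.isDiagonal _ D.2)
  rcases hT.neighbour hD h with hE | hE | hE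
  · exact ⟨x, y, hD, h1, h2, hE⟩
  · refine ⟨y, x + (n + 3), by rw [arc_flip, hD], by omega, by omega, Or.inr ?_⟩
    rw [arc_flip, hE]
  · refine ⟨y, x + (n + 3), by rw [arc_flip, hD], by omega, by omega, Or.inl ?_⟩
    rw [hE, ← arc_flip]
    congr 1
    ring

/-- Once the arcs grow they keep growing: of the two contractions of the second arc, one is the
first arc and the other crosses it. -/
theorem IsTypeA.expansion_step (hT : T.IsTypeA) {D E G : T.Vertex} {x y x' y' : ℤ}
    (hD : D.1 = arc n x y) (h1 : x + 2 ≤ y) (hE : E.1 = arc n x' y') (h2 : y' ≤ x' + n + 1)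
    (hxy : (x' = x ∧ y' = y + 1) ∨ (x' = x - 1 ∧ y' = y))
    (h : (SimpleGraph.fromRel T.Arrow).Adj E G) (hDG : G ≠ D) : IsExpansion G.1 x' y' := by
  have hne : G.1 ≠ arc n x y := fun hG => hDG (Subtype.ext (hG.trans hD.symm))
  rcases hT.neighbour hE h with hG | hG | hG
  · exact hG
  · exfalso
    rcases hxy with ⟨rfl, rfl⟩ | ⟨rfl, rfl⟩
    · rw [add_sub_cancel_right] at hG
      exact hne hG
    · refine T.noncrossing _ G.2 _ D.2 ?_
      rw [hG, hD]
      exact crosses_arc (by omega) (by omega) (by omega) (by omega)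
  · exfalso
    rcases hxy with ⟨rfl, rfl⟩ | ⟨rfl, rfl⟩
    · refine T.noncrossing _ D.2 _ G.2 ?_
      rw [hG, hD]
      exact crosses_arc (by omega) (by omega) (by omega) (by omega)
    · rw [sub_add_cancel] at hG
      exact hne hG

open Classical in
/-- Lift a sequence of arcs, each of which is an expansion of the preceding one. -/
def liftArcs (D : ℕ → Sym2 (ZMod (n + 3))) (p : ℤ × ℤ) : ℕ → ℤ × ℤ
  | 0 => p
  | i + 1 => if D (i + 1) = arc n ((liftArcs D p i).1 - 1) (liftArcs D p i).2 then
      ((liftArcs D p i).1 - 1, (liftArcs D p i).2)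
    else ((liftArcs D p i).1, (liftArcs D p i).2 + 1)

theorem liftArcs_succ (D : ℕ → Sym2 (ZMod (n + 3))) (p : ℤ × ℤ) (i : ℕ) :
    ((liftArcs D p (i + 1)).1 = (liftArcs D p i).1 ∧
      (liftArcs D p (i + 1)).2 = (liftArcs D p i).2 + 1) ∨
    ((liftArcs D p (i + 1)).1 = (liftArcs D p i).1 - 1 ∧
      (liftArcs D p (i + 1)).2 = (liftArcs D p i).2) := by
  rw [liftArcs]
  split_ifs
  · exact Or.inr ⟨rfl, rfl⟩
  · exact Or.inl ⟨rfl, rfl⟩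

theorem eq_arc_liftArcs_succ {D : ℕ → Sym2 (ZMod (n + 3))} {p : ℤ × ℤ} {i : ℕ}
    (h : IsExpansion (D (i + 1)) (liftArcs D p i).1 (liftArcs D p i).2) :
    D (i + 1) = arc n (liftArcs D p (i + 1)).1 (liftArcs D p (i + 1)).2 := by
  rw [liftArcs]
  split_ifs with h'
  · exact h'
  · exact h.resolve_right h'

theorem IsTypeA.exists_lift (hn : 1 ≤ n) (hT : T.IsTypeA)
    (φ : SimpleGraph.fromRel T.Arrow ≃g SimpleGraph.pathGraph n) :
    ∃ x y : ℕ → ℤ, (∀ i : ℕ, y i = x i + i + 2) ∧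
      (∀ i : ℕ, x (i + 1) = x i ∨ x (i + 1) = x i - 1) ∧
      ∀ D : T.Vertex, D.1 = arc n (x (φ D)) (y (φ D)) := by
  have hex : ∃ D : ℕ → T.Vertex, ∀ i (hi : i < n), φ (D i) = ⟨i, hi⟩ := by
    -- Indices from `n` on get an arbitrary diagonal; the lifted sequence still moves by unit steps
    -- there.
    refine ⟨fun i => if hi : i < n then φ.symm ⟨i, hi⟩ else φ.symm ⟨0, hn⟩, fun i hi => ?_⟩
    exact (congrArg φ (dif_pos hi)).trans (φ.apply_symm_apply _)
  obtain ⟨D, hφ⟩ := hex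
  have hadj : ∀ i, i + 1 < n → (SimpleGraph.fromRel T.Arrow).Adj (D i) (D (i + 1)) := by
    intro i hi
    rw [← φ.map_adj_iff, hφ i (by omega), hφ (i + 1) hi, SimpleGraph.pathGraph_adj]
    exact Or.inl rfl
  obtain ⟨x₀, y₀, h0, h1, h2, h3⟩ : ∃ x y : ℤ, (D 0).1 = arc n x y ∧ x + 2 ≤ y ∧ y ≤ x + n + 1 ∧
      (1 < n → IsExpansion (D 1).1 x y) := by
    by_cases hn1 : 1 < n
    · obtain ⟨x, y, h0, h1, h2, h3⟩ := hT.exists_expansion (hadj 0 hn1)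
      exact ⟨x, y, h0, h1, h2, fun _ => h3⟩
    · obtain ⟨x, y, h0, h1, h2⟩ := exists_arc (T.isDiagonal _ (D 0).2)
      exact ⟨x, y, h0, h1, h2, fun h => absurd h hn1⟩
  set p := liftArcs (fun i => (D i).1) (x₀, y₀) with hp
  have hstep := liftArcs_succ (fun i => (D i).1) (x₀, y₀)
  rw [← hp] at hstep
  have hlen : ∀ i : ℕ, (p i).2 = (p i).1 + i + (y₀ - x₀) := by
    intro i
    induction i with
    | zero => simp [hp, liftArcs]
    | succ i ih =>
      have := hstep i
      push_cast
      omega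
  have main : ∀ i, i < n → (D i).1 = arc n (p i).1 (p i).2 ∧ (p i).2 ≤ (p i).1 + n + 1 ∧
      (i + 1 < n → IsExpansion (D (i + 1)).1 (p i).1 (p i).2) := by
    intro i
    induction i with
    | zero => exact fun _ => ⟨h0, h2, h3⟩
    | succ i ih =>
      intro hi
      obtain ⟨h4, h5, h6⟩ := ih (by omega)
      have h7 := eq_arc_liftArcs_succ (D := fun i => (D i).1) (p := (x₀, y₀)) (h6 hi)
      rw [← hp] at h7
      have h8 := hlen i
      have h9 := hstep i
      have h10 := arc_bounds (h7 ▸ T.isDiagonal _ (D (i + 1)).2) (by omega) (by omega)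
      refine ⟨h7, h10.2, fun hi' => ?_⟩
      refine hT.expansion_step h4 (by omega) h7 h10.2 h9 (hadj (i + 1) hi') fun h => ?_
      have h' := congrArg φ h
      rw [hφ _ hi', hφ _ (by omega)] at h'
      have := congrArg Fin.val h'
      simp only at this
      omega
  -- Lengths grow by one and lie between `2` and `n + 1`, so `n` arcs leave no choice for the first
  -- one.
  have h00 : y₀ = x₀ + 2 := by
    have := (main (n - 1) (by omega)).2.1
    have := hlen (n - 1)
    omega
  refine ⟨fun i => (p i).1, fun i => (p i).2, fun i => ?_, fun i => ?_, fun E => ?_⟩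
  · have := hlen i
    simp only
    omega
  · have := hstep i
    simp only
    omega
  · have := (main (φ E) (φ E).2).1
    rwa [show D (φ E) = E from φ.injective (hφ _ _)] at this

theorem IsTypeA.exists_zigzagCoords (hn : 1 ≤ n) (hT : T.IsTypeA) :
    ∃ C : ZigzagCoords T.Vertex n, ∀ k : ℤ, T.valency (k : ZMod (n + 3)) = C.arcCount k := by
  obtain ⟨φ⟩ := id hT
  obtain ⟨x, y, hgap, hstep, hD⟩ := hT.exists_lift hn φ
  have hxmove : ∀ v w : T.Vertex, (φ v : ℕ) + 1 = φ w → x (φ w) = x (φ v) - 1 → T.Arrow v w := by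
    intro v w hvw hx
    rw [hT.arrow_iff]
    have h1 := hgap (φ v)
    have h2 := hgap (φ w)
    refine ⟨y (φ v), x (φ v), by rw [hD v, ← arc_swap]; rfl, ?_⟩
    rw [hD w, hx, show y (φ w) = y (φ v) by omega, ← arc_swap]
    unfold arc
    push_cast
    rfl
  have hymove : ∀ v w : T.Vertex, (φ v : ℕ) + 1 = φ w → x (φ w) = x (φ v) → T.Arrow w v := by
    intro v w hvw hx
    rw [hT.arrow_iff]
    have h1 := hgap (φ v)
    have h2 := hgap (φ w)
    refine ⟨x (φ v), y (φ w), by rw [hD w, hx]; rfl, ?_⟩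
    rw [hD v, show y (φ v) = y (φ w) - 1 by omega]
    unfold arc
    push_cast
    rfl
  have hstep' : ∀ v w : T.Vertex, (φ v : ℕ) + 1 = φ w →
      x (φ w) = x (φ v) ∨ x (φ w) = x (φ v) - 1 := by
    intro v w hvw
    rw [← hvw]
    exact hstep _
  refine ⟨⟨φ.toEquiv, x, y, hgap, hstep, fun v w => ?_, fun v w => ?_⟩, fun k => ?_⟩
  · change Nonempty (PLift (T.Arrow v w)) ↔ ((φ v : ℕ) + 1 = φ w ∨ (φ w : ℕ) + 1 = φ v) ∧
      x (φ w) ≤ x (φ v) ∧ y (φ w) ≤ y (φ v)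
    rw [nonempty_plift, nonempty_prop]
    have h1 := hgap (φ v)
    have h2 := hgap (φ w)
    constructor
    · intro h
      have hadj : (SimpleGraph.fromRel T.Arrow).Adj v w := by
        rw [SimpleGraph.fromRel_adj]
        exact ⟨fun hvw => by subst hvw; exact hT.arrow_asymm h h, Or.inl h⟩
      rw [← φ.map_adj_iff, SimpleGraph.pathGraph_adj] at hadj
      refine ⟨hadj, ?_⟩
      rcases hadj with hvw | hvw
      · rcases hstep' v w hvw with hx | hx
        · exact absurd (hymove v w hvw hx) (hT.arrow_asymm h)
        · omega
      · rcases hstep' w v hvw with hx | hx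
        · omega
        · exact absurd (hxmove w v hvw hx) (hT.arrow_asymm h)
    · rintro ⟨hvw | hvw, hx, hy⟩
      · refine hxmove v w hvw ((hstep' v w hvw).resolve_left fun _ => ?_)
        omega
      · refine hymove w v hvw ((hstep' w v hvw).resolve_right fun _ => ?_)
        omega
  · exact inferInstanceAs (Subsingleton (PLift (T.Arrow v w)))
  · unfold valency ZigzagCoords.arcCount
    symm
    change ((Finset.range n).filter fun i => (n : ℤ) + 3 ∣ k - x i ∨ (n : ℤ) + 3 ∣ k - y i).card = _
    have hD' : ∀ i : Fin n, (φ.symm i).1 = arc n (x i) (y i) := by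
      intro i
      rw [hD, φ.apply_symm_apply]
    apply Finset.card_bij (fun i hi =>
      (φ.symm ⟨i, Finset.mem_range.1 (Finset.mem_filter.1 hi).1⟩).1)
    · intro i hi
      refine Finset.mem_filter.2 ⟨(φ.symm _).2, ?_⟩
      rw [hD', mem_arc]
      exact (Finset.mem_filter.1 hi).2
    · intro i hi j hj h
      exact congrArg Fin.val (φ.symm.injective (Subtype.ext h))
    · intro D hDk
      obtain ⟨hDT, hk⟩ := Finset.mem_filter.1 hDk
      refine ⟨φ ⟨D, hDT⟩, Finset.mem_filter.2 ⟨Finset.mem_range.2 (φ ⟨D, hDT⟩).2, ?_⟩, ?_⟩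
      · rw [← mem_arc, ← hD]
        exact hk
      · simp only [Fin.eta]
        rw [φ.symm_apply_apply]

end PolygonTriangulation

end Triangulations

end

/-! ### The proposition, assembled from the display and the frieze vectors -/

theorem mainTheorem6 (n : ℕ) (hn : 1 ≤ n) (T : PolygonTriangulation n) (hT : T.IsTypeA) :
    ∃ (p : ℕ → ℤ → ClusterObject T.Vertex) (F : ℕ → ℤ → ℚ),
      IsStripDisplay n p ∧ T.IsCoxeterConwayFrieze F ∧
        ∀ r k, stripPoint n r → ∀ M : ClusterObject T.Vertex,
          (p r k).Iso M → M.number = F r k := by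
  obtain ⟨C, hval⟩ := hT.exists_zigzagCoords hn
  obtain ⟨z, hz, hdet⟩ := C.exists_isFriezeVectors hn
  obtain ⟨v₀, -⟩ := C.exists_idx hn
  exact ⟨C.stripObject v₀, _, C.isStripDisplay v₀, hz.isCoxeterConwayFrieze hdet v₀ hval,
    fun r k hr M hM => (hz.number_eq ((C.stripObject_iso_iff v₀ hr k M).1 hM)).1⟩
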